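/- Let $\Theta(s)=\frac12(s-s^{-1})$, $\langle x\rangle=(1+x^2)^{1/2}$, and for $h:\mathbb R\to\mathbb C$ let $$\mathcal P^{\pm}[h](z)=\lim_{\varepsilon\downarrow0}\frac1{2\pi i}\int_{\mathbb R}\frac{h(s)}{s-(z\pm i\varepsilon)}\,ds,\qquad z\in\mathbb R .$$ For $S\subset\mathbb R$ and $m\in\mathbb Z$ let $\dot L^{2,m}(S)$ be the space of measurable $f$ with $\|f\|_{\dot L^{2,m}(S)}=\big(\int_S|s|^{2m}|f(s)|^2ds\big)^{1/2}<\infty$, and let $L^{2,1}(\mathbb R)=\dot L^{2,1}(\mathbb R)\cap L^2(\mathbb R)$ with norm $\|f\|_{\dot L^{2,1}(\mathbb R)}+\|f\|_{L^2(\mathbb R)}$. Let $X_0=H^1(\mathbb R\setminus[-1,1])\cap\dot H^{1,1}([-1,1])\cap\dot L^{2,-1}([-1,1])$, that is, the space of functions $f:\mathbb R\to\mathbb C$ that have a locally integrable weak derivative $f'$ on $\mathbb R\setminus\{0\}$ (in particular, without jumps at $\pm1$) and for which $$\|f\|_{X_0}=\|f\|_{L^2(\mathbb R\setminus[-1,1])}+\|f'\|_{L^2(\mathbb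 R\setminus[-1,1])}+\|f'\|_{\dot L^{2,1}([-1,1])}+\|f\|_{\dot L^{2,-1}([-1,1])}<\infty .$$ There is a constant $C>0$ such that the following hold, for the upper signs and for the lower signs. In each case the integrals converge absolutely, the limit that defines $\mathcal P^\pm$ exists for almost every $z\in\mathbb R$, and the resulting function lies in the indicated $L^2(\mathbb R)$ or $L^\infty(\mathbb R)$. 1. For all $x_0>0$ and all $f\in X_0$, $$\sup_{x\in(x_0,\infty)}\big\|\langle x\rangle\,\mathcal P^{\pm}[f e^{\mp ix\Theta}]\big\|_{L^2(\mathbb R)}\le C\|f\|_{X_0}.$$ 2. For all $f\in X_0\cap\dot L^{2,-1}(\mathbb R)$, $$\sup_{x\in\mathbb R}\big\|\mathcal P^{\pm}[f e^{\mp ix\Theta}]\big\|_{L^\infty(\mathbb R)}\le C\big(\|f\|_{X_0}+\|f\|_{\dot L^{2,-1}(\mathbb R)}\big).$$ 3. For all $f\in L^{2,1}(\mathbb R)\cap\dot L^{2,-1}(\mathbb R)$, $$\sup_{x\in\mathbb R}\big\|\mathcal P^{\pm}[(s-s^{-1})f(s)e^{\mp ix\Theta(s)}]\big\|_{L^2(\mathbb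 R)}\le C\big(\|f\|_{L^{2,1}(\mathbb R)}+\|f\|_{\dot L^{2,-1}(\mathbb R)}\big).$$ -/

import Mathlib

open MeasureTheory Filter Topology Set

noncomputable section

/-! ### Weak derivatives and weighted spaces -/

/-- `g` is a weak (distributional) derivative of `f` on the open set `U ⊆ ℝ`: both are locally
integrable on `U`, and `∫ φ' f = - ∫ φ g` for all real test functions `φ ∈ C_c^∞(U)`. -/
def IsWeakDerivOn (U : Set ℝ) (f g : ℝ → ℂ) : Prop :=
  LocallyIntegrableOn f U volume ∧ LocallyIntegrableOn g U volume ∧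
    ∀ φ : ℝ → ℝ, ContDiff ℝ ((⊤ : ℕ∞) : WithTop ℕ∞) φ → HasCompactSupport φ → tsupport φ ⊆ U →
      ∫ s, deriv φ s • f s = -∫ s, φ s • g s

/-- `f` is weakly differentiable on `U`. -/
def WeaklyDifferentiableOn (U : Set ℝ) (f : ℝ → ℂ) : Prop :=
  ∃ g : ℝ → ℂ, IsWeakDerivOn U f g

open Classical in
/-- The weak derivative of `f` on `U` (unique up to a null subset of `U`). -/
def weakDerivOn (U : Set ℝ) (f : ℝ → ℂ) : ℝ → ℂ :=
  if h : WeaklyDifferentiableOn U f then Classical.choose h else 0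

/-- `f ∈ L̇^{2,m}(S)`: the function `|s|^m f(s)` is square integrable on `S`. -/
def MemWL2 (m : ℤ) (S : Set ℝ) (f : ℝ → ℂ) : Prop :=
  MemLp (fun s : ℝ => (|s| ^ m : ℝ) • f s) 2 (volume.restrict S)

/-- The norm of `L̇^{2,m}(S)`, that is `(∫_S |s|^{2m} |f(s)|² ds)^{1/2}`. -/
def normWL2 (m : ℤ) (S : Set ℝ) (f : ℝ → ℂ) : ENNReal :=
  eLpNorm (fun s : ℝ => (|s| ^ m : ℝ) • f s) 2 (volume.restrict S)

/-- `L^{2,1}(ℝ) = L̇^{2,1}(ℝ) ∩ L²(ℝ)`. -/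
def MemL21 (f : ℝ → ℂ) : Prop :=
  MemWL2 1 univ f ∧ MemLp f 2 volume

/-- The norm of `L^{2,1}(ℝ)`. -/
def normL21 (f : ℝ → ℂ) : ENNReal :=
  normWL2 1 univ f + eLpNorm f 2 volume

/-! ### The space `X₀ = H¹(ℝ ∖ [-1,1]) ∩ Ḣ^{1,1}([-1,1]) ∩ L̇^{2,-1}([-1,1])`

The derivative `f'` is the weak derivative of `f` on `ℝ ∖ {0}`; the sets `ℝ ∖ [-1,1]` and `[-1,1]`
only say with which weight `f` and `f'` are square integrable. -/

/-- The weak derivative on `ℝ ∖ {0}`. -/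
def wDeriv (f : ℝ → ℂ) : ℝ → ℂ := weakDerivOn {0}ᶜ f

/-- `f ∈ X₀`. -/
structure MemX0 (f : ℝ → ℂ) : Prop where
  weaklyDiff : WeaklyDifferentiableOn {0}ᶜ f
  outer : MemLp f 2 (volume.restrict (Icc (-1) 1)ᶜ)
  outer_deriv : MemLp (wDeriv f) 2 (volume.restrict (Icc (-1) 1)ᶜ)
  inner_deriv : MemWL2 1 (Icc (-1) 1) (wDeriv f)
  inner : MemWL2 (-1) (Icc (-1) 1) f

/-- The norm of `X₀`: the sum of the norms of the spaces of which it is the intersection. -/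
def normX0 (f : ℝ → ℂ) : ENNReal :=
  eLpNorm f 2 (volume.restrict (Icc (-1) 1)ᶜ)
    + eLpNorm (wDeriv f) 2 (volume.restrict (Icc (-1) 1)ᶜ)
    + normWL2 1 (Icc (-1) 1) (wDeriv f)
    + normWL2 (-1) (Icc (-1) 1) f

/-! ### Cauchy projections

The sign `σ = 1` gives `𝒫⁺`, the sign `σ = -1` gives `𝒫⁻`. -/

/-- The Cauchy integral `(1 / (2πi)) ∫_ℝ h(s) / (s - w) ds`. -/
def cauchyIntegral (h : ℝ → ℂ) (w : ℂ) : ℂ :=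
  1 / (2 * (Real.pi : ℂ) * Complex.I) * ∫ s : ℝ, h s / ((s : ℂ) - w)

/-- The Cauchy integral of `h` at the point `z + σ i ε`. -/
def cauchyApprox (σ : ℝ) (h : ℝ → ℂ) (z ε : ℝ) : ℂ :=
  cauchyIntegral h ((z : ℂ) + (σ : ℂ) * Complex.I * (ε : ℂ))

/-- `𝒫^σ[h](z) = lim_{ε ↓ 0} (1 / (2πi)) ∫_ℝ h(s) / (s - (z + σ i ε)) ds`. -/
def cauchyProj (σ : ℝ) (h : ℝ → ℂ) (z : ℝ) : ℂ :=
  limUnder (𝓝[>] (0 : ℝ)) (fun ε => cauchyApprox σ h z ε)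

/-- `𝒫^σ[h]` is well defined: the integrals converge absolutely off the real line, and the limit
`ε ↓ 0` exists for almost every real `z`. -/
def CauchyProjExists (σ : ℝ) (h : ℝ → ℂ) : Prop :=
  (∀ w : ℂ, w.im ≠ 0 → Integrable (fun s : ℝ => h s / ((s : ℂ) - w)) volume) ∧
    ∀ᵐ z : ℝ, ∃ l : ℂ, Tendsto (fun ε => cauchyApprox σ h z ε) (𝓝[>] (0 : ℝ)) (𝓝 l)

/-! ### The phase -/

/-- `Θ(s) = (s - s⁻¹) / 2`. -/
def Theta (s : ℝ) : ℝ := (s - s⁻¹) / 2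

/-- `e^{-σ i x Θ(s)}`. -/
def phase (σ x s : ℝ) : ℂ :=
  Complex.exp (-((σ : ℂ) * Complex.I * (x : ℂ) * (Theta s : ℂ)))

/-- `⟨x⟩ = (1 + x²)^{1/2}`. -/
def japanese (x : ℝ) : ℝ := Real.sqrt (1 + x ^ 2)

end

noncomputable section

open scoped FourierTransform ENNReal SchwartzMap

/-! ### The Cauchy kernel -/

/-! The substitution y = Θ(s) turns the phase e^{-ixΘ(s)} into the character e^{-ixy}, at the price
that Θ is two-to-one from ℝ∖{0} onto ℝ. The complex extension of Θ maps the upper half plane into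
itself and satisfies Θ(s) - Θ(w) = (s - w)(s + 1/w)/(2s). Put F_n(y) = Σ_{Θ(s)=y} 2sⁿf(s)/(1+s²)
(`weightedFiberSum`) and let C be the Cauchy integral. Then, for Im w > 0, C[f e^{-ixΘ}](w) = ½ C[F₂
e^{-ixy}](Θ(w)) + (1/2w) C[F₁ e^{-ixy}](Θ(w)), which is `cauchyIntegral_mul_chirp_Theta`. The
weights of X₀ fit the Jacobian of Θ, so that F₀, F₁, F₂ lie in H¹(ℝ) with norms bounded by that of f
(`IsX0Pair.eLpNorm_weightedFiberSum_add_le`). Since Θ sends s = 0 to infinity, test functions in y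
pull back to test functions on ℝ∖{0}, and a weak derivative there is all that is needed
(`isWeakDerivOn_fiberSum`).

On the line the rest is Fourier analysis. The Cauchy integral from above sees only positive
frequencies; its boundary values are those of the L² contraction `hardyProj`, by the Poisson kernel
at Lebesgue points (`ae_tendsto_cauchyIntegral`). Convergence in cones is required, because Θ(z +
iε) does not approach Θ(z) vertically. For G in H¹, 𝓕(e^{-ixy}G') = i(2πξ + x) 𝓕(e^{-ixy}G). If x ≥
0 and ξ > 0 the factor is at least x, which gives the decay in estimate 1. For every real x,
𝓕(e^{-ixy}G) is (1 + i(2πξ + x))⁻¹ times an L² function, hence integrable with a bound independent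
of x, and C[e^{-ixy}G] is bounded.

Estimate 2 follows where |z| ≥ 1. Near z = 0 the factor 1/(2w) is removed by writing f = s·q: then
C[f e](w) = const·∫ q e + w C[q e](w), where e is the phase, and the sums F₂, F₁ of q are F₁, F₀ of
f. Estimate 3 needs only that (s - s⁻¹)f is in L². The lower sign reduces to the upper one by
complex conjugation. -/

theorem ofReal_sub_ne_zero {w : ℂ} (hw : w.im ≠ 0) (s : ℝ) : (s : ℂ) - w ≠ 0 := by
  intro h
  apply hw
  have := congrArg Complex.im h
  simpa using this

theorem norm_sq_ofReal_sub (w : ℂ) (s : ℝ) :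
    ‖(s : ℂ) - w‖ ^ 2 = (s - w.re) ^ 2 + w.im ^ 2 := by
  rw [Complex.sq_norm, Complex.normSq_apply]
  simp
  ring

theorem measurable_inv_ofReal_sub (w : ℂ) : Measurable fun s : ℝ => ((s : ℂ) - w)⁻¹ :=
  (Complex.measurable_ofReal.sub_const w).inv

theorem integrable_inv_sq_add_sq {b : ℝ} (hb : b ≠ 0) (a : ℝ) :
    Integrable fun s : ℝ => ((s - a) ^ 2 + b ^ 2)⁻¹ := by
  have h := ((integrable_inv_one_add_sq.comp_div hb).comp_sub_right a).const_mul (b ^ 2)⁻¹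
  refine h.congr (Eventually.of_forall fun s => ?_)
  have hb2 : b ^ 2 ≠ 0 := pow_ne_zero 2 hb
  simp only
  rw [← mul_inv]
  congr 1
  field_simp
  ring

theorem memLp_inv_ofReal_sub {w : ℂ} (hw : w.im ≠ 0) :
    MemLp (fun s : ℝ => ((s : ℂ) - w)⁻¹) 2 volume := by
  rw [memLp_two_iff_integrable_sq_norm (measurable_inv_ofReal_sub w).aestronglyMeasurable]
  refine (integrable_inv_sq_add_sq hw w.re).congr (Eventually.of_forall fun s => ?_)
  simp only [norm_inv, inv_pow, norm_sq_ofReal_sub]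

theorem integrable_div_ofReal_sub {h : ℝ → ℂ} (hh : MemLp h 2 volume) {w : ℂ} (hw : w.im ≠ 0) :
    Integrable (fun s : ℝ => h s / ((s : ℂ) - w)) volume := by
  simpa only [div_eq_mul_inv, Pi.mul_def] using! hh.integrable_mul (memLp_inv_ofReal_sub hw)

/-! ### The Fourier transform on `L²` -/

/-- Integration against a fixed `L²` function is continuous on `L²`. -/
theorem continuous_integral_mul_of_memLp {k : ℝ → ℂ} (hk : MemLp k 2 volume) :
    Continuous fun h : Lp ℂ 2 (volume : Measure ℝ) => ∫ x, h x * k x := by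
  have hc : MemLp (fun x => (starRingEnd ℂ) (k x)) 2 volume := hk.star
  have : (fun h : Lp ℂ 2 (volume : Measure ℝ) => ∫ x, h x * k x) =
      fun h => inner ℂ (hc.toLp _) h := by
    funext h
    rw [L2.inner_def]
    refine integral_congr_ae ?_
    filter_upwards [hc.coeFn_toLp] with x hx
    rw [hx]
    simp
  rw [this]
  fun_prop

/-- The multiplication formula for the Fourier transform on `L²`. -/
theorem integral_Lp_fourier_mul (h : Lp ℂ 2 (volume : Measure ℝ)) {k : ℝ → ℂ}
    (hk : Integrable k volume) (hk2 : MemLp k 2 volume) (hFk : MemLp (𝓕 k) 2 volume) :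
    ∫ x, (𝓕 h : Lp ℂ 2 (volume : Measure ℝ)) x * k x = ∫ x, h x * 𝓕 k x := by
  -- Both sides are continuous in `h` for the L² norm, so it suffices to take `h` Schwartz, where
  -- the formula is Fubini.
  refine DenseRange.induction_on
    (p := fun h : Lp ℂ 2 (volume : Measure ℝ) =>
      ∫ x, (𝓕 h : Lp ℂ 2 (volume : Measure ℝ)) x * k x = ∫ x, h x * 𝓕 k x)
    (SchwartzMap.denseRange_toLpCLM (p := 2) (μ := (volume : Measure ℝ))
      ENNReal.ofNat_ne_top) h ?_ ?_
  · exact isClosed_eq ((continuous_integral_mul_of_memLp hk2).comp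
      (Lp.fourierTransformₗᵢ ℝ ℂ).continuous) (continuous_integral_mul_of_memLp hFk)
  · intro f
    simp only [SchwartzMap.toLpCLM_apply]
    rw [SchwartzMap.toLp_fourier_eq]
    have h1 : ∫ x, ((𝓕 f).toLp 2 : Lp ℂ 2 (volume : Measure ℝ)) x * k x = ∫ x, 𝓕 f x * k x := by
      refine integral_congr_ae ?_
      filter_upwards [(𝓕 f).coeFn_toLp 2 volume] with x hx
      rw [hx]
    have h2 : ∫ x, (f.toLp 2 : Lp ℂ 2 (volume : Measure ℝ)) x * 𝓕 k x = ∫ x, f x * 𝓕 k x := by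
      refine integral_congr_ae ?_
      filter_upwards [f.coeFn_toLp 2 volume] with x hx
      rw [hx]
    rw [h1, h2]
    simpa using! VectorFourier.integral_fourierIntegral_smul_eq_flip (L := innerₗ ℝ)
      Real.continuous_fourierChar continuous_inner f.integrable hk

/-- The exponential whose Fourier transform is the Cauchy kernel with pole `w`, `0 < Im w`. -/
def expKernel (w : ℂ) (ξ : ℝ) : ℂ :=
  (Ioi (0 : ℝ)).indicator (fun ξ => Complex.exp (2 * Real.pi * Complex.I * w * ξ)) ξ

/-- The analogue of `expKernel` for poles in the lower half plane. -/
def expKernelNeg (w : ℂ) (ξ : ℝ) : ℂ :=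
  (Iic (0 : ℝ)).indicator (fun ξ => -Complex.exp (2 * Real.pi * Complex.I * w * ξ)) ξ

theorem two_pi_I_mul_re (w : ℂ) : (2 * Real.pi * Complex.I * w).re = -(2 * Real.pi * w.im) := by
  simp

theorem integrable_expKernel {w : ℂ} (hw : 0 < w.im) : Integrable (expKernel w) volume := by
  refine (integrable_indicator_iff measurableSet_Ioi).2 (integrableOn_exp_mul_complex_Ioi ?_ 0)
  rw [two_pi_I_mul_re]
  have := mul_pos Real.two_pi_pos hw
  linarith

theorem integrable_expKernelNeg {w : ℂ} (hw : w.im < 0) :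
    Integrable (expKernelNeg w) volume := by
  refine (integrable_indicator_iff measurableSet_Iic).2
    (Integrable.neg (integrableOn_exp_mul_complex_Iic ?_ 0))
  rw [two_pi_I_mul_re]
  have := mul_neg_of_pos_of_neg Real.two_pi_pos hw
  linarith

theorem memLp_two_of_integrable_of_norm_le {f : ℝ → ℂ} (hf : Integrable f volume) {c : ℝ}
    (hc : ∀ x, ‖f x‖ ≤ c) : MemLp f 2 volume := by
  rw [memLp_two_iff_integrable_sq_norm hf.aestronglyMeasurable]
  refine (hf.norm.const_mul c).mono' (hf.aestronglyMeasurable.norm.pow 2)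
    (Eventually.of_forall fun x => ?_)
  rw [Real.norm_of_nonneg (by positivity), sq]
  exact mul_le_mul_of_nonneg_right (hc x) (norm_nonneg _)

theorem norm_expKernel_le {w : ℂ} (hw : 0 < w.im) (ξ : ℝ) : ‖expKernel w ξ‖ ≤ 1 := by
  unfold expKernel
  by_cases hξ : ξ ∈ Ioi (0 : ℝ)
  · rw [indicator_of_mem hξ, Complex.norm_exp, Complex.re_mul_ofReal, two_pi_I_mul_re,
      Real.exp_le_one_iff]
    have := mul_pos (mul_pos Real.two_pi_pos hw) hξ
    linarith
  · rw [indicator_of_notMem hξ]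
    simp

theorem memLp_two_expKernel {w : ℂ} (hw : 0 < w.im) : MemLp (expKernel w) 2 volume :=
  memLp_two_of_integrable_of_norm_le (integrable_expKernel hw) (norm_expKernel_le hw)

theorem memLp_two_expKernelNeg {w : ℂ} (hw : w.im < 0) : MemLp (expKernelNeg w) 2 volume := by
  refine memLp_two_of_integrable_of_norm_le (integrable_expKernelNeg hw) (c := 1) fun ξ => ?_
  unfold expKernelNeg
  by_cases hξ : ξ ∈ Iic (0 : ℝ)
  · rw [indicator_of_mem hξ, norm_neg, Complex.norm_exp, Complex.re_mul_ofReal, two_pi_I_mul_re,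
      Real.exp_le_one_iff]
    have := mul_nonneg_of_nonpos_of_nonpos (mul_neg_of_pos_of_neg Real.two_pi_pos hw).le hξ
    linarith
  · rw [indicator_of_notMem hξ]
    simp

/-- The integral of e^{2πi(w-s)v} over v > 0 converges because Im w > 0, and equals -1/(2πi(w-s)).
The normalization 1/(2πi) of the Cauchy integral thus appears by itself. -/
theorem fourier_expKernel {w : ℂ} (hw : 0 < w.im) :
    𝓕 (expKernel w) = fun s : ℝ => 1 / (2 * (Real.pi : ℂ) * Complex.I) * ((s : ℂ) - w)⁻¹ := by
  funext s
  rw [Real.fourier_real_eq_integral_exp_smul]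
  have h1 : (fun v : ℝ => Complex.exp (↑(-2 * Real.pi * v * s) * Complex.I) • expKernel w v) =
      (Ioi (0 : ℝ)).indicator
        (fun v : ℝ => Complex.exp (2 * Real.pi * Complex.I * (w - s) * v)) := by
    funext v
    unfold expKernel
    by_cases hv : v ∈ Ioi (0 : ℝ)
    · rw [indicator_of_mem hv, indicator_of_mem hv, smul_eq_mul, ← Complex.exp_add]
      congr 1
      push_cast
      ring
    · rw [indicator_of_notMem hv, indicator_of_notMem hv, smul_zero]
  rw [h1, integral_indicator measurableSet_Ioi, integral_exp_mul_complex_Ioi]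
  · have hs := ofReal_sub_ne_zero hw.ne' s
    have hs' : w - s ≠ 0 := by rw [← neg_sub]; exact neg_ne_zero.2 hs
    have hpi : (Real.pi : ℂ) ≠ 0 := Complex.ofReal_ne_zero.2 Real.pi_ne_zero
    rw [← neg_sub w (s : ℂ), inv_neg]
    simp
    field_simp
    rw [Complex.I_sq]
  · rw [two_pi_I_mul_re]
    have := mul_pos Real.two_pi_pos hw
    simp only [Complex.sub_im, Complex.ofReal_im, sub_zero]
    linarith

theorem fourier_expKernelNeg {w : ℂ} (hw : w.im < 0) :
    𝓕 (expKernelNeg w) =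
      fun s : ℝ => 1 / (2 * (Real.pi : ℂ) * Complex.I) * ((s : ℂ) - w)⁻¹ := by
  funext s
  rw [Real.fourier_real_eq_integral_exp_smul]
  have h1 : (fun v : ℝ => Complex.exp (↑(-2 * Real.pi * v * s) * Complex.I) • expKernelNeg w v) =
      (Iic (0 : ℝ)).indicator
        (fun v : ℝ => -Complex.exp (2 * Real.pi * Complex.I * (w - s) * v)) := by
    funext v
    unfold expKernelNeg
    by_cases hv : v ∈ Iic (0 : ℝ)
    · rw [indicator_of_mem hv, indicator_of_mem hv, smul_eq_mul, mul_neg, ← Complex.exp_add]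
      congr 2
      push_cast
      ring
    · rw [indicator_of_notMem hv, indicator_of_notMem hv, smul_zero]
  rw [h1, integral_indicator measurableSet_Iic, integral_neg, integral_exp_mul_complex_Iic]
  · have hs := ofReal_sub_ne_zero hw.ne s
    have hs' : w - s ≠ 0 := by rw [← neg_sub]; exact neg_ne_zero.2 hs
    have hpi : (Real.pi : ℂ) ≠ 0 := Complex.ofReal_ne_zero.2 Real.pi_ne_zero
    rw [← neg_sub w (s : ℂ), inv_neg]
    simp
    field_simp
  · rw [two_pi_I_mul_re]
    have := mul_neg_of_pos_of_neg Real.two_pi_pos hw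
    simp only [Complex.sub_im, Complex.ofReal_im, sub_zero]
    linarith

theorem cauchyIntegral_eq_integral_mul (h : ℝ → ℂ) (w : ℂ) :
    cauchyIntegral h w =
      ∫ s : ℝ, h s * (1 / (2 * (Real.pi : ℂ) * Complex.I) * ((s : ℂ) - w)⁻¹) := by
  rw [cauchyIntegral, ← integral_const_mul]
  refine integral_congr_ae (Eventually.of_forall fun s => ?_)
  simp only
  ring

theorem cauchyIntegral_congr_ae {h k : ℝ → ℂ} (hk : h =ᵐ[volume] k) (w : ℂ) :
    cauchyIntegral h w = cauchyIntegral k w := by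
  unfold cauchyIntegral
  congr 1
  refine integral_congr_ae ?_
  filter_upwards [hk] with s hs
  rw [hs]

/-- The Cauchy integral of an `L²` function in the upper half plane, in terms of the positive
frequencies. -/
theorem cauchyIntegral_eq_integral_fourier (h : Lp ℂ 2 (volume : Measure ℝ)) {w : ℂ}
    (hw : 0 < w.im) :
    cauchyIntegral h w = ∫ ξ, (𝓕 h : Lp ℂ 2 (volume : Measure ℝ)) ξ * expKernel w ξ := by
  rw [integral_Lp_fourier_mul h (integrable_expKernel hw) (memLp_two_expKernel hw),
    cauchyIntegral_eq_integral_mul, fourier_expKernel hw]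
  rw [fourier_expKernel hw]
  exact (memLp_inv_ofReal_sub hw.ne').const_mul _

theorem cauchyIntegral_eq_integral_fourier_neg (h : Lp ℂ 2 (volume : Measure ℝ)) {w : ℂ}
    (hw : w.im < 0) :
    cauchyIntegral h w = ∫ ξ, (𝓕 h : Lp ℂ 2 (volume : Measure ℝ)) ξ * expKernelNeg w ξ := by
  rw [integral_Lp_fourier_mul h (integrable_expKernelNeg hw) (memLp_two_expKernelNeg hw),
    cauchyIntegral_eq_integral_mul, fourier_expKernelNeg hw]
  rw [fourier_expKernelNeg hw]
  exact (memLp_inv_ofReal_sub hw.ne).const_mul _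

/-! ### The Hardy projection -/

/-- The positive frequencies of an `L²` function. -/
theorem memLp_posFreq (h : Lp ℂ 2 (volume : Measure ℝ)) :
    MemLp ((Ioi (0 : ℝ)).indicator (𝓕 h : Lp ℂ 2 (volume : Measure ℝ))) 2 volume :=
  (Lp.memLp _).indicator measurableSet_Ioi

/-- The orthogonal projection of `L²(ℝ)` onto the Hardy space of the upper half plane. -/
def hardyProj (h : Lp ℂ 2 (volume : Measure ℝ)) : Lp ℂ 2 (volume : Measure ℝ) :=
  𝓕⁻ (memLp_posFreq h).toLp

theorem fourier_hardyProj (h : Lp ℂ 2 (volume : Measure ℝ)) :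
    (𝓕 (hardyProj h) : Lp ℂ 2 (volume : Measure ℝ)) =ᵐ[volume]
      (Ioi (0 : ℝ)).indicator (𝓕 h : Lp ℂ 2 (volume : Measure ℝ)) := by
  rw [hardyProj, FourierTransform.fourier_fourierInv_eq]
  exact MemLp.coeFn_toLp _

/-- For a pole in the upper half plane the kernel on the frequency side is supported in ξ > 0, so
discarding the other frequencies changes nothing. -/
theorem cauchyIntegral_hardyProj (h : Lp ℂ 2 (volume : Measure ℝ)) {w : ℂ} (hw : 0 < w.im) :
    cauchyIntegral (hardyProj h) w = cauchyIntegral h w := by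
  rw [cauchyIntegral_eq_integral_fourier _ hw, cauchyIntegral_eq_integral_fourier _ hw]
  refine integral_congr_ae ?_
  filter_upwards [fourier_hardyProj h] with ξ hξ
  rw [hξ, expKernel]
  by_cases h0 : ξ ∈ Ioi (0 : ℝ)
  · rw [indicator_of_mem h0]
  · rw [indicator_of_notMem h0, indicator_of_notMem h0, mul_zero, mul_zero]

/-- For a pole in the lower half plane the kernel is supported in ξ ≤ 0, where the projection has no
frequencies. This vanishing allows the Cauchy kernel to be replaced by the Poisson kernel. -/
theorem cauchyIntegral_hardyProj_neg (h : Lp ℂ 2 (volume : Measure ℝ)) {w : ℂ} (hw : w.im < 0) :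
    cauchyIntegral (hardyProj h) w = 0 := by
  rw [cauchyIntegral_eq_integral_fourier_neg _ hw]
  refine integral_eq_zero_of_ae ?_
  filter_upwards [fourier_hardyProj h] with ξ hξ
  rw [hξ, expKernelNeg]
  by_cases h0 : ξ ∈ Ioi (0 : ℝ)
  · rw [indicator_of_notMem (s := Iic (0 : ℝ)) (by simpa using h0), mul_zero]
    rfl
  · rw [indicator_of_notMem h0, zero_mul]
    rfl

theorem eLpNorm_hardyProj (h : Lp ℂ 2 (volume : Measure ℝ)) :
    eLpNorm (hardyProj h) 2 volume =
      eLpNorm ((Ioi (0 : ℝ)).indicator (𝓕 h : Lp ℂ 2 (volume : Measure ℝ))) 2 volume := by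
  rw [← eLpNorm_congr_ae (fourier_hardyProj h), ← Lp.enorm_def, ← Lp.enorm_def]
  rw [← ofReal_norm, ← ofReal_norm, Lp.norm_fourier_eq]

theorem eLpNorm_fourier (h : Lp ℂ 2 (volume : Measure ℝ)) :
    eLpNorm (𝓕 h : Lp ℂ 2 (volume : Measure ℝ)) 2 volume = eLpNorm h 2 volume := by
  rw [← Lp.enorm_def, ← Lp.enorm_def, ← ofReal_norm, ← ofReal_norm, Lp.norm_fourier_eq]

theorem eLpNorm_hardyProj_le (h : Lp ℂ 2 (volume : Measure ℝ)) :
    eLpNorm (hardyProj h) 2 volume ≤ eLpNorm h 2 volume := by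
  rw [eLpNorm_hardyProj, ← eLpNorm_fourier h]
  exact eLpNorm_indicator_le _

/-- The Cauchy integral of an `L²` function in the upper half plane is the Poisson integral of its
projection onto the Hardy space. -/
theorem cauchyIntegral_eq_poisson (h : Lp ℂ 2 (volume : Measure ℝ)) {w : ℂ} (hw : 0 < w.im) :
    cauchyIntegral h w =
      ∫ s : ℝ, (Real.pi⁻¹ * (w.im * ((s - w.re) ^ 2 + w.im ^ 2)⁻¹) : ℝ) • hardyProj h s := by
  have hc : (starRingEnd ℂ w).im < 0 := by simpa using hw
  have hP := Lp.memLp (hardyProj h)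
  -- The vanishing Cauchy integral at the conjugate pole is subtracted: 1/(s-w) - 1/(s-w̄) = 2i Im w
  -- / |s-w|².
  rw [← cauchyIntegral_hardyProj h hw, ← sub_zero (cauchyIntegral _ w),
    ← cauchyIntegral_hardyProj_neg h hc, cauchyIntegral, cauchyIntegral, ← mul_sub,
    ← integral_sub (integrable_div_ofReal_sub hP hw.ne') (integrable_div_ofReal_sub hP hc.ne),
    ← integral_const_mul]
  refine integral_congr_ae (Eventually.of_forall fun s => ?_)
  have h1 := ofReal_sub_ne_zero hw.ne' s
  have h2 := ofReal_sub_ne_zero hc.ne s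
  have hpi : (Real.pi : ℂ) ≠ 0 := Complex.ofReal_ne_zero.2 Real.pi_ne_zero
  have h3 : (((s - w.re) ^ 2 + w.im ^ 2 : ℝ) : ℂ) = ((s : ℂ) - w) * (s - starRingEnd ℂ w) := by
    rw [← norm_sq_ofReal_sub, Complex.ofReal_pow, ← Complex.mul_conj']
    simp
  have h4 : w - starRingEnd ℂ w = 2 * Complex.I * w.im := by
    rw [Complex.sub_conj]
    push_cast
    ring
  simp only [Complex.real_smul, Complex.ofReal_mul, Complex.ofReal_inv, h3]
  have h5 : (w.im : ℂ) = (w - starRingEnd ℂ w) / (2 * Complex.I) := by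
    rw [h4]
    field_simp
  rw [h5]
  field_simp
  ring

end

noncomputable section

open scoped FourierTransform ENNReal

/-! ### Boundary values of Poisson integrals -/

theorem integral_mul_inv_sq_add_sq {b : ℝ} (hb : 0 < b) (a : ℝ) :
    ∫ s : ℝ, b * ((s - a) ^ 2 + b ^ 2)⁻¹ = Real.pi := by
  have h1 : ∀ s : ℝ, b * ((s - a) ^ 2 + b ^ 2)⁻¹ = b⁻¹ * (1 + ((s - a) / b) ^ 2)⁻¹ := by
    intro s
    have hb2 : (s - a) ^ 2 + b ^ 2 ≠ 0 := by positivity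
    have hb3 : 1 + ((s - a) / b) ^ 2 ≠ 0 := by positivity
    field_simp
    ring
  simp_rw [h1]
  rw [integral_const_mul, integral_sub_right_eq_self (fun s => (1 + (s / b) ^ 2)⁻¹) a,
    Measure.integral_comp_div (fun s => (1 + s ^ 2)⁻¹) b, integral_univ_inv_one_add_sq,
    abs_of_pos hb, smul_eq_mul, ← mul_assoc, inv_mul_cancel₀ hb.ne', one_mul]

theorem lintegral_mul_inv_sq_add_sq {b : ℝ} (hb : 0 < b) (a : ℝ) :
    ∫⁻ s : ℝ, ENNReal.ofReal (b * ((s - a) ^ 2 + b ^ 2)⁻¹) = ENNReal.ofReal Real.pi := by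
  rw [← integral_mul_inv_sq_add_sq hb a, ofReal_integral_eq_lintegral_ofReal]
  · exact (integrable_inv_sq_add_sq hb.ne' a).const_mul b
  · exact Eventually.of_forall fun s => by positivity

/-- The Poisson kernel decreases in the distance to its centre, so its superlevel sets are balls.
This is what lets averages over balls control Poisson averages. -/
theorem setOf_le_mul_inv_sq_add_sq {b : ℝ} (hb : 0 < b) (a : ℝ) {t : ℝ} (ht : 0 < t) :
    {s : ℝ | t ≤ b * ((s - a) ^ 2 + b ^ 2)⁻¹} = ∅ ∨
      ∃ ρ : ℝ, 0 ≤ ρ ∧ {s : ℝ | t ≤ b * ((s - a) ^ 2 + b ^ 2)⁻¹} = Metric.closedBall a ρ := by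
  have key : ∀ s : ℝ, t ≤ b * ((s - a) ^ 2 + b ^ 2)⁻¹ ↔ (s - a) ^ 2 ≤ b / t - b ^ 2 := by
    intro s
    have h0 : 0 < (s - a) ^ 2 + b ^ 2 := by positivity
    rw [← div_eq_mul_inv, le_div_iff₀ h0, le_sub_iff_add_le, le_div_iff₀ ht, mul_comm]
  by_cases hneg : b / t - b ^ 2 < 0
  · left
    ext s
    simp only [mem_ofPred_eq, mem_empty_iff_false, iff_false, key]
    intro h
    nlinarith [sq_nonneg (s - a)]
  · right
    refine ⟨√(b / t - b ^ 2), Real.sqrt_nonneg _, ?_⟩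
    ext s
    simp only [mem_ofPred_eq, key, Metric.mem_closedBall, Real.dist_eq]
    rw [Real.le_sqrt (abs_nonneg _) (not_lt.1 hneg), sq_abs]

/-- If the averages of `v` over small balls around `y` are at most `δ`, so is, up to a constant,
the Poisson average of `v` restricted to a ball. -/
theorem setLIntegral_poisson_mul_le {v : ℝ → ℝ≥0∞} (hv : AEMeasurable v volume) {y r₀ : ℝ}
    {δ : ℝ≥0∞} (hδ : δ ≠ ⊤) (h : ∀ r, 0 < r → r ≤ r₀ →
      ∫⁻ s in Metric.closedBall y r, v s ≤ δ * volume (Metric.closedBall y r))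
    (hr₀ : 0 < r₀) {b : ℝ} (hb : 0 < b) :
    ∫⁻ s in Metric.closedBall y r₀, ENNReal.ofReal (b * ((s - y) ^ 2 + b ^ 2)⁻¹) * v s ≤
      δ * ENNReal.ofReal Real.pi := by
  set P : ℝ → ℝ := fun s => b * ((s - y) ^ 2 + b ^ 2)⁻¹ with hP
  have hPm : Measurable P := by fun_prop
  have hP0 : ∀ s, 0 ≤ P s := fun s => by simp only [hP]; positivity
  set B := Metric.closedBall y r₀ with hB
  set μ : Measure ℝ := (volume.restrict B).withDensity v with hμ
  have h1 : ∫⁻ s in B, ENNReal.ofReal (P s) * v s = ∫⁻ s, ENNReal.ofReal (P s) ∂μ := by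
    rw [hμ, lintegral_withDensity_eq_lintegral_mul₀ hv.restrict hPm.ennreal_ofReal.aemeasurable]
    simp only [Pi.mul_apply, mul_comm]
  -- Layer cake on both sides: for each level t the superlevel set of the kernel is a closed ball
  -- about `y`, on which the hypothesis compares `μ` with `δ` times Lebesgue measure. The kernel has
  -- total mass π.
  rw [h1, lintegral_eq_lintegral_meas_le μ (Eventually.of_forall hP0) hPm.aemeasurable,
    ← lintegral_mul_inv_sq_add_sq hb y,
    lintegral_eq_lintegral_meas_le volume (Eventually.of_forall hP0) hPm.aemeasurable,
    ← lintegral_const_mul' _ _ ?_]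
  · refine setLIntegral_mono_ae' measurableSet_Ioi (Eventually.of_forall fun t ht => ?_)
    rcases setOf_le_mul_inv_sq_add_sq hb y (mem_Ioi.1 ht) with he | ⟨ρ, hρ, he⟩
    · simp only [hP, he, measure_empty, zero_le]
    · simp only [hP, he]
      rw [hμ, withDensity_apply _ measurableSet_closedBall,
        Measure.restrict_restrict measurableSet_closedBall]
      rcases hρ.eq_or_lt with h0 | h0
      · rw [← h0, Metric.closedBall_zero, setLIntegral_measure_zero]
        · exact zero_le
        · exact measure_mono_null inter_subset_left (by simp)
      · have hsub : Metric.closedBall y ρ ∩ B = Metric.closedBall y (min ρ r₀) := by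
          ext s
          simp [hB, Metric.mem_closedBall]
        rw [hsub]
        refine (h _ (lt_min h0 hr₀) (min_le_right _ _)).trans ?_
        gcongr
        exact min_le_left _ _
  · exact hδ

theorem integrable_mul_inv_sq_add_sq {u : ℝ → ℂ} (hu : MemLp u 2 volume) {b : ℝ} (hb : b ≠ 0)
    (a : ℝ) : Integrable (fun s => (((s - a) ^ 2 + b ^ 2)⁻¹ : ℝ) • u s) volume := by
  have hw : ((a : ℂ) + b * Complex.I).im ≠ 0 := by simpa using hb
  have hL : MemLp (fun s : ℝ => ((s - a) ^ 2 + b ^ 2)⁻¹) 2 volume := by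
    have hm : AEStronglyMeasurable (fun s : ℝ => ((s - a) ^ 2 + b ^ 2)⁻¹) volume :=
      Measurable.aestronglyMeasurable (by fun_prop)
    rw [memLp_two_iff_integrable_sq hm]
    refine ((integrable_inv_sq_add_sq hb a).const_mul (b ^ 2)⁻¹).mono' (hm.pow 2)
      (Eventually.of_forall fun s => ?_)
    have hb2 : 0 < b ^ 2 := by positivity
    rw [Real.norm_of_nonneg (by positivity), sq]
    gcongr
    exact le_add_of_nonneg_left (sq_nonneg _)
  exact memLp_one_iff_integrable.1 (hu.smul hL)

/-- Poisson averages of `‖u - u y‖` tend to zero at Lebesgue points. -/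
theorem tendsto_lintegral_poisson {u : ℝ → ℂ} (hu : MemLp u 2 volume) {y : ℝ}
    (hy : Tendsto (fun r => ⨍ t in Metric.closedBall y r, ‖u t - u y‖) (𝓝[>] (0 : ℝ)) (𝓝 0)) :
    Tendsto (fun b : ℝ => ∫⁻ s, ENNReal.ofReal (b * ((s - y) ^ 2 + b ^ 2)⁻¹) * ‖u s - u y‖ₑ)
      (𝓝[>] (0 : ℝ)) (𝓝 0) := by
  have hum : AEStronglyMeasurable (fun s => u s - u y) volume :=
    hu.1.sub aestronglyMeasurable_const
  have hloc : ∀ r, IntegrableOn (fun s => u s - u y) (Metric.closedBall y r) volume := fun r =>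
    ((hu.locallyIntegrable one_le_two).sub (locallyIntegrable_const _)).integrableOn_isCompact
      (isCompact_closedBall y r)
  have hK : ∫⁻ s, ENNReal.ofReal ((s - y) ^ 2 + 1 ^ 2)⁻¹ * ‖u s - u y‖ₑ ≠ ⊤ := by
    have h1 : Integrable (fun s => (((s - y) ^ 2 + 1 ^ 2)⁻¹ : ℝ) • (u s - u y)) volume := by
      simp_rw [smul_sub]
      exact (integrable_mul_inv_sq_add_sq hu one_ne_zero y).sub
        ((integrable_inv_sq_add_sq one_ne_zero y).smul_const _)
    have h2 := h1.2.ne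
    convert h2 using 3 with s
    rw [enorm_smul, Real.enorm_of_nonneg (by positivity)]
  set K := ∫⁻ s, ENNReal.ofReal ((s - y) ^ 2 + 1 ^ 2)⁻¹ * ‖u s - u y‖ₑ with hKdef
  rw [ENNReal.tendsto_nhds_zero]
  intro ε hε
  obtain ⟨δ, hδ0, hδ⟩ : ∃ δ : ℝ, 0 < δ ∧ ENNReal.ofReal δ * ENNReal.ofReal Real.pi ≤ ε / 2 := by
    have h1 : Tendsto (fun δ : ℝ => ENNReal.ofReal δ * ENNReal.ofReal Real.pi) (𝓝[>] 0) (𝓝 0) := by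
      have : Tendsto (fun δ : ℝ => ENNReal.ofReal δ * ENNReal.ofReal Real.pi) (𝓝 0)
          (𝓝 (ENNReal.ofReal 0 * ENNReal.ofReal Real.pi)) :=
        ENNReal.Tendsto.mul_const (ENNReal.continuous_ofReal.tendsto 0)
          (Or.inr ENNReal.ofReal_ne_top)
      rw [ENNReal.ofReal_zero, zero_mul] at this
      exact this.mono_left nhdsWithin_le_nhds
    obtain ⟨δ, h2, h3⟩ := ((ENNReal.tendsto_nhds_zero.1 h1 (ε / 2)
      (ENNReal.half_pos hε.ne')).and self_mem_nhdsWithin).exists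
    exact ⟨δ, h3, h2⟩
  obtain ⟨r₀, hr₀, hr⟩ : ∃ r₀ : ℝ, 0 < r₀ ∧ ∀ r, 0 < r → r ≤ r₀ →
      ∫⁻ s in Metric.closedBall y r, ‖u s - u y‖ₑ ≤
        ENNReal.ofReal δ * volume (Metric.closedBall y r) := by
    have h1 := hy.eventually (eventually_le_nhds hδ0)
    obtain ⟨r₁, hr₁, h2⟩ := mem_nhdsGT_iff_exists_Ioc_subset.1 h1
    refine ⟨r₁, hr₁, fun r hr0 hr1 => ?_⟩
    have h3 : ⨍ t in Metric.closedBall y r, ‖u t - u y‖ ≤ δ := h2 ⟨hr0, hr1⟩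
    have hvol : 0 < volume.real (Metric.closedBall y r) := by
      rw [Real.volume_real_closedBall hr0.le]
      positivity
    rw [setAverage_eq, smul_eq_mul, inv_mul_le_iff₀ hvol, mul_comm] at h3
    rw [← ofReal_integral_norm_eq_lintegral_enorm (hloc r), ← ofReal_measureReal (measure_closedBall_lt_top.ne),
      ← ENNReal.ofReal_mul hδ0.le]
    exact ENNReal.ofReal_le_ofReal h3
  -- Tail: where |s-y| > r₀, the kernel with parameter b is at most b(1 + r₀⁻²) times the kernel
  -- with parameter 1, whose integral `K` is finite.
  have hout : Tendsto (fun b : ℝ => ENNReal.ofReal (b * (1 + (r₀ ^ 2)⁻¹)) * K) (𝓝[>] 0) (𝓝 0) := by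
    have h1 : Tendsto (fun b : ℝ => ENNReal.ofReal (b * (1 + (r₀ ^ 2)⁻¹)) * K) (𝓝 0)
        (𝓝 (ENNReal.ofReal (0 * (1 + (r₀ ^ 2)⁻¹)) * K)) :=
      ENNReal.Tendsto.mul_const ((ENNReal.continuous_ofReal.comp
        (continuous_id.mul continuous_const)).tendsto 0) (Or.inr hK)
    rw [zero_mul, ENNReal.ofReal_zero, zero_mul] at h1
    exact h1.mono_left nhdsWithin_le_nhds
  filter_upwards [self_mem_nhdsWithin,
    ENNReal.tendsto_nhds_zero.1 hout (ε / 2) (ENNReal.half_pos hε.ne')] with b hb hb2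
  rw [← lintegral_add_compl _ (Metric.isClosed_closedBall (x := y) (ε := r₀)).measurableSet,
    ← ENNReal.add_halves ε]
  refine add_le_add ((setLIntegral_poisson_mul_le hum.enorm ENNReal.ofReal_ne_top hr hr₀
    hb).trans hδ) (le_trans ?_ hb2)
  have hcm : AEMeasurable (fun s => ENNReal.ofReal ((s - y) ^ 2 + 1 ^ 2)⁻¹ * ‖u s - u y‖ₑ)
      volume := (Measurable.aemeasurable (by fun_prop)).mul hum.enorm
  rw [hKdef, ← lintegral_const_mul'' _ hcm]
  refine (setLIntegral_mono_ae' Metric.isClosed_closedBall.measurableSet.compl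
    (Eventually.of_forall fun s hs => ?_)).trans (setLIntegral_le_lintegral _ _)
  rw [← mul_assoc, ← ENNReal.ofReal_mul (by have := mem_Ioi.1 hb; positivity)]
  refine mul_le_mul_left (ENNReal.ofReal_le_ofReal ?_) _
  rw [mul_assoc]
  refine mul_le_mul_of_nonneg_left ?_ (mem_Ioi.1 hb).le
  have hs' : r₀ ^ 2 ≤ (s - y) ^ 2 := by
    rw [mem_compl_iff, Metric.mem_closedBall, not_le, Real.dist_eq] at hs
    rw [← sq_abs (s - y)]
    exact pow_le_pow_left₀ hr₀.le hs.le 2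
  have h0 : 0 < r₀ ^ 2 := by positivity
  have h1 : 0 < (s - y) ^ 2 := h0.trans_le hs'
  rw [← div_eq_mul_inv, le_div_iff₀ (by positivity), inv_mul_le_iff₀ (by positivity)]
  have h2 : 1 ≤ (s - y) ^ 2 * (r₀ ^ 2)⁻¹ := by
    rw [← div_eq_mul_inv, one_le_div h0]
    exact hs'
  nlinarith [sq_nonneg b, inv_pos.2 h0]

/-- Nontangential boundary values of Cauchy integrals of `L²` functions: the Cauchy integral of `h`
converges to `hardyProj h` at almost every boundary point. -/
theorem ae_tendsto_cauchyIntegral (h : Lp ℂ 2 (volume : Measure ℝ)) :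
    ∀ᵐ y : ℝ, ∀ w : ℝ → ℂ, (∀ᶠ ε in 𝓝[>] (0 : ℝ), 0 < (w ε).im ∧ |(w ε).re - y| ≤ (w ε).im) →
      Tendsto (fun ε => (w ε).im) (𝓝[>] (0 : ℝ)) (𝓝 0) →
      Tendsto (fun ε => cauchyIntegral h (w ε)) (𝓝[>] (0 : ℝ)) (𝓝 (hardyProj h y)) := by
  set u := hardyProj h with hu_def
  have hu : MemLp u 2 volume := Lp.memLp u
  filter_upwards [IsUnifLocDoublingMeasure.ae_tendsto_average_norm_sub (μ := volume)
    (hu.locallyIntegrable one_le_two) 1] with y hy w hw hw0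
  have hL : Tendsto (fun r => ⨍ t in Metric.closedBall y r, ‖u t - u y‖) (𝓝[>] (0 : ℝ)) (𝓝 0) :=
    hy (fun _ => y) id tendsto_id (by
      filter_upwards [self_mem_nhdsWithin] with r hr
      exact Metric.mem_closedBall_self (by simpa using (mem_Ioi.1 hr).le))
  have hwim : Tendsto (fun ε => (w ε).im) (𝓝[>] (0 : ℝ)) (𝓝[>] 0) :=
    tendsto_nhdsWithin_iff.2 ⟨hw0, hw.mono fun ε hε => hε.1⟩
  have hlim := ENNReal.Tendsto.const_mul (a := ENNReal.ofReal 3)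
    ((tendsto_lintegral_poisson hu hL).comp hwim) (Or.inr ENNReal.ofReal_ne_top)
  rw [mul_zero] at hlim
  rw [tendsto_iff_edist_tendsto_0]
  refine tendsto_of_tendsto_of_tendsto_of_le_of_le' tendsto_const_nhds hlim
    (Eventually.of_forall fun _ => zero_le) ?_
  filter_upwards [hw] with ε hε
  obtain ⟨him, hre⟩ := hε
  rw [edist_eq_enorm_sub, cauchyIntegral_eq_poisson h him]
  -- The normalized Poisson kernel has mass one, so the constant `u y` can be moved under the
  -- integral.
  have hnorm : u y = ∫ s : ℝ, (Real.pi⁻¹ *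
      ((w ε).im * ((s - (w ε).re) ^ 2 + (w ε).im ^ 2)⁻¹) : ℝ) • u y := by
    rw [integral_smul_const, integral_const_mul, integral_mul_inv_sq_add_sq him,
      inv_mul_cancel₀ Real.pi_ne_zero, one_smul]
  have hint1 : Integrable (fun s : ℝ => (Real.pi⁻¹ *
      ((w ε).im * ((s - (w ε).re) ^ 2 + (w ε).im ^ 2)⁻¹) : ℝ) • u s) volume := by
    simp_rw [mul_smul]
    exact ((integrable_mul_inv_sq_add_sq hu him.ne' _).smul _).smul _
  have hint2 : Integrable (fun s : ℝ => (Real.pi⁻¹ *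
      ((w ε).im * ((s - (w ε).re) ^ 2 + (w ε).im ^ 2)⁻¹) : ℝ) • u y) volume :=
    (((integrable_inv_sq_add_sq him.ne' _).const_mul _).const_mul _).smul_const _
  conv_lhs => rw [← hu_def, hnorm, ← integral_sub hint1 hint2]
  refine (enorm_integral_le_lintegral_enorm _).trans ?_
  simp only [Function.comp_apply]
  rw [← lintegral_const_mul' _ _ ENNReal.ofReal_ne_top]
  refine lintegral_mono fun s => ?_
  rw [← smul_sub, enorm_smul, Real.enorm_of_nonneg (by positivity),
    ← mul_assoc (ENNReal.ofReal 3),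
    ← ENNReal.ofReal_mul (by norm_num)]
  refine mul_le_mul_left (ENNReal.ofReal_le_ofReal ?_) _
  have hpi : Real.pi⁻¹ ≤ 1 := inv_le_one_of_one_le₀ (by linarith [Real.pi_gt_three])
  -- In the cone, (s-y)² ≤ 2(s-Re w)² + 2(Im w)², so the kernel centred at Re w is at most three
  -- times the one centred at `y`.
  have h2 : ((s - (w ε).re) ^ 2 + (w ε).im ^ 2)⁻¹ ≤ 3 * ((s - y) ^ 2 + (w ε).im ^ 2)⁻¹ := by
    rw [← div_eq_mul_inv, le_div_iff₀ (by positivity), inv_mul_le_iff₀ (by positivity)]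
    have h3 : ((w ε).re - y) ^ 2 ≤ (w ε).im ^ 2 := sq_le_sq' (by linarith [abs_le.1 hre])
      (abs_le.1 hre).2
    nlinarith [sq_nonneg ((s - (w ε).re) - ((w ε).re - y))]
  calc Real.pi⁻¹ * ((w ε).im * ((s - (w ε).re) ^ 2 + (w ε).im ^ 2)⁻¹)
      ≤ 1 * ((w ε).im * (3 * ((s - y) ^ 2 + (w ε).im ^ 2)⁻¹)) := by gcongr
    _ = _ := by ring

end

noncomputable section

open scoped FourierTransform ENNReal ContDiff SchwartzMap

/-! ### Weak derivatives on the line and the Fourier transform -/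

/-- The definition tests with real functions only; complex ones are split into real and imaginary
parts. -/
theorem IsWeakDerivOn.integral_deriv_mul_of_hasCompactSupport {G G' : ℝ → ℂ}
    (hG : IsWeakDerivOn univ G G') {ψ : ℝ → ℂ} (hψ : ContDiff ℝ ∞ ψ) (hc : HasCompactSupport ψ) :
    ∫ s, deriv ψ s * G s = -∫ s, ψ s * G' s := by
  have hre : ContDiff ℝ ∞ fun s => (ψ s).re := Complex.reCLM.contDiff.comp hψ
  have him : ContDiff ℝ ∞ fun s => (ψ s).im := Complex.imCLM.contDiff.comp hψ
  have hcre : HasCompactSupport fun s => (ψ s).re := hc.comp_left (g := Complex.re) rfl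
  have hcim : HasCompactSupport fun s => (ψ s).im := hc.comp_left (g := Complex.im) rfl
  have hd : ∀ s, HasDerivAt ψ (deriv ψ s) s := fun s =>
    (hψ.differentiable (by simp) s).hasDerivAt
  have hdre : ∀ s, deriv (fun s => (ψ s).re) s = (deriv ψ s).re := fun s =>
    (Complex.reCLM.hasFDerivAt.comp_hasDerivAt s (hd s)).deriv
  have hdim : ∀ s, deriv (fun s => (ψ s).im) s = (deriv ψ s).im := fun s =>
    (Complex.imCLM.hasFDerivAt.comp_hasDerivAt s (hd s)).deriv
  have hGl : LocallyIntegrable G volume := locallyIntegrableOn_univ.1 hG.1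
  have hGl' : LocallyIntegrable G' volume := locallyIntegrableOn_univ.1 hG.2.1
  have h1 := hG.2.2 _ hre hcre (subset_univ _)
  have h2 := hG.2.2 _ him hcim (subset_univ _)
  have hi1 := hGl.integrable_smul_left_of_hasCompactSupport (hre.continuous_deriv (by simp))
    hcre.deriv
  have hi2 := hGl.integrable_smul_left_of_hasCompactSupport (him.continuous_deriv (by simp))
    hcim.deriv
  have hi3 := hGl'.integrable_smul_left_of_hasCompactSupport hre.continuous hcre
  have hi4 := hGl'.integrable_smul_left_of_hasCompactSupport him.continuous hcim
  have e1 : ∀ s, deriv ψ s * G s = deriv (fun s => (ψ s).re) s • G s +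
      Complex.I * (deriv (fun s => (ψ s).im) s • G s) := by
    intro s
    rw [hdre, hdim, Complex.real_smul, Complex.real_smul]
    conv_lhs => rw [← Complex.re_add_im (deriv ψ s)]
    ring
  have e2 : ∀ s, ψ s * G' s = (ψ s).re • G' s + Complex.I * ((ψ s).im • G' s) := by
    intro s
    rw [Complex.real_smul, Complex.real_smul]
    conv_lhs => rw [← Complex.re_add_im (ψ s)]
    ring
  simp_rw [e1, e2]
  rw [integral_add hi1 (hi2.const_mul _), integral_add hi3 (hi4.const_mul _), integral_const_mul,
    integral_const_mul, h1, h2]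
  ring

/-- Integration by parts against smooth functions which, with their derivative, are in `L²`. -/
theorem IsWeakDerivOn.integral_deriv_mul_of_memLp {G G' : ℝ → ℂ} (hG : IsWeakDerivOn univ G G')
    (h2 : MemLp G 2 volume) (h2' : MemLp G' 2 volume) {ψ : ℝ → ℂ} (hψ : ContDiff ℝ ∞ ψ)
    (hψ2 : MemLp ψ 2 volume) (hψ2' : MemLp (deriv ψ) 2 volume) :
    ∫ s, deriv ψ s * G s = -∫ s, ψ s * G' s := by
  let b : ContDiffBump (0 : ℝ) := ⟨1, 2, one_pos, one_lt_two⟩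
  have hb : ContDiff ℝ ∞ b := b.contDiff
  obtain ⟨M, hM⟩ : ∃ M, ∀ s, ‖deriv b s‖ ≤ M :=
    (hb.continuous_deriv (by simp)).bounded_above_of_compact_support b.hasCompactSupport.deriv
  -- Dilated cutoffs: they tend to 1 pointwise and their derivatives are O(1/n), so dominated
  -- convergence removes them.
  let χ : ℕ → ℝ → ℝ := fun n s => b (s / (n + 1))
  have hχ : ∀ n, ContDiff ℝ ∞ (χ n) := fun n => hb.comp (contDiff_id.div_const _)
  have hχc : ∀ n, HasCompactSupport (χ n) := fun n => by
    have hn : ((n : ℝ) + 1)⁻¹ ≠ 0 := by positivity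
    simpa [χ, div_eq_inv_mul] using!
      b.hasCompactSupport.comp_homeomorph (Homeomorph.mulLeft₀ _ hn)
  have hχd : ∀ n s, HasDerivAt (χ n) (deriv b (s / (n + 1)) / (n + 1)) s := fun n s => by
    have h1 := (hb.differentiable (by simp) (s / (n + 1))).hasDerivAt.comp s
      ((hasDerivAt_id s).div_const ((n : ℝ) + 1))
    simpa [div_eq_mul_inv] using! h1
  have hψd : ∀ s, HasDerivAt ψ (deriv ψ s) s := fun s =>
    (hψ.differentiable (by simp) s).hasDerivAt
  have hprod : ∀ n s, deriv (fun s => (χ n s : ℂ) * ψ s) s =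
      ((deriv b (s / (n + 1)) / (n + 1) : ℝ) : ℂ) * ψ s + (χ n s : ℂ) * deriv ψ s := fun n s =>
    ((hχd n s).ofReal_comp.mul (hψd s)).deriv
  have hstep : ∀ n : ℕ, ∫ s, (((deriv b (s / (n + 1)) / (n + 1) : ℝ) : ℂ) * ψ s +
      (χ n s : ℂ) * deriv ψ s) * G s = -∫ s, (χ n s : ℂ) * ψ s * G' s := fun n => by
    have h1 := hG.integral_deriv_mul_of_hasCompactSupport (ψ := fun s => (χ n s : ℂ) * ψ s)
      ((Complex.ofRealCLM.contDiff.comp (hχ n)).mul hψ) ((hχc n).comp_left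
        (g := Complex.ofReal) Complex.ofReal_zero).mul_right
    rw [← h1]
    refine integral_congr_ae (Eventually.of_forall fun s => ?_)
    exact congrArg (· * G s) (hprod n s).symm
  have hbm : Continuous (deriv b) := hb.continuous_deriv (by simp)
  have hlim : ∀ s : ℝ, Tendsto (fun n : ℕ => s / ((n : ℝ) + 1)) atTop (𝓝 0) := fun s =>
    tendsto_const_div_atTop_nhds_zero_nat s |>.comp (tendsto_add_atTop_nat 1) |>.congr
      fun n => by simp
  have hχlim : ∀ s, Tendsto (fun n => (χ n s : ℂ)) atTop (𝓝 1) := fun s => by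
    have h1 : Tendsto (fun n => χ n s) atTop (𝓝 (b 0)) := (hb.continuous.tendsto 0).comp (hlim s)
    have h0 : b 0 = 1 := b.one_of_mem_closedBall (Metric.mem_closedBall_self zero_le_one)
    rw [h0] at h1
    exact (Complex.continuous_ofReal.tendsto 1).comp h1
  have hdlim : ∀ s : ℝ, Tendsto (fun n : ℕ => ((deriv b (s / (n + 1)) / (n + 1) : ℝ) : ℂ)) atTop
      (𝓝 0) := fun s => by
    have h1 : Tendsto (fun n : ℕ => deriv b (s / (n + 1)) / ((n : ℝ) + 1)) atTop (𝓝 0) := by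
      refine squeeze_zero_norm (fun n => ?_) (hlim M)
      rw [norm_div, Real.norm_of_nonneg (by positivity : (0 : ℝ) ≤ n + 1)]
      gcongr
      exact hM _
    exact (Complex.continuous_ofReal.tendsto 0).comp h1
  have hχ1 : ∀ n s, ‖(χ n s : ℂ)‖ ≤ 1 := fun n s => by
    rw [Complex.norm_real, Real.norm_of_nonneg b.nonneg]
    exact b.le_one
  have hχm : ∀ n, Measurable fun s => (χ n s : ℂ) := fun n =>
    (Complex.continuous_ofReal.comp (hχ n).continuous).measurable
  have hdm : ∀ n : ℕ, Measurable fun s : ℝ => ((deriv b (s / (n + 1)) / (n + 1) : ℝ) : ℂ) :=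
    fun n => (Complex.continuous_ofReal.comp
      ((hbm.comp (continuous_id.div_const _)).div_const _)).measurable
  have hd1 : ∀ (n : ℕ) (s : ℝ), ‖((deriv b (s / (n + 1)) / (n + 1) : ℝ) : ℂ)‖ ≤ M := fun n s => by
    rw [Complex.norm_real, norm_div, Real.norm_of_nonneg (by positivity : (0 : ℝ) ≤ n + 1)]
    exact (div_le_self (norm_nonneg _) (by linarith [n.cast_nonneg (α := ℝ)])).trans (hM _)
  have hL : Tendsto (fun n : ℕ => ∫ s, (((deriv b (s / (n + 1)) / (n + 1) : ℝ) : ℂ) * ψ s +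
      (χ n s : ℂ) * deriv ψ s) * G s) atTop (𝓝 (∫ s, deriv ψ s * G s)) := by
    refine tendsto_integral_of_dominated_convergence
      (fun s => M * ‖ψ s * G s‖ + ‖deriv ψ s * G s‖) (fun n => ?_) ?_ (fun n => ?_) ?_
    · exact (((hdm n).aestronglyMeasurable.mul hψ2.1).add
        ((hχm n).aestronglyMeasurable.mul hψ2'.1)).mul h2.1
    · exact ((hψ2.integrable_mul h2).norm.const_mul M).add (hψ2'.integrable_mul h2).norm
    · refine Eventually.of_forall fun s => ?_
      rw [add_mul, mul_assoc, mul_assoc]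
      refine (norm_add_le _ _).trans (add_le_add ?_ ?_)
      · rw [norm_mul]
        exact mul_le_mul_of_nonneg_right (hd1 n s) (norm_nonneg _)
      · rw [norm_mul]
        exact mul_le_of_le_one_left (norm_nonneg _) (hχ1 n s)
    · refine Eventually.of_forall fun s => ?_
      have := (((hdlim s).mul_const (ψ s)).add ((hχlim s).mul_const (deriv ψ s))).mul_const (G s)
      simpa using this
  have hR : Tendsto (fun n : ℕ => -∫ s, (χ n s : ℂ) * ψ s * G' s) atTop
      (𝓝 (-∫ s, ψ s * G' s)) := by
    refine (tendsto_integral_of_dominated_convergence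
      (fun s => ‖ψ s * G' s‖) (fun n => ?_) ?_ (fun n => ?_) ?_).neg
    · exact ((hχm n).aestronglyMeasurable.mul hψ2.1).mul h2'.1
    · exact (hψ2.integrable_mul h2').norm
    · refine Eventually.of_forall fun s => ?_
      rw [mul_assoc, norm_mul]
      exact mul_le_of_le_one_left (norm_nonneg _) (hχ1 n s)
    · refine Eventually.of_forall fun s => ?_
      simpa [mul_assoc] using (hχlim s).mul_const (ψ s * G' s)
  exact tendsto_nhds_unique hL (hR.congr fun n => (hstep n).symm)

/-! ### Modulated functions of class H¹ -/

/-- The character `y ↦ e^{-ixy}`. -/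
def chirp (x y : ℝ) : ℂ := Complex.exp (-(Complex.I * x * y))

theorem norm_chirp (x y : ℝ) : ‖chirp x y‖ = 1 := by
  rw [chirp, Complex.norm_exp]
  simp

theorem contDiff_chirp (x : ℝ) : ContDiff ℝ ∞ (chirp x) :=
  (contDiff_const.mul Complex.ofRealCLM.contDiff).neg.cexp

theorem hasDerivAt_chirp (x y : ℝ) : HasDerivAt (chirp x) (-(Complex.I * x) * chirp x y) y := by
  have h1 : HasDerivAt (fun y : ℝ => -(Complex.I * x * (y : ℂ))) (-(Complex.I * x)) y := by
    simpa using! ((hasDerivAt_id y).ofReal_comp.const_mul (Complex.I * x)).neg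
  rw [mul_comm]
  exact h1.cexp

theorem MemLp.mul_chirp {G : ℝ → ℂ} {p : ℝ≥0∞} (hG : MemLp G p volume) (x : ℝ) :
    MemLp (fun y => G y * chirp x y) p volume :=
  hG.of_le (hG.1.mul (contDiff_chirp x).continuous.aestronglyMeasurable)
    (Eventually.of_forall fun y => by rw [norm_mul, norm_chirp, mul_one])

theorem eLpNorm_mul_chirp (G : ℝ → ℂ) (p : ℝ≥0∞) (x : ℝ) :
    eLpNorm (fun y => G y * chirp x y) p volume = eLpNorm G p volume :=
  eLpNorm_congr_norm_ae (Eventually.of_forall fun y => by rw [norm_mul, norm_chirp, mul_one])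

theorem integral_coeFn_toLp_mul {G : ℝ → ℂ} (hG : MemLp G 2 volume) (k : ℝ → ℂ) :
    ∫ s, hG.toLp G s * k s = ∫ s, G s * k s := by
  refine integral_congr_ae ?_
  filter_upwards [hG.coeFn_toLp] with s hs
  rw [hs]

/-- The Fourier transform of `e^{-ixy} G'` in terms of that of `e^{-ixy} G`. -/
theorem fourier_mul_chirp_of_isWeakDerivOn {G G' : ℝ → ℂ} (hG : IsWeakDerivOn univ G G')
    (h2 : MemLp G 2 volume) (h2' : MemLp G' 2 volume) (x : ℝ) :
    (𝓕 ((MemLp.mul_chirp h2' x).toLp) : Lp ℂ 2 (volume : Measure ℝ)) =ᵐ[volume] fun ξ =>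
      Complex.I * (2 * Real.pi * ξ + x) *
        (𝓕 ((MemLp.mul_chirp h2 x).toLp) : Lp ℂ 2 (volume : Measure ℝ)) ξ := by
  set A := (MemLp.mul_chirp h2 x).toLp with hA
  set B := (MemLp.mul_chirp h2' x).toLp with hB
  have hAl : LocallyIntegrable (𝓕 A : Lp ℂ 2 (volume : Measure ℝ)) volume :=
    (Lp.memLp _).locallyIntegrable one_le_two
  have hBl : LocallyIntegrable (𝓕 B : Lp ℂ 2 (volume : Measure ℝ)) volume :=
    (Lp.memLp _).locallyIntegrable one_le_two
  have hmul : LocallyIntegrable (fun ξ : ℝ => Complex.I * (2 * Real.pi * ξ + x) *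
        (𝓕 A : Lp ℂ 2 (volume : Measure ℝ)) ξ) volume := by
    rw [← locallyIntegrableOn_univ] at hAl ⊢
    exact hAl.continuousOn_mul (by fun_prop) isOpen_univ.isLocallyClosed
  have key : ∀ᵐ ξ : ℝ, (𝓕 B : Lp ℂ 2 (volume : Measure ℝ)) ξ - Complex.I * (2 * Real.pi * ξ + x) *
        (𝓕 A : Lp ℂ 2 (volume : Measure ℝ)) ξ = 0 := by
    -- Weak formulation on the frequency side. Against a test function the multiplication formula
    -- moves the transform onto `k`, and the claim becomes integration by parts of 𝓕k·e^{-ixy}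
    -- against `G`. The function `l` is chosen so that 𝓕l is the derivative of 𝓕k.
    refine ae_eq_zero_of_integral_contDiff_smul_eq_zero (hBl.sub hmul) fun φ hφ hφc => ?_
    have hkc : HasCompactSupport fun ξ => (φ ξ : ℂ) :=
      hφc.comp_left (g := Complex.ofReal) Complex.ofReal_zero
    have hk : ContDiff ℝ ∞ fun ξ => (φ ξ : ℂ) := Complex.ofRealCLM.contDiff.comp hφ
    have hlc : HasCompactSupport fun ξ : ℝ => -2 * Real.pi * Complex.I * ξ * (φ ξ : ℂ) :=
      hkc.mul_left
    have hl : ContDiff ℝ ∞ fun ξ : ℝ => -2 * Real.pi * Complex.I * ξ * (φ ξ : ℂ) :=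
      (contDiff_const.mul Complex.ofRealCLM.contDiff).mul hk
    set k : 𝓢(ℝ, ℂ) := hkc.toSchwartzMap hk with hkdef
    set l : 𝓢(ℝ, ℂ) := hlc.toSchwartzMap hl with hldef
    have hk_apply : ∀ ξ, k ξ = φ ξ := fun ξ => rfl
    have hl_apply : ∀ ξ, l ξ = -2 * Real.pi * Complex.I * ξ * φ ξ := fun ξ => rfl
    have hder : ∀ s, HasDerivAt (𝓕 k : 𝓢(ℝ, ℂ)) ((𝓕 l : 𝓢(ℝ, ℂ)) s) s := fun s => by
      have hxk : Integrable (fun ξ : ℝ => ξ • k ξ) volume :=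
        (continuous_id.smul k.continuous).integrable_of_hasCompactSupport hkc.smul_left
      have h1 := Real.hasDerivAt_fourier k.integrable hxk s
      rw [SchwartzMap.fourier_coe, SchwartzMap.fourier_coe]
      convert! h1 using 2
    have hψd : ∀ s, HasDerivAt (fun s => (𝓕 k : 𝓢(ℝ, ℂ)) s * chirp x s)
        ((𝓕 l : 𝓢(ℝ, ℂ)) s * chirp x s - Complex.I * x * ((𝓕 k : 𝓢(ℝ, ℂ)) s * chirp x s)) s :=
      fun s => by
        convert! (hder s).mul (hasDerivAt_chirp x s) using 1
        ring
    have hψ2 : MemLp (fun s => (𝓕 k : 𝓢(ℝ, ℂ)) s * chirp x s) 2 volume :=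
      MemLp.mul_chirp ((𝓕 k : 𝓢(ℝ, ℂ)).memLp 2 volume) x
    have hl2 : MemLp (fun s => (𝓕 l : 𝓢(ℝ, ℂ)) s * chirp x s) 2 volume :=
      MemLp.mul_chirp ((𝓕 l : 𝓢(ℝ, ℂ)).memLp 2 volume) x
    have hψ' : deriv (fun s => (𝓕 k : 𝓢(ℝ, ℂ)) s * chirp x s) = fun s =>
        (𝓕 l : 𝓢(ℝ, ℂ)) s * chirp x s - Complex.I * x * ((𝓕 k : 𝓢(ℝ, ℂ)) s * chirp x s) :=
      funext fun s => (hψd s).deriv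
    have hparts := hG.integral_deriv_mul_of_memLp h2 h2'
      (((𝓕 k : 𝓢(ℝ, ℂ)).smooth ⊤).mul (contDiff_chirp x)) hψ2 (by
        rw [hψ']
        exact hl2.sub (hψ2.const_mul _))
    have hAk : ∫ ξ, (𝓕 A : Lp ℂ 2 (volume : Measure ℝ)) ξ * k ξ =
        ∫ s, (𝓕 k : 𝓢(ℝ, ℂ)) s * chirp x s * G s := by
      rw [integral_Lp_fourier_mul A k.integrable (k.memLp 2 volume)
        (by rw [← SchwartzMap.fourier_coe]; exact (𝓕 k : 𝓢(ℝ, ℂ)).memLp 2 volume), hA,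
        integral_coeFn_toLp_mul, ← SchwartzMap.fourier_coe]
      exact integral_congr_ae (Eventually.of_forall fun s => by simp only; ring)
    have hAl' : ∫ ξ, (𝓕 A : Lp ℂ 2 (volume : Measure ℝ)) ξ * l ξ =
        ∫ s, (𝓕 l : 𝓢(ℝ, ℂ)) s * chirp x s * G s := by
      rw [integral_Lp_fourier_mul A l.integrable (l.memLp 2 volume)
        (by rw [← SchwartzMap.fourier_coe]; exact (𝓕 l : 𝓢(ℝ, ℂ)).memLp 2 volume), hA,
        integral_coeFn_toLp_mul, ← SchwartzMap.fourier_coe]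
      exact integral_congr_ae (Eventually.of_forall fun s => by simp only; ring)
    have hBk : ∫ ξ, (𝓕 B : Lp ℂ 2 (volume : Measure ℝ)) ξ * k ξ =
        ∫ s, (𝓕 k : 𝓢(ℝ, ℂ)) s * chirp x s * G' s := by
      rw [integral_Lp_fourier_mul B k.integrable (k.memLp 2 volume)
        (by rw [← SchwartzMap.fourier_coe]; exact (𝓕 k : 𝓢(ℝ, ℂ)).memLp 2 volume), hB,
        integral_coeFn_toLp_mul, ← SchwartzMap.fourier_coe]
      exact integral_congr_ae (Eventually.of_forall fun s => by simp only; ring)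
    rw [hψ'] at hparts
    simp_rw [sub_mul, mul_assoc (Complex.I * (x : ℂ))] at hparts
    have hi1 : Integrable (fun s => (𝓕 l : 𝓢(ℝ, ℂ)) s * chirp x s * G s) volume :=
      hl2.integrable_mul h2
    have hi2 : Integrable (fun s => (𝓕 k : 𝓢(ℝ, ℂ)) s * chirp x s * G s) volume :=
      hψ2.integrable_mul h2
    rw [integral_sub hi1 (hi2.const_mul _), integral_const_mul, ← hAk, ← hAl', ← hBk] at hparts
    have hiA : ∀ m : 𝓢(ℝ, ℂ), Integrable
        (fun ξ => (𝓕 A : Lp ℂ 2 (volume : Measure ℝ)) ξ * m ξ) volume := fun m =>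
      (Lp.memLp _).integrable_mul (m.memLp 2 volume)
    have hiB : Integrable (fun ξ => (𝓕 B : Lp ℂ 2 (volume : Measure ℝ)) ξ * k ξ) volume :=
      (Lp.memLp _).integrable_mul (k.memLp 2 volume)
    have hsplit : ∀ ξ : ℝ, φ ξ • ((𝓕 B : Lp ℂ 2 (volume : Measure ℝ)) ξ -
        Complex.I * (2 * Real.pi * ξ + x) * (𝓕 A : Lp ℂ 2 (volume : Measure ℝ)) ξ) =
        (𝓕 B : Lp ℂ 2 (volume : Measure ℝ)) ξ * k ξ +
          ((𝓕 A : Lp ℂ 2 (volume : Measure ℝ)) ξ * l ξ -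
            Complex.I * x * ((𝓕 A : Lp ℂ 2 (volume : Measure ℝ)) ξ * k ξ)) := fun ξ => by
      rw [hk_apply, hl_apply, Complex.real_smul]
      ring
    simp_rw [hsplit]
    have hiA' : Integrable (fun ξ => (𝓕 A : Lp ℂ 2 (volume : Measure ℝ)) ξ * l ξ -
        Complex.I * x * ((𝓕 A : Lp ℂ 2 (volume : Measure ℝ)) ξ * k ξ)) volume :=
      (hiA l).sub ((hiA k).const_mul _)
    rw [integral_add hiB hiA', integral_sub (hiA l) ((hiA k).const_mul _), integral_const_mul,
      hparts]
    ring
  filter_upwards [key] with ξ hξ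
  exact sub_eq_zero.1 hξ

/-- Decay in `x > 0` of the projection of `e^{-ixy} G` onto the Hardy space. -/
theorem ofReal_mul_eLpNorm_hardyProj_mul_chirp_le {G G' : ℝ → ℂ} (hG : IsWeakDerivOn univ G G')
    (h2 : MemLp G 2 volume) (h2' : MemLp G' 2 volume) {x : ℝ} (hx : 0 ≤ x) :
    ENNReal.ofReal x * eLpNorm (hardyProj ((MemLp.mul_chirp h2 x).toLp)) 2 volume ≤
      eLpNorm G' 2 volume := by
  rw [eLpNorm_hardyProj, ← eLpNorm_mul_chirp G' 2 x,
    ← eLpNorm_congr_ae (MemLp.mul_chirp h2' x).coeFn_toLp, ← eLpNorm_fourier,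
    ← Real.enorm_of_nonneg hx, ← eLpNorm_const_smul]
  refine eLpNorm_mono_ae ?_
  filter_upwards [fourier_mul_chirp_of_isWeakDerivOn hG h2 h2' x] with ξ hξ
  rw [hξ, Pi.smul_apply, norm_smul]
  by_cases h0 : ξ ∈ Ioi (0 : ℝ)
  -- Here the signs matter: with ξ > 0 and x ≥ 0 there is no cancellation in 2πξ + x, which is
  -- therefore at least x.
  · rw [indicator_of_mem h0, norm_mul, norm_mul, Complex.norm_I, one_mul]
    refine mul_le_mul_of_nonneg_right ?_ (norm_nonneg _)
    have h1 : (2 * Real.pi * ξ + x : ℂ) = ((2 * Real.pi * ξ + x : ℝ) : ℂ) := by push_cast; rfl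
    have h3 := mul_pos Real.two_pi_pos (mem_Ioi.1 h0)
    rw [h1, Complex.norm_real, Real.norm_of_nonneg hx, Real.norm_of_nonneg (by linarith)]
    linarith
  · rw [indicator_of_notMem h0, norm_zero, mul_zero]
    exact norm_nonneg _

/-! ### Uniform bounds through integrable Fourier transforms -/

/-- The parameter x only translates the function, and its squared norm is 1/2 for every x. -/
theorem eLpNorm_inv_one_add_I_mul_le (x : ℝ) :
    eLpNorm (fun ξ : ℝ => (1 + Complex.I * (2 * Real.pi * ξ + x))⁻¹) 2 volume ≤ 1 := by
  have hb : 0 < (2 * Real.pi)⁻¹ := inv_pos.2 Real.two_pi_pos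
  have hn : ∀ ξ : ℝ, ‖(1 + Complex.I * (2 * Real.pi * ξ + x))⁻¹‖ₑ ^ (2 : ℝ) =
      ENNReal.ofReal ((2 * Real.pi)⁻¹ * ((ξ - -(x / (2 * Real.pi))) ^ 2 +
        ((2 * Real.pi)⁻¹) ^ 2)⁻¹) * ENNReal.ofReal (2 * Real.pi)⁻¹ := fun ξ => by
    have h1 : (1 + Complex.I * (2 * Real.pi * ξ + x) : ℂ) =
        ((1 : ℝ) : ℂ) + ((2 * Real.pi * ξ + x : ℝ) : ℂ) * Complex.I := by
      push_cast
      ring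
    rw [← ofReal_norm, ENNReal.ofReal_rpow_of_nonneg (norm_nonneg _) zero_le_two,
      ← ENNReal.ofReal_mul (by positivity), Real.rpow_two, norm_inv, inv_pow, Complex.sq_norm, h1,
      Complex.normSq_add_mul_I]
    have hc := Real.two_pi_pos.ne'
    generalize 2 * Real.pi = c at hc
    congr 1
    rw [← mul_inv, ← mul_inv]
    congr 1
    field_simp
    ring
  have hint : ∫⁻ ξ : ℝ, ‖(1 + Complex.I * (2 * Real.pi * ξ + x))⁻¹‖ₑ ^ (2 : ℝ) ≤ 1 := by
    simp_rw [hn]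
    rw [lintegral_mul_const' _ _ ENNReal.ofReal_ne_top, lintegral_mul_inv_sq_add_sq hb,
      ← ENNReal.ofReal_mul Real.pi_pos.le, ENNReal.ofReal_le_one]
    have hpi := Real.pi_ne_zero
    field_simp
    norm_num
  rw [eLpNorm_eq_lintegral_rpow_enorm_toReal two_ne_zero ENNReal.ofNat_ne_top]
  simp only [ENNReal.toReal_ofNat]
  exact ENNReal.rpow_le_one hint (by norm_num)

theorem enorm_cauchyIntegral_le_lintegral_fourier (h : Lp ℂ 2 (volume : Measure ℝ)) {w : ℂ}
    (hw : 0 < w.im) :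
    ‖cauchyIntegral h w‖ₑ ≤ ∫⁻ ξ, ‖(𝓕 h : Lp ℂ 2 (volume : Measure ℝ)) ξ‖ₑ := by
  rw [cauchyIntegral_eq_integral_fourier h hw]
  refine (enorm_integral_le_lintegral_enorm _).trans (lintegral_mono fun ξ => ?_)
  rw [enorm_mul]
  refine mul_le_of_le_one_right zero_le ?_
  rw [← ofReal_norm, ENNReal.ofReal_le_one]
  exact norm_expKernel_le hw ξ

/-- The Cauchy integral of `e^{-ixy} G` is bounded, uniformly in `x`, for `G` in `H¹`. -/
theorem enorm_cauchyIntegral_mul_chirp_le {G G' : ℝ → ℂ} (hG : IsWeakDerivOn univ G G')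
    (h2 : MemLp G 2 volume) (h2' : MemLp G' 2 volume) (x : ℝ) {w : ℂ} (hw : 0 < w.im) :
    ‖cauchyIntegral (fun y => G y * chirp x y) w‖ₑ ≤
      eLpNorm G 2 volume + eLpNorm G' 2 volume := by
  rw [← cauchyIntegral_congr_ae (MemLp.mul_chirp h2 x).coeFn_toLp, ← eLpNorm_mul_chirp G 2 x,
    ← eLpNorm_mul_chirp G' 2 x, ← eLpNorm_congr_ae (MemLp.mul_chirp h2 x).coeFn_toLp,
    ← eLpNorm_congr_ae (MemLp.mul_chirp h2' x).coeFn_toLp, 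
    ← eLpNorm_fourier (MemLp.mul_chirp h2 x).toLp, ← eLpNorm_fourier (MemLp.mul_chirp h2' x).toLp]
  have hrel := fourier_mul_chirp_of_isWeakDerivOn hG h2 h2' x
  set A := (MemLp.mul_chirp h2 x).toLp with hA
  set B := (MemLp.mul_chirp h2' x).toLp with hB
  refine (enorm_cauchyIntegral_le_lintegral_fourier A hw).trans ?_
  have hFA := Lp.aestronglyMeasurable (𝓕 A : Lp ℂ 2 (volume : Measure ℝ))
  have hFB := Lp.aestronglyMeasurable (𝓕 B : Lp ℂ 2 (volume : Measure ℝ))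
  have hm : AEStronglyMeasurable (fun ξ : ℝ => (1 + Complex.I * (2 * Real.pi * ξ + x))⁻¹)
      volume := Measurable.aestronglyMeasurable (by fun_prop)
  -- The relation 𝓕B = i(2πξ + x)𝓕A is solved as 𝓕A = (𝓕A + 𝓕B)/(1 + i(2πξ + x)), so Cauchy–Schwarz
  -- bounds the L¹ norm of 𝓕A.
  have heq : (𝓕 A : Lp ℂ 2 (volume : Measure ℝ)) =ᵐ[volume]
      (fun ξ : ℝ => (1 + Complex.I * (2 * Real.pi * ξ + x))⁻¹) •
        (⇑(𝓕 A : Lp ℂ 2 (volume : Measure ℝ)) + ⇑(𝓕 B : Lp ℂ 2 (volume : Measure ℝ))) := by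
    filter_upwards [hrel] with ξ hξ
    rw [Pi.smul_apply', Pi.add_apply, hξ, smul_eq_mul]
    have h0 : (1 + Complex.I * (2 * Real.pi * ξ + x) : ℂ) ≠ 0 := fun h => by
      have := congrArg Complex.re h
      simp at this
    field_simp
  rw [← eLpNorm_one_eq_lintegral_enorm, eLpNorm_congr_ae heq]
  calc _ ≤ _ := eLpNorm_smul_le_mul_eLpNorm (p := 2) (q := 2) (hFA.add hFB) hm
    _ ≤ 1 * (eLpNorm (𝓕 A : Lp ℂ 2 (volume : Measure ℝ)) 2 volume +
          eLpNorm (𝓕 B : Lp ℂ 2 (volume : Measure ℝ)) 2 volume) :=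
        mul_le_mul' (eLpNorm_inv_one_add_I_mul_le x) (eLpNorm_add_le hFA hFB one_le_two)
    _ = _ := one_mul _

end

noncomputable section

open scoped ENNReal ContDiff

/-! ### The phase as a two-to-one change of variables -/

/-- The positive half line for `τ = 1`, the negative one for `τ = -1`. -/
def halfLine (τ : ℝ) : Set ℝ := {s | 0 < τ * s}

theorem mem_halfLine {τ s : ℝ} : s ∈ halfLine τ ↔ 0 < τ * s := Iff.rfl

/-- The inverse branches of `Theta`, with values in `halfLine τ`, for `τ = 1` and `τ = -1`. -/
def branch (τ y : ℝ) : ℝ := τ * Real.exp (τ * Real.arsinh y)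

/-- The derivative of the inverse branches of `Theta`, in terms of their value. -/
def jac (s : ℝ) : ℝ := 2 * s ^ 2 / (1 + s ^ 2)

/-- The derivative of `Theta`. -/
def dTheta (s : ℝ) : ℝ := (1 + (s ^ 2)⁻¹) / 2

theorem jac_nonneg (s : ℝ) : 0 ≤ jac s := by
  unfold jac
  positivity

theorem jac_mul_dTheta {s : ℝ} (hs : s ≠ 0) : jac s * dTheta s = 1 := by
  unfold jac dTheta
  field_simp
  ring

theorem jac_pos {s : ℝ} (hs : s ≠ 0) : 0 < jac s := by
  unfold jac
  positivity

theorem measurable_jac : Measurable jac := by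
  unfold jac
  fun_prop

theorem measurable_Theta : Measurable Theta := by
  unfold Theta
  fun_prop

theorem measurable_branch (τ : ℝ) : Measurable (branch τ) :=
  ((Real.continuous_arsinh.const_mul τ).rexp.const_mul τ).measurable

theorem hasDerivAt_Theta {s : ℝ} (hs : s ≠ 0) : HasDerivAt Theta (dTheta s) s := by
  unfold Theta dTheta
  convert! ((hasDerivAt_id s).sub (hasDerivAt_inv hs)).div_const 2 using 2
  ring

theorem mul_branch_pos {τ : ℝ} (hτ : τ = 1 ∨ τ = -1) (y : ℝ) : 0 < τ * branch τ y := by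
  have h1 : τ * τ = 1 := by rcases hτ with rfl | rfl <;> norm_num
  rw [branch, ← mul_assoc, h1, one_mul]
  exact Real.exp_pos _

theorem branch_ne_zero {τ : ℝ} (hτ : τ = 1 ∨ τ = -1) (y : ℝ) : branch τ y ≠ 0 := fun h => by
  have := mul_branch_pos hτ y
  rw [h, mul_zero] at this
  exact lt_irrefl _ this

theorem Theta_branch {τ : ℝ} (hτ : τ = 1 ∨ τ = -1) (y : ℝ) : Theta (branch τ y) = y := by
  conv_rhs => rw [← Real.sinh_arsinh y, Real.sinh_eq]
  unfold Theta branch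
  rcases hτ with rfl | rfl
  · simp [Real.exp_neg]
  · simp [Real.exp_neg]
    ring

theorem branch_Theta {τ : ℝ} (hτ : τ = 1 ∨ τ = -1) {s : ℝ} (hs : 0 < τ * s) :
    branch τ (Theta s) = s := by
  have h1 : τ * τ = 1 := by rcases hτ with rfl | rfl <;> norm_num
  have h2 : Theta s = Real.sinh (τ * Real.log (τ * s)) := by
    have h3 : s = branch τ (Real.sinh (τ * Real.log (τ * s))) := by
      rw [branch, Real.arsinh_sinh, ← mul_assoc, h1, one_mul, Real.exp_log hs, ← mul_assoc, h1,
        one_mul]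
    conv_lhs => rw [h3]
    exact Theta_branch hτ _
  rw [h2, branch, Real.arsinh_sinh, ← mul_assoc, h1, one_mul, Real.exp_log hs, ← mul_assoc, h1,
    one_mul]

theorem range_branch {τ : ℝ} (hτ : τ = 1 ∨ τ = -1) : branch τ '' univ = halfLine τ := by
  ext s
  simp only [image_univ, mem_range, mem_halfLine]
  constructor
  · rintro ⟨y, rfl⟩
    exact mul_branch_pos hτ y
  · intro hs
    exact ⟨Theta s, branch_Theta hτ hs⟩

theorem injective_branch {τ : ℝ} (hτ : τ = 1 ∨ τ = -1) : Function.Injective (branch τ) :=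
  Function.LeftInverse.injective (g := Theta) (Theta_branch hτ)

theorem measurableSet_halfLine (τ : ℝ) : MeasurableSet (halfLine τ) :=
  measurableSet_lt measurable_const (measurable_id.const_mul τ)

theorem hasDerivAt_branch {τ : ℝ} (hτ : τ = 1 ∨ τ = -1) (y : ℝ) :
    HasDerivAt (branch τ) (jac (branch τ y)) y := by
  have h1 := (((Real.hasDerivAt_arsinh y).const_mul τ).exp).const_mul τ
  convert! h1 using 1
  have hc : √(1 + y ^ 2) = (Real.exp (Real.arsinh y) + Real.exp (-Real.arsinh y)) / 2 := by
    rw [← Real.cosh_arsinh, Real.cosh_eq]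
  rw [hc, jac, branch]
  have he := Real.exp_pos (Real.arsinh y)
  rcases hτ with rfl | rfl
  · simp only [one_mul, Real.exp_neg]
    field_simp
    ring
  · simp only [neg_mul, one_mul, Real.exp_neg]
    field_simp

theorem setLIntegral_halfLine {τ : ℝ} (hτ : τ = 1 ∨ τ = -1) (b : ℝ → ℝ≥0∞) :
    ∫⁻ s in halfLine τ, b s =
      ∫⁻ y, ENNReal.ofReal (jac (branch τ y)) * b (branch τ y) := by
  rw [← range_branch hτ, lintegral_image_eq_lintegral_abs_deriv_mul MeasurableSet.univ
    (fun y _ => (hasDerivAt_branch hτ y).hasDerivWithinAt) (injective_branch hτ).injOn,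
    Measure.restrict_univ]
  simp_rw [abs_of_nonneg (jac_nonneg _)]

/-- The Jacobian is nowhere zero on the branch, so null sets pull back to null sets. Almost
everywhere strong measurability then survives composition with the branches. -/
theorem quasiMeasurePreserving_branch {τ : ℝ} (hτ : τ = 1 ∨ τ = -1) :
    Measure.QuasiMeasurePreserving (branch τ) volume volume := by
  refine ⟨measurable_branch τ, Measure.AbsolutelyContinuous.mk fun N hN h0 => ?_⟩
  rw [Measure.map_apply (measurable_branch τ) hN]
  have h1 := setLIntegral_halfLine hτ (N.indicator 1)
  have h2 : ∫⁻ s in halfLine τ, N.indicator (1 : ℝ → ℝ≥0∞) s = 0 := by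
    refine le_antisymm ((setLIntegral_le_lintegral _ _).trans ?_) zero_le
    rw [lintegral_indicator_one hN, h0]
  rw [h2, eq_comm, lintegral_eq_zero_iff] at h1
  · have h3 : ∀ᵐ y : ℝ, y ∉ branch τ ⁻¹' N := by
      filter_upwards [h1] with y hy hmem
      rw [indicator_of_mem (mem_preimage.1 hmem)] at hy
      simp only [Pi.one_apply, mul_one, Pi.zero_apply, ENNReal.ofReal_eq_zero] at hy
      exact absurd (jac_pos (branch_ne_zero hτ y)) (not_lt.2 hy)
    exact measure_eq_zero_iff_ae_notMem.2 h3
  · exact (measurable_jac.comp (measurable_branch τ)).ennreal_ofReal.mul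
      ((measurable_one.indicator hN).comp (measurable_branch τ))

theorem ae_ne_zero : ∀ᵐ s : ℝ, s ≠ 0 := by
  simp [ae_iff]

/-- Boundary values known for almost every y pull back to almost every z with y = Θ(z). -/
theorem quasiMeasurePreserving_Theta : Measure.QuasiMeasurePreserving Theta volume volume := by
  refine ⟨measurable_Theta, Measure.AbsolutelyContinuous.mk fun N hN h0 => ?_⟩
  rw [Measure.map_apply measurable_Theta hN]
  have h1 : ∀ τ : ℝ, τ = 1 ∨ τ = -1 → volume (halfLine τ ∩ Theta ⁻¹' N) = 0 := by
    intro τ hτ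
    rw [inter_comm, ← Measure.restrict_apply (measurable_Theta hN),
      ← lintegral_indicator_one (measurable_Theta hN), setLIntegral_halfLine hτ]
    refine lintegral_eq_zero_of_ae_eq_zero ?_
    filter_upwards [measure_eq_zero_iff_ae_notMem.1 h0] with y hy
    rw [indicator_of_notMem (by simpa [Theta_branch hτ] using hy), mul_zero]
    rfl
  refine measure_mono_null (t := (halfLine 1 ∩ Theta ⁻¹' N) ∪
    (halfLine (-1) ∩ Theta ⁻¹' N) ∪ {0}) ?_ ?_
  · intro s hs
    rcases lt_trichotomy s 0 with h | h | h
    · exact Or.inl (Or.inr ⟨by simpa [mem_halfLine] using h, hs⟩)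
    · exact Or.inr h
    · exact Or.inl (Or.inl ⟨by simpa [mem_halfLine] using h, hs⟩)
  · exact measure_union_null (measure_union_null (h1 1 (Or.inl rfl)) (h1 (-1) (Or.inr rfl)))
      (by simp)

/-- The `L²` norm on a half line after the change of variables. -/
theorem eLpNorm_restrict_halfLine {τ : ℝ} (hτ : τ = 1 ∨ τ = -1) (F : ℝ → ℂ) :
    eLpNorm F 2 (volume.restrict (halfLine τ)) =
      eLpNorm (fun y => √(jac (branch τ y)) • F (branch τ y)) 2 volume := by
  rw [eLpNorm_eq_lintegral_rpow_enorm_toReal two_ne_zero ENNReal.ofNat_ne_top,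
    eLpNorm_eq_lintegral_rpow_enorm_toReal two_ne_zero ENNReal.ofNat_ne_top,
    setLIntegral_halfLine hτ]
  congr 1
  refine lintegral_congr fun y => ?_
  rw [enorm_smul, ENNReal.mul_rpow_of_nonneg _ _ (by norm_num), Real.enorm_of_nonneg
    (Real.sqrt_nonneg _), ENNReal.ofReal_rpow_of_nonneg (Real.sqrt_nonneg _) (by norm_num)]
  simp only [ENNReal.toReal_ofNat, Real.rpow_two, Real.sq_sqrt (jac_nonneg _)]

theorem eLpNorm_le_add_restrict_halfLine {F : ℝ → ℂ} (hF : AEStronglyMeasurable F volume) :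
    eLpNorm F 2 volume ≤ eLpNorm F 2 (volume.restrict (halfLine 1)) +
      eLpNorm F 2 (volume.restrict (halfLine (-1))) := by
  rw [← eLpNorm_indicator_eq_eLpNorm_restrict (measurableSet_halfLine 1),
    ← eLpNorm_indicator_eq_eLpNorm_restrict (measurableSet_halfLine (-1))]
  refine le_trans (le_of_eq (eLpNorm_congr_ae ?_)) (eLpNorm_add_le
    (hF.indicator (measurableSet_halfLine 1)) (hF.indicator (measurableSet_halfLine (-1))) one_le_two)
  filter_upwards [ae_ne_zero] with s hs
  rw [Pi.add_apply]
  rcases hs.lt_or_gt with h | h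
  · rw [indicator_of_notMem (by simpa [mem_halfLine] using h.le), indicator_of_mem (by simpa [mem_halfLine] using h), zero_add]
  · rw [indicator_of_mem (by simpa [mem_halfLine] using h), indicator_of_notMem (by simpa [mem_halfLine] using h.le), add_zero]

/-- Composition with `Theta`, with a weight, is bounded on `L²`. -/
theorem eLpNorm_smul_comp_Theta_le {u : ℝ → ℂ} (hu : AEStronglyMeasurable u volume) {c : ℝ → ℝ}
    (hc : Measurable c) (hcj : ∀ s, c s ^ 2 * jac s ≤ 4) :
    eLpNorm (fun s => c s • u (Theta s)) 2 volume ≤ 4 * eLpNorm u 2 volume := by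
  have hm : AEStronglyMeasurable (fun s => c s • u (Theta s)) volume :=
    hc.aestronglyMeasurable.smul (hu.comp_quasiMeasurePreserving quasiMeasurePreserving_Theta)
  have h1 : ∀ τ : ℝ, τ = 1 ∨ τ = -1 →
      eLpNorm (fun s => c s • u (Theta s)) 2 (volume.restrict (halfLine τ)) ≤
        2 * eLpNorm u 2 volume := fun τ hτ => by
    suffices hpt : ∀ y, ‖√(jac (branch τ y)) • c (branch τ y) • u (Theta (branch τ y))‖ ≤
        2 * ‖u y‖ by
      have h2 := eLpNorm_le_mul_eLpNorm_of_ae_le_mul (μ := volume) (Eventually.of_forall hpt) 2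
      rwa [ENNReal.ofReal_ofNat, ← eLpNorm_restrict_halfLine hτ
        (fun s => c s • u (Theta s))] at h2
    intro y
    rw [Theta_branch hτ, norm_smul, norm_smul, ← mul_assoc]
    refine mul_le_mul_of_nonneg_right ?_ (norm_nonneg _)
    rw [Real.norm_of_nonneg (Real.sqrt_nonneg _), Real.norm_eq_abs]
    refine abs_le_of_sq_le_sq' ?_ zero_le_two |>.2
    rw [mul_pow, Real.sq_sqrt (jac_nonneg _), sq_abs, mul_comm]
    exact (hcj _).trans (by norm_num)
  refine (eLpNorm_le_add_restrict_halfLine hm).trans ((add_le_add (h1 1 (Or.inl rfl))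
    (h1 (-1) (Or.inr rfl))).trans (le_of_eq ?_))
  rw [← add_mul]
  norm_num

/-- Summation over the fibres of `Theta`. -/
def fiberSum (b : ℝ → ℂ) (y : ℝ) : ℂ := b (branch 1 y) + b (branch (-1) y)

theorem aestronglyMeasurable_fiberSum {b : ℝ → ℂ} (hb : AEStronglyMeasurable b volume) :
    AEStronglyMeasurable (fiberSum b) volume :=
  (hb.comp_quasiMeasurePreserving (quasiMeasurePreserving_branch (Or.inl rfl))).add
    (hb.comp_quasiMeasurePreserving (quasiMeasurePreserving_branch (Or.inr rfl)))

/-- On each branch dy = `dTheta s` ds, so the L² norm in y is the L² norm in s with weight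
√`dTheta`. The factor 2 counts the branches. -/
theorem eLpNorm_fiberSum_le {b : ℝ → ℂ} (hb : AEStronglyMeasurable b volume) :
    eLpNorm (fiberSum b) 2 volume ≤ 2 * eLpNorm (fun s => √(dTheta s) • b s) 2 volume := by
  have h1 : ∀ τ : ℝ, τ = 1 ∨ τ = -1 → eLpNorm (fun y => b (branch τ y)) 2 volume ≤
      eLpNorm (fun s => √(dTheta s) • b s) 2 volume := fun τ hτ => by
    refine le_trans (le_of_eq ?_) (eLpNorm_mono_measure _ (Measure.restrict_le_self
      (s := halfLine τ)))
    rw [eLpNorm_restrict_halfLine hτ]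
    congr 1
    funext y
    rw [smul_smul, ← Real.sqrt_mul (jac_nonneg _), jac_mul_dTheta (branch_ne_zero hτ y),
      Real.sqrt_one, one_smul]
  rw [two_mul]
  exact (eLpNorm_add_le
    (hb.comp_quasiMeasurePreserving (quasiMeasurePreserving_branch (Or.inl rfl)))
    (hb.comp_quasiMeasurePreserving (quasiMeasurePreserving_branch (Or.inr rfl)))
    one_le_two).trans (add_le_add (h1 1 (Or.inl rfl)) (h1 (-1) (Or.inr rfl)))

theorem integral_fiberSum {b : ℝ → ℂ} (hb : Integrable (fun s => dTheta s • b s) volume) :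
    ∫ y, fiberSum b y = ∫ s, dTheta s • b s := by
  have h1 : ∀ τ : ℝ, τ = 1 ∨ τ = -1 → Integrable (fun y => b (branch τ y)) volume ∧
      ∫ y, b (branch τ y) = ∫ s in halfLine τ, dTheta s • b s := fun τ hτ => by
    have hcanc : ∀ y, |jac (branch τ y)| • dTheta (branch τ y) • b (branch τ y) =
        b (branch τ y) := fun y => by
      rw [abs_of_nonneg (jac_nonneg _), smul_smul, jac_mul_dTheta (branch_ne_zero hτ y), one_smul]
    constructor
    · have h2 := (integrableOn_image_iff_integrableOn_abs_deriv_smul MeasurableSet.univ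
        (fun y _ => (hasDerivAt_branch hτ y).hasDerivWithinAt) (injective_branch hτ).injOn
        (fun s => dTheta s • b s)).1 hb.integrableOn
      simpa only [hcanc, integrableOn_univ] using h2
    · rw [← range_branch hτ, integral_image_eq_integral_abs_deriv_smul MeasurableSet.univ
        (fun y _ => (hasDerivAt_branch hτ y).hasDerivWithinAt) (injective_branch hτ).injOn,
        Measure.restrict_univ]
      simp_rw [hcanc]
  obtain ⟨hi1, he1⟩ := h1 1 (Or.inl rfl)
  obtain ⟨hi2, he2⟩ := h1 (-1) (Or.inr rfl)
  unfold fiberSum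
  have h0 : ∫ s in halfLine (-1), dTheta s • b s = ∫ s in (halfLine 1)ᶜ, dTheta s • b s := by
    have e1 : (halfLine 1)ᶜ = Iic 0 := by ext; simp [mem_halfLine]
    have e2 : halfLine (-1) = Iio 0 := by ext; simp [mem_halfLine]
    rw [e1, e2, integral_Iic_eq_integral_Iio]
  rw [integral_add hi1 hi2, he1, he2, h0,
    integral_add_compl (measurableSet_halfLine 1) hb]

end

noncomputable section

open scoped ENNReal ContDiff

/-! ### Weak derivatives under the change of variables -/

/-- The preimage of `[-R, R]` under `Theta` is contained in this compact subset of `ℝ ∖ {0}`. -/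
def annulus (R : ℝ) : Set ℝ := {s | (2 * R + 1)⁻¹ ≤ |s| ∧ |s| ≤ 2 * R + 1}

theorem isCompact_annulus (R : ℝ) : IsCompact (annulus R) := by
  refine (isCompact_closedBall (0 : ℝ) (2 * R + 1)).of_isClosed_subset ?_ fun s hs => ?_
  · exact (isClosed_le continuous_const continuous_abs).inter
      (isClosed_le continuous_abs continuous_const)
  · simpa [Metric.mem_closedBall] using hs.2

theorem annulus_subset {R : ℝ} (hR : 0 ≤ R) : annulus R ⊆ {0}ᶜ := fun s hs h => by
  rw [mem_singleton_iff] at h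
  have h1 := hs.1
  rw [h, abs_zero] at h1
  have : 0 < (2 * R + 1)⁻¹ := by positivity
  linarith

/-- |Θ(s)| is half of ||s| - |s|⁻¹|. If |s| > 2R + 1 then |s|⁻¹ < 1 and this exceeds R; the lower
bound follows by the symmetry |s| ↔ |s|⁻¹. -/
theorem mem_annulus_of_abs_Theta_le {R s : ℝ} (hR : 0 ≤ R) (hs : s ≠ 0) (h : |Theta s| ≤ R) :
    s ∈ annulus R := by
  have hpos : 0 < |s| := abs_pos.2 hs
  have h1 : |Theta s| = abs (|s| - |s|⁻¹) / 2 := by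
    unfold Theta
    rw [abs_div, abs_two]
    congr 1
    rcases hs.lt_or_gt with h | h
    · rw [abs_of_neg h, inv_neg, ← abs_neg]
      congr 1
      ring
    · rw [abs_of_pos h]
  rw [h1, div_le_iff₀ two_pos, abs_le] at h
  obtain ⟨ha, hb⟩ := h
  constructor
  · rw [inv_le_comm₀ (by positivity) hpos]
    by_contra! hcon
    have h2 : 1 < |s|⁻¹ := by linarith
    have h3 : |s| < 1 := (one_lt_inv₀ hpos).1 h2
    linarith
  · by_contra! hcon
    have h2 : 1 < |s| := by linarith
    have h3 : |s|⁻¹ < 1 := inv_lt_one_of_one_lt₀ h2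
    linarith

theorem exists_support_bound {φ : ℝ → ℝ} (hφ : HasCompactSupport φ) :
    ∃ R : ℝ, 0 ≤ R ∧ ∀ y, φ y ≠ 0 → |y| ≤ R := by
  obtain ⟨R, hR⟩ := hφ.isCompact.isBounded.subset_closedBall 0
  refine ⟨max R 0, le_max_right _ _, fun y hy => ?_⟩
  have := hR (subset_tsupport φ hy)
  rw [Metric.mem_closedBall, Real.dist_eq, sub_zero] at this
  exact this.trans (le_max_left _ _)

theorem continuousOn_Theta : ContinuousOn Theta {0}ᶜ := fun _ hs =>
  (hasDerivAt_Theta hs).continuousAt.continuousWithinAt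

theorem contDiffAt_Theta {s : ℝ} (hs : s ≠ 0) : ContDiffAt ℝ ∞ Theta s :=
  (contDiffAt_id.sub (contDiffAt_inv ℝ hs)).div_const 2

theorem integrable_comp_Theta_mul_smul {φ : ℝ → ℝ} (hφ : Continuous φ) (hφc : HasCompactSupport φ)
    {c : ℝ → ℝ} (hc : ContinuousOn c {0}ᶜ) {f : ℝ → ℂ} (hf : LocallyIntegrableOn f {0}ᶜ volume) :
    Integrable (fun s => (φ (Theta s) * c s) • f s) volume := by
  obtain ⟨R, hR, hsupp⟩ := exists_support_bound hφc
  have hsub := annulus_subset hR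
  have h1 : IntegrableOn (fun s => (φ (Theta s) * c s) • f s) (annulus R) volume :=
    (hf.integrableOn_compact_subset hsub (isCompact_annulus R)).continuousOn_smul
      (((hφ.comp_continuousOn continuousOn_Theta).mul hc).mono hsub) (isCompact_annulus R)
  refine ((integrable_indicator_iff (isCompact_annulus R).measurableSet).2 h1).congr ?_
  filter_upwards [ae_ne_zero] with s hs
  by_cases hmem : s ∈ annulus R
  · rw [indicator_of_mem hmem]
  · rw [indicator_of_notMem hmem]
    have h0 : φ (Theta s) = 0 := by
      by_contra hne
      exact hmem (mem_annulus_of_abs_Theta_le hR hs (hsupp _ hne))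
    simp [h0]

/-- The pullback of a test function by `Theta`, times a smooth function, is a test function on
`ℝ ∖ {0}` when set to zero at the origin. -/
def pullbackTest (φ a : ℝ → ℝ) : ℝ → ℝ := fun s => if s = 0 then 0 else φ (Theta s) * a s

theorem pullbackTest_of_ne {φ a : ℝ → ℝ} {s : ℝ} (hs : s ≠ 0) :
    pullbackTest φ a s = φ (Theta s) * a s := if_neg hs

theorem pullbackTest_eventuallyEq (φ a : ℝ → ℝ) {s : ℝ} (hs : s ≠ 0) :
    pullbackTest φ a =ᶠ[𝓝 s] fun s => φ (Theta s) * a s := by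
  filter_upwards [isOpen_ne.mem_nhds hs] with t ht
  exact pullbackTest_of_ne ht

theorem tsupport_pullbackTest_subset {φ : ℝ → ℝ} (a : ℝ → ℝ) {R : ℝ} (hR : 0 ≤ R)
    (hsupp : ∀ y, φ y ≠ 0 → |y| ≤ R) : tsupport (pullbackTest φ a) ⊆ annulus R := by
  refine closure_minimal (fun s hs => ?_) (isCompact_annulus R).isClosed
  rw [Function.mem_support, pullbackTest] at hs
  split_ifs at hs with h0
  · exact absurd rfl hs
  · exact mem_annulus_of_abs_Theta_le hR h0 (hsupp _ (left_ne_zero_of_mul hs))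

/-- The only doubtful point is the origin, and there the function vanishes identically nearby,
because |Θ| tends to infinity. -/
theorem contDiff_pullbackTest {φ a : ℝ → ℝ} (hφ : ContDiff ℝ ∞ φ) (hφc : HasCompactSupport φ)
    (ha : ContDiff ℝ ∞ a) : ContDiff ℝ ∞ (pullbackTest φ a) := by
  obtain ⟨R, hR, hsupp⟩ := exists_support_bound hφc
  rw [contDiff_iff_contDiffAt]
  intro s
  by_cases hs : s = 0
  · have h0 : s ∉ tsupport (pullbackTest φ a) := fun h =>
      annulus_subset hR (tsupport_pullbackTest_subset a hR hsupp h) hs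
    exact contDiffAt_const.congr_of_eventuallyEq (notMem_tsupport_iff_eventuallyEq.1 h0)
  · exact ((hφ.contDiffAt.comp s (contDiffAt_Theta hs)).mul ha.contDiffAt).congr_of_eventuallyEq
      (pullbackTest_eventuallyEq φ a hs)

theorem deriv_pullbackTest {φ a : ℝ → ℝ} (hφ : ContDiff ℝ ∞ φ) (ha : ContDiff ℝ ∞ a) {s : ℝ}
    (hs : s ≠ 0) : deriv (pullbackTest φ a) s =
      deriv φ (Theta s) * (dTheta s * a s) + φ (Theta s) * deriv a s := by
  rw [(pullbackTest_eventuallyEq φ a hs).deriv_eq]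
  have h1 := ((hφ.differentiable (by simp) (Theta s)).hasDerivAt.comp s (hasDerivAt_Theta hs)).mul
    (ha.differentiable (by simp) s).hasDerivAt
  rw [← mul_assoc]
  exact h1.deriv

/-- The chain rule for the sum over the fibres of `Theta`, in the sense of weak derivatives. -/
theorem isWeakDerivOn_fiberSum {f g : ℝ → ℂ} (hfg : IsWeakDerivOn {0}ᶜ f g) {a : ℝ → ℝ}
    (ha : ContDiff ℝ ∞ a)
    (h1 : LocallyIntegrable (fiberSum fun s => a s • f s) volume)
    (h2 : LocallyIntegrable (fiberSum fun s => jac s • (a s • g s + deriv a s • f s)) volume) :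
    IsWeakDerivOn univ (fiberSum fun s => a s • f s)
      (fiberSum fun s => jac s • (a s • g s + deriv a s • f s)) := by
  refine ⟨locallyIntegrableOn_univ.2 h1, locallyIntegrableOn_univ.2 h2, fun φ hφ hφc _ => ?_⟩
  have hpull : ∀ (χ : ℝ → ℝ) (b : ℝ → ℂ) (y : ℝ), χ y • fiberSum b y =
      fiberSum (fun s => χ (Theta s) • b s) y := fun χ b y => by
    simp only [fiberSum, Theta_branch (Or.inl rfl), Theta_branch (Or.inr rfl), smul_add]
  have hdT : ContinuousOn dTheta {0}ᶜ := by
    unfold dTheta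
    exact (continuousOn_const.add ((continuousOn_pow 2).inv₀ fun s hs =>
      pow_ne_zero 2 hs)).div_const 2
  have hac : ContinuousOn a {0}ᶜ := ha.continuous.continuousOn
  have hac' : ContinuousOn (deriv a) {0}ᶜ := (ha.continuous_deriv (by simp)).continuousOn
  have hφd : Continuous (deriv φ) := hφ.continuous_deriv (by simp)
  have i1 : Integrable (fun s => (deriv φ (Theta s) * (dTheta s * a s)) • f s) volume :=
    integrable_comp_Theta_mul_smul hφd hφc.deriv (hdT.mul hac) hfg.1
  have i2 := integrable_comp_Theta_mul_smul hφ.continuous hφc hac' hfg.1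
  have i3 := integrable_comp_Theta_mul_smul hφ.continuous hφc hac hfg.2.1
  obtain ⟨R, hR, hsupp⟩ := exists_support_bound hφc
  have hts := tsupport_pullbackTest_subset a hR hsupp
  -- The definition of the weak derivative of `f` is applied to (φ∘Θ)·a. The product rule leaves a
  -- term with `deriv a`, which moves to the right-hand side; `jac` there cancels the `dTheta` of
  -- the substitution.
  have hw := hfg.2.2 (pullbackTest φ a) (contDiff_pullbackTest hφ hφc ha)
    (HasCompactSupport.of_support_subset_isCompact (isCompact_annulus R)
      ((subset_tsupport _).trans hts)) (hts.trans (annulus_subset hR))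
  have e1 : ∫ s, deriv (pullbackTest φ a) s • f s =
      (∫ s, (deriv φ (Theta s) * (dTheta s * a s)) • f s) +
        ∫ s, (φ (Theta s) * deriv a s) • f s := by
    rw [← integral_add i1 i2]
    refine integral_congr_ae ?_
    filter_upwards [ae_ne_zero] with s hs
    rw [deriv_pullbackTest hφ ha hs, add_smul]
  have e2 : ∫ s, pullbackTest φ a s • g s = ∫ s, (φ (Theta s) * a s) • g s := by
    refine integral_congr_ae ?_
    filter_upwards [ae_ne_zero] with s hs
    rw [pullbackTest_of_ne hs]
  simp_rw [hpull]
  have c1 : ∀ s, dTheta s • deriv φ (Theta s) • a s • f s =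
      (deriv φ (Theta s) * (dTheta s * a s)) • f s := fun s => by
    simp only [smul_smul]
    congr 1
    ring
  have c2 : (fun s => dTheta s • φ (Theta s) • jac s • (a s • g s + deriv a s • f s)) =ᵐ[volume]
      fun s => (φ (Theta s) * a s) • g s + (φ (Theta s) * deriv a s) • f s := by
    filter_upwards [ae_ne_zero] with s hs
    have hj := jac_mul_dTheta hs
    simp only [smul_add, smul_smul]
    congr 2
    · linear_combination (φ (Theta s) * a s) * hj
    · linear_combination (φ (Theta s) * deriv a s) * hj
  rw [integral_fiberSum (by simpa only [c1] using i1),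
    integral_fiberSum ((i3.add i2).congr c2.symm), integral_congr_ae c2, integral_add i3 i2]
  simp_rw [c1]
  rw [e1, e2] at hw
  rw [neg_add, ← hw]
  abel

/-! ### The Cauchy kernel under the change of variables -/

/-- The complex extension of `Theta`. -/
def complexTheta (w : ℂ) : ℂ := (w - w⁻¹) / 2

theorem complexTheta_im (w : ℂ) : (complexTheta w).im = w.im * (1 + (Complex.normSq w)⁻¹) / 2 := by
  have h1 : complexTheta w = ((2 : ℝ)⁻¹ : ℝ) * (w - w⁻¹) := by
    unfold complexTheta
    push_cast
    ring
  rw [h1, Complex.im_ofReal_mul, Complex.sub_im, Complex.inv_im]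
  ring

theorem complexTheta_im_pos {w : ℂ} (hw : 0 < w.im) : 0 < (complexTheta w).im := by
  rw [complexTheta_im]
  have := Complex.normSq_nonneg w
  positivity

theorem neg_inv_im_pos {w : ℂ} (hw : 0 < w.im) : 0 < (-w⁻¹).im := by
  have hw0 : w ≠ 0 := fun h => by simp [h] at hw
  rw [Complex.neg_im, Complex.inv_im, neg_div, neg_neg]
  exact div_pos hw (Complex.normSq_pos.2 hw0)

/-- The equation Θ(s) = Θ(w) is quadratic in s with roots w and -1/w, both in the upper half plane.
-/
theorem inv_Theta_sub {w : ℂ} (hw : 0 < w.im) {s : ℝ} (hs : s ≠ 0) :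
    ((Theta s : ℂ) - complexTheta w)⁻¹ =
      2 * s * ((s : ℂ) - w)⁻¹ * ((s : ℂ) - (-w⁻¹))⁻¹ := by
  have hw0 : w ≠ 0 := fun h => by simp [h] at hw
  have h1 := ofReal_sub_ne_zero hw.ne' s
  have h2 := ofReal_sub_ne_zero (neg_inv_im_pos hw).ne' s
  have hs' : (s : ℂ) ≠ 0 := Complex.ofReal_ne_zero.2 hs
  have h3 : (Theta s : ℂ) - complexTheta w =
      ((s : ℂ) - w) * ((s : ℂ) - (-w⁻¹)) / (2 * s) := by
    unfold Theta complexTheta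
    push_cast
    field_simp
    ring
  rw [h3, inv_div, div_eq_mul_inv, mul_inv]
  ring

theorem norm_inv_ofReal_sub_le {w : ℂ} (hw : 0 < w.im) (s : ℝ) :
    ‖((s : ℂ) - w)⁻¹‖ ≤ w.im⁻¹ := by
  rw [norm_inv]
  refine inv_anti₀ hw ?_
  have h1 := Complex.abs_im_le_norm ((s : ℂ) - w)
  rwa [Complex.sub_im, Complex.ofReal_im, zero_sub, abs_neg, abs_of_pos hw] at h1

theorem norm_ofReal_mul_inv_sub_le {w : ℂ} (hw : 0 < w.im) (s : ℝ) :
    ‖(s : ℂ) * ((s : ℂ) - w)⁻¹‖ ≤ 1 + ‖w‖ / w.im := by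
  have h1 := ofReal_sub_ne_zero hw.ne' s
  have h2 : (s : ℂ) * ((s : ℂ) - w)⁻¹ = 1 + w * ((s : ℂ) - w)⁻¹ := by
    field_simp
    ring
  rw [h2]
  refine (norm_add_le _ _).trans ?_
  rw [norm_one, norm_mul, div_eq_mul_inv]
  gcongr
  exact norm_inv_ofReal_sub_le hw s

/-! ### The two fibre sums in the Cauchy integral -/

/-- The weights `jac s * s ^ (n - 2)` occurring in the change of variables. -/
def fiberWeight (n : ℕ) (s : ℝ) : ℝ := 2 * s ^ n / (1 + s ^ 2)

theorem measurable_fiberWeight (n : ℕ) : Measurable (fiberWeight n) := by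
  unfold fiberWeight
  fun_prop

theorem dTheta_mul_fiberWeight_two {s : ℝ} (hs : s ≠ 0) : dTheta s * fiberWeight 2 s = 1 := by
  rw [mul_comm]
  exact jac_mul_dTheta hs

theorem dTheta_mul_fiberWeight_one {s : ℝ} (hs : s ≠ 0) : dTheta s * fiberWeight 1 s = s⁻¹ := by
  unfold dTheta fiberWeight
  field_simp
  ring

theorem cauchyIntegral_fiberSum_mul_chirp {b : ℝ → ℂ} {x : ℝ} {w : ℂ}
    (h : Integrable (fun s => dTheta s • (b s * chirp x (Theta s) *
      ((Theta s : ℂ) - w)⁻¹)) volume) :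
    cauchyIntegral (fun y => fiberSum b y * chirp x y) w =
      1 / (2 * (Real.pi : ℂ) * Complex.I) * ∫ s, dTheta s • (b s * chirp x (Theta s) *
      ((Theta s : ℂ) - w)⁻¹) := by
  rw [cauchyIntegral, ← integral_fiberSum h]
  congr 1
  refine integral_congr_ae (Eventually.of_forall fun y => ?_)
  simp only [fiberSum, Theta_branch (Or.inl rfl), Theta_branch (Or.inr rfl)]
  ring

theorem integrable_mul_bounded_mul_inv_sub {f B : ℝ → ℂ} (hf : MemLp f 2 volume)
    (hB : Measurable B) {M : ℝ} (hM : ∀ s, ‖B s‖ ≤ M) (x : ℝ) {w : ℂ} (hw : 0 < w.im) :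
    Integrable (fun s => f s * chirp x (Theta s) * (B s * ((s : ℂ) - w)⁻¹)) volume := by
  have hmc : Measurable fun s => chirp x (Theta s) :=
    (contDiff_chirp x).continuous.measurable.comp measurable_Theta
  refine ((hf.integrable_mul (memLp_inv_ofReal_sub hw.ne')).norm.const_mul M).mono' ?_
    (Eventually.of_forall fun s => ?_)
  · exact (hf.1.mul hmc.aestronglyMeasurable).mul
      (hB.mul (measurable_inv_ofReal_sub w)).aestronglyMeasurable
  · rw [Pi.mul_apply, norm_mul, norm_mul, norm_chirp, mul_one, norm_mul, norm_mul, mul_left_comm]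
    gcongr
    exact hM s

/-- The change of variables `y = Theta s` in the Cauchy integral. -/
theorem cauchyIntegral_mul_chirp_Theta {f : ℝ → ℂ} (hf : MemLp f 2 volume) (x : ℝ) {w : ℂ}
    (hw : 0 < w.im) :
    cauchyIntegral (fun s => f s * chirp x (Theta s)) w =
      1 / 2 * cauchyIntegral
        (fun y => fiberSum (fun s => fiberWeight 2 s • f s) y * chirp x y) (complexTheta w) +
      1 / (2 * w) * cauchyIntegral
        (fun y => fiberSum (fun s => fiberWeight 1 s • f s) y * chirp x y) (complexTheta w) := by
  have hw0 : w ≠ 0 := fun h => by simp [h] at hw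
  have hw' := neg_inv_im_pos hw
  -- The identity used is 1/(s-w) = (s + 1/w)/((s-w)(s + 1/w)). The summand s of the numerator gives
  -- the fibre sum with weight index 2, the summand 1/w the one with index 1. In both, one factor of
  -- the kernel is bounded and the other is in L².
  have i2 : Integrable (fun s => f s * chirp x (Theta s) *
      ((2 * ((s : ℂ) * ((s : ℂ) - w)⁻¹)) * ((s : ℂ) - (-w⁻¹))⁻¹)) volume := by
    refine integrable_mul_bounded_mul_inv_sub hf ?_ (M := 2 * (1 + ‖w‖ / w.im)) (fun s => ?_) x hw'
    · exact (Complex.measurable_ofReal.mul (measurable_inv_ofReal_sub w)).const_mul 2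
    · rw [norm_mul, Complex.norm_ofNat]
      exact mul_le_mul_of_nonneg_left (norm_ofReal_mul_inv_sub_le hw s) zero_le_two
  have i1 : Integrable (fun s => f s * chirp x (Theta s) *
      ((2 * ((s : ℂ) - w)⁻¹) * ((s : ℂ) - (-w⁻¹))⁻¹)) volume := by
    refine integrable_mul_bounded_mul_inv_sub hf ?_ (M := 2 * w.im⁻¹) (fun s => ?_) x hw'
    · exact (measurable_inv_ofReal_sub w).const_mul 2
    · rw [norm_mul, Complex.norm_ofNat]
      exact mul_le_mul_of_nonneg_left (norm_inv_ofReal_sub_le hw s) zero_le_two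
  have e2 : (fun s => dTheta s • (fiberWeight 2 s • f s * chirp x (Theta s) *
      ((Theta s : ℂ) - complexTheta w)⁻¹)) =ᵐ[volume] fun s => f s * chirp x (Theta s) *
      ((2 * ((s : ℂ) * ((s : ℂ) - w)⁻¹)) * ((s : ℂ) - (-w⁻¹))⁻¹) := by
    filter_upwards [ae_ne_zero] with s hs
    rw [inv_Theta_sub hw hs, smul_mul_assoc, smul_mul_assoc, smul_smul,
      dTheta_mul_fiberWeight_two hs, one_smul]
    ring
  have e1 : (fun s => dTheta s • (fiberWeight 1 s • f s * chirp x (Theta s) *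
      ((Theta s : ℂ) - complexTheta w)⁻¹)) =ᵐ[volume] fun s => f s * chirp x (Theta s) *
      ((2 * ((s : ℂ) - w)⁻¹) * ((s : ℂ) - (-w⁻¹))⁻¹) := by
    filter_upwards [ae_ne_zero] with s hs
    have hs' : (s : ℂ) ≠ 0 := Complex.ofReal_ne_zero.2 hs
    rw [inv_Theta_sub hw hs, smul_mul_assoc, smul_mul_assoc, smul_smul,
      dTheta_mul_fiberWeight_one hs, Complex.real_smul, Complex.ofReal_inv]
    field_simp
  rw [cauchyIntegral_fiberSum_mul_chirp (i2.congr e2.symm),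
    cauchyIntegral_fiberSum_mul_chirp (i1.congr e1.symm), integral_congr_ae e2,
    integral_congr_ae e1, cauchyIntegral, mul_left_comm (1 / 2 : ℂ), mul_left_comm (1 / (2 * w)),
    ← mul_add, ← integral_const_mul (1 / 2 : ℂ), ← integral_const_mul (1 / (2 * w)),
    ← integral_add (i2.const_mul _) (i1.const_mul _)]
  congr 1
  refine integral_congr_ae (Eventually.of_forall fun s => ?_)
  have h1 := ofReal_sub_ne_zero hw.ne' s
  have h2 := ofReal_sub_ne_zero hw'.ne' s
  have h3 : (s : ℂ) * w + 1 ≠ 0 := fun h => by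
    apply h2
    field_simp
    linear_combination h
  simp only
  field_simp
  rw [sub_neg_eq_add, mul_div_cancel_right₀ _ h3]

end

noncomputable section

open scoped ENNReal ContDiff

/-! ### The space `X₀` with a chosen weak derivative -/

/-- `f` and its weak derivative `g` are square integrable with the weights of `X₀`. -/
structure IsX0Pair (f g : ℝ → ℂ) : Prop where
  weakDeriv : IsWeakDerivOn {0}ᶜ f g
  outer : MemLp f 2 (volume.restrict (Icc (-1) 1)ᶜ)
  outer_deriv : MemLp g 2 (volume.restrict (Icc (-1) 1)ᶜ)
  inner_deriv : MemWL2 1 (Icc (-1) 1) g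
  inner : MemWL2 (-1) (Icc (-1) 1) f

/-- The norm of `X₀` with the weak derivative as a second argument. -/
def normX0Pair (f g : ℝ → ℂ) : ℝ≥0∞ :=
  eLpNorm f 2 (volume.restrict (Icc (-1) 1)ᶜ) + eLpNorm g 2 (volume.restrict (Icc (-1) 1)ᶜ) +
    normWL2 1 (Icc (-1) 1) g + normWL2 (-1) (Icc (-1) 1) f

theorem MemX0.isX0Pair {f : ℝ → ℂ} (hf : MemX0 f) : IsX0Pair f (wDeriv f) where
  weakDeriv := by
    have h := hf.weaklyDiff
    rw [wDeriv, weakDerivOn, dif_pos h]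
    exact Classical.choose_spec h
  outer := hf.outer
  outer_deriv := hf.outer_deriv
  inner_deriv := hf.inner_deriv
  inner := hf.inner

theorem normX0Pair_wDeriv (f : ℝ → ℂ) : normX0Pair f (wDeriv f) = normX0 f := rfl

/-- The weight `|s|^m` on `[-1, 1]` and `1` elsewhere. -/
def splitWeight (m : ℤ) (s : ℝ) : ℝ := (Icc (-1 : ℝ) 1).piecewise (fun s => |s| ^ m) 1 s

theorem splitWeight_of_mem (m : ℤ) {s : ℝ} (hs : s ∈ Icc (-1 : ℝ) 1) :
    splitWeight m s = |s| ^ m := piecewise_eq_of_mem _ _ _ hs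

theorem splitWeight_of_notMem (m : ℤ) {s : ℝ} (hs : s ∉ Icc (-1 : ℝ) 1) :
    splitWeight m s = 1 := piecewise_eq_of_notMem _ _ _ hs

theorem splitWeight_nonneg (m : ℤ) (s : ℝ) : 0 ≤ splitWeight m s := by
  by_cases hs : s ∈ Icc (-1 : ℝ) 1
  · rw [splitWeight_of_mem m hs]
    positivity
  · rw [splitWeight_of_notMem m hs]
    exact zero_le_one

theorem measurable_splitWeight (m : ℤ) : Measurable (splitWeight m) :=
  Measurable.piecewise measurableSet_Icc (measurable_norm.pow_const m) measurable_const

/-- Merges the norms over the two regions into a single weighted L² norm on the line, the form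
suited to the change of variables. -/
theorem memLp_splitWeight_smul {m : ℤ} {f : ℝ → ℂ}
    (ho : MemLp f 2 (volume.restrict (Icc (-1) 1)ᶜ)) (hi : MemWL2 m (Icc (-1) 1) f) :
    MemLp (fun s => splitWeight m s • f s) 2 volume ∧
      eLpNorm (fun s => splitWeight m s • f s) 2 volume ≤
        eLpNorm f 2 (volume.restrict (Icc (-1) 1)ᶜ) + normWL2 m (Icc (-1) 1) f := by
  have h1 : (fun s => splitWeight m s • f s) =
      (Icc (-1 : ℝ) 1)ᶜ.indicator f +
        (Icc (-1 : ℝ) 1).indicator (fun s : ℝ => (|s| ^ m : ℝ) • f s) := by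
    funext s
    rw [Pi.add_apply]
    by_cases hs : s ∈ Icc (-1 : ℝ) 1
    · rw [splitWeight_of_mem m hs, indicator_of_notMem (by simpa using hs), indicator_of_mem hs,
        zero_add]
    · rw [splitWeight_of_notMem m hs, indicator_of_mem (by simpa using hs),
        indicator_of_notMem hs, add_zero, one_smul]
  have m1 : MemLp ((Icc (-1 : ℝ) 1)ᶜ.indicator f) 2 volume :=
    (memLp_indicator_iff_restrict measurableSet_Icc.compl).2 ho
  have m2 : MemLp ((Icc (-1 : ℝ) 1).indicator (fun s : ℝ => (|s| ^ m : ℝ) • f s)) 2 volume :=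
    (memLp_indicator_iff_restrict measurableSet_Icc).2 hi
  rw [h1]
  refine ⟨m1.add m2, (eLpNorm_add_le m1.1 m2.1 one_le_two).trans (le_of_eq ?_)⟩
  rw [eLpNorm_indicator_eq_eLpNorm_restrict measurableSet_Icc.compl,
    eLpNorm_indicator_eq_eLpNorm_restrict measurableSet_Icc]
  rfl

theorem splitWeight_ne_zero (m : ℤ) {s : ℝ} (hs : s ≠ 0) : splitWeight m s ≠ 0 := by
  by_cases h : s ∈ Icc (-1 : ℝ) 1
  · rw [splitWeight_of_mem m h]
    exact zpow_ne_zero _ (abs_ne_zero.2 hs)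
  · rw [splitWeight_of_notMem m h]
    exact one_ne_zero

theorem aestronglyMeasurable_of_splitWeight_smul {m : ℤ} {f : ℝ → ℂ}
    (h : AEStronglyMeasurable (fun s => splitWeight m s • f s) volume) :
    AEStronglyMeasurable f volume := by
  refine ((measurable_splitWeight m).inv.aestronglyMeasurable.smul h).congr ?_
  filter_upwards [ae_ne_zero] with s hs
  simp only [Pi.smul_apply', Pi.inv_apply]
  rw [smul_smul, inv_mul_cancel₀ (splitWeight_ne_zero m hs), one_smul]

theorem abs_le_one_of_mem_Icc {s : ℝ} (hs : s ∈ Icc (-1 : ℝ) 1) : |s| ≤ 1 := abs_le.2 hs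

theorem one_lt_sq_of_notMem_Icc {s : ℝ} (hs : s ∉ Icc (-1 : ℝ) 1) : 1 < s ^ 2 := by
  rw [one_lt_sq_iff_one_lt_abs]
  by_contra! h
  exact hs (abs_le.1 h)

theorem one_le_splitWeight_neg_one {s : ℝ} (hs : s ≠ 0) : 1 ≤ splitWeight (-1) s := by
  by_cases h : s ∈ Icc (-1 : ℝ) 1
  · rw [splitWeight_of_mem _ h, zpow_neg_one]
    exact one_le_inv_iff₀.2 ⟨abs_pos.2 hs, abs_le_one_of_mem_Icc h⟩
  · rw [splitWeight_of_notMem _ h]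

/-- `dTheta` grows like s⁻²/2 at the origin and tends to 1/2 at infinity: this is the weight that X₀
puts on f. -/
theorem sqrt_dTheta_le {s : ℝ} (hs : s ≠ 0) : √(dTheta s) ≤ splitWeight (-1) s := by
  refine Real.sqrt_le_iff.2 ⟨splitWeight_nonneg _ _, ?_⟩
  have hs2 : 0 < s ^ 2 := by positivity
  by_cases h : s ∈ Icc (-1 : ℝ) 1
  · have h1 : s ^ 2 ≤ 1 := (sq_le_one_iff_abs_le_one s).2 (abs_le_one_of_mem_Icc h)
    have h2 : 1 ≤ (s ^ 2)⁻¹ := one_le_inv_iff₀.2 ⟨hs2, h1⟩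
    rw [splitWeight_of_mem _ h, zpow_neg_one, inv_pow, sq_abs, dTheta]
    linarith
  · have h2 : (s ^ 2)⁻¹ < 1 := inv_lt_one_of_one_lt₀ (one_lt_sq_of_notMem_Icc h)
    rw [splitWeight_of_notMem _ h, dTheta]
    linarith

/-- `jac` behaves like 2s² at the origin and is bounded at infinity: this is the weight that X₀ puts
on f'. -/
theorem sqrt_jac_le_two_mul (s : ℝ) : √(jac s) ≤ 2 * splitWeight 1 s := by
  refine Real.sqrt_le_iff.2 ⟨mul_nonneg zero_le_two (splitWeight_nonneg _ _), ?_⟩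
  rw [jac, div_le_iff₀ (by positivity), mul_pow]
  by_cases h : s ∈ Icc (-1 : ℝ) 1
  · rw [splitWeight_of_mem _ h, zpow_one, sq_abs]
    nlinarith [sq_nonneg s, sq_nonneg (s ^ 2)]
  · rw [splitWeight_of_notMem _ h]
    nlinarith [sq_nonneg s]

theorem sqrt_jac_le_two (s : ℝ) : √(jac s) ≤ 2 := by
  refine Real.sqrt_le_iff.2 ⟨zero_le_two, ?_⟩
  rw [jac, div_le_iff₀ (by positivity)]
  nlinarith [sq_nonneg s]

theorem sqrt_dTheta_mul_jac {s : ℝ} (hs : s ≠ 0) : √(dTheta s) * jac s = √(jac s) := by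
  have h1 : √(jac s) * √(dTheta s) = 1 := by
    rw [← Real.sqrt_mul (jac_nonneg s), jac_mul_dTheta hs, Real.sqrt_one]
  calc √(dTheta s) * jac s = √(dTheta s) * (√(jac s) * √(jac s)) := by
        rw [Real.mul_self_sqrt (jac_nonneg s)]
    _ = √(jac s) * √(dTheta s) * √(jac s) := by ring
    _ = √(jac s) := by rw [h1, one_mul]

theorem contDiff_fiberWeight (n : ℕ) : ContDiff ℝ ∞ (fiberWeight n) := by
  unfold fiberWeight
  exact (contDiff_const.mul (contDiff_id.pow n)).div (contDiff_const.add (contDiff_id.pow 2))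
    fun s => by positivity

/-- The index 2 is the largest for which sⁿ/(1+s²) stays bounded. -/
theorem abs_fiberWeight_le {n : ℕ} (hn : n ≤ 2) (s : ℝ) : |fiberWeight n s| ≤ 2 := by
  unfold fiberWeight
  rw [abs_div, abs_of_pos (by positivity : 0 < 1 + s ^ 2), div_le_iff₀ (by positivity), abs_le]
  interval_cases n <;> constructor <;> nlinarith [sq_nonneg (s - 1), sq_nonneg (s + 1)]

theorem deriv_fiberWeight (n : ℕ) (s : ℝ) : deriv (fiberWeight n) s =
    (2 * (n * s ^ (n - 1)) * (1 + s ^ 2) - 2 * s ^ n * (2 * s)) / (1 + s ^ 2) ^ 2 := by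
  have h1 : HasDerivAt (fun s : ℝ => 2 * s ^ n) (2 * (n * s ^ (n - 1))) s :=
    (hasDerivAt_pow n s).const_mul 2
  have h2 : HasDerivAt (fun s : ℝ => 1 + s ^ 2) (2 * s) s := by
    simpa using (hasDerivAt_pow 2 s).const_add 1
  exact (h1.div h2 (by positivity)).deriv

theorem abs_deriv_fiberWeight_le {n : ℕ} (hn : n ≤ 2) (s : ℝ) :
    |deriv (fiberWeight n) s| ≤ 4 := by
  rw [deriv_fiberWeight, abs_div, abs_of_pos (by positivity : 0 < (1 + s ^ 2) ^ 2),
    div_le_iff₀ (by positivity), abs_le]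
  interval_cases n <;> constructor <;> norm_num <;>
    nlinarith [sq_nonneg (s - 1), sq_nonneg (s + 1), sq_nonneg (s ^ 2), sq_nonneg s]

/-! ### Fibre sums of functions in X₀ -/

/-- The sum of `f` over the fibres of `Theta`, weighted by `fiberWeight n`. -/
def weightedFiberSum (n : ℕ) (f : ℝ → ℂ) : ℝ → ℂ := fiberSum fun s => fiberWeight n s • f s

/-- The weak derivative of `weightedFiberSum n f`, where `g` is the weak derivative of `f`. -/
def weightedFiberSumDeriv (n : ℕ) (f g : ℝ → ℂ) : ℝ → ℂ :=
  fiberSum fun s => jac s • (fiberWeight n s • g s + deriv (fiberWeight n) s • f s)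

namespace IsX0Pair

variable {f g : ℝ → ℂ}

theorem memLp_weight (h : IsX0Pair f g) : MemLp (fun s => splitWeight (-1) s • f s) 2 volume :=
  (memLp_splitWeight_smul h.outer h.inner).1

theorem memLp_weight_deriv (h : IsX0Pair f g) : MemLp (fun s => splitWeight 1 s • g s) 2 volume :=
  (memLp_splitWeight_smul h.outer_deriv h.inner_deriv).1

theorem eLpNorm_weight_add_le (h : IsX0Pair f g) :
    eLpNorm (fun s => splitWeight (-1) s • f s) 2 volume +
      eLpNorm (fun s => splitWeight 1 s • g s) 2 volume ≤ normX0Pair f g := by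
  refine (add_le_add (memLp_splitWeight_smul h.outer h.inner).2
    (memLp_splitWeight_smul h.outer_deriv h.inner_deriv).2).trans (le_of_eq ?_)
  unfold normX0Pair
  abel

theorem normX0Pair_ne_top (h : IsX0Pair f g) : normX0Pair f g ≠ ⊤ := by
  unfold normX0Pair
  exact ENNReal.add_ne_top.2 ⟨ENNReal.add_ne_top.2 ⟨ENNReal.add_ne_top.2
    ⟨h.outer.2.ne, h.outer_deriv.2.ne⟩, h.inner_deriv.2.ne⟩, h.inner.2.ne⟩

theorem aestronglyMeasurable (h : IsX0Pair f g) : AEStronglyMeasurable f volume :=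
  aestronglyMeasurable_of_splitWeight_smul h.memLp_weight.1

theorem aestronglyMeasurable_deriv (h : IsX0Pair f g) : AEStronglyMeasurable g volume :=
  aestronglyMeasurable_of_splitWeight_smul h.memLp_weight_deriv.1

theorem eLpNorm_le (h : IsX0Pair f g) : eLpNorm f 2 volume ≤ normX0Pair f g := by
  refine (eLpNorm_mono_ae ?_).trans (le_self_add.trans h.eLpNorm_weight_add_le)
  filter_upwards [ae_ne_zero] with s hs
  rw [norm_smul, Real.norm_of_nonneg (splitWeight_nonneg _ _)]
  exact le_mul_of_one_le_left (norm_nonneg _) (one_le_splitWeight_neg_one hs)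

theorem memLp (h : IsX0Pair f g) : MemLp f 2 volume :=
  ⟨h.aestronglyMeasurable, h.eLpNorm_le.trans_lt h.normX0Pair_ne_top.lt_top⟩

theorem eLpNorm_weightedFiberSum_le (h : IsX0Pair f g) {n : ℕ} (hn : n ≤ 2) :
    eLpNorm (weightedFiberSum n f) 2 volume ≤
      4 * eLpNorm (fun s => splitWeight (-1) s • f s) 2 volume := by
  have hm : AEStronglyMeasurable (fun s => fiberWeight n s • f s) volume :=
    (measurable_fiberWeight n).aestronglyMeasurable.smul h.aestronglyMeasurable
  have h1 : eLpNorm (fun s => √(dTheta s) • fiberWeight n s • f s) 2 volume ≤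
      ENNReal.ofReal 2 * eLpNorm (fun s => splitWeight (-1) s • f s) 2 volume := by
    refine eLpNorm_le_mul_eLpNorm_of_ae_le_mul ?_ 2
    filter_upwards [ae_ne_zero] with s hs
    rw [norm_smul, norm_smul, norm_smul, Real.norm_of_nonneg (Real.sqrt_nonneg _),
      Real.norm_of_nonneg (splitWeight_nonneg _ _), Real.norm_eq_abs]
    calc √(dTheta s) * (|fiberWeight n s| * ‖f s‖)
        ≤ splitWeight (-1) s * (2 * ‖f s‖) := by
          gcongr
          · exact splitWeight_nonneg _ _
          · exact sqrt_dTheta_le hs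
          · exact abs_fiberWeight_le hn s
      _ = _ := by ring
  rw [ENNReal.ofReal_ofNat] at h1
  calc _ ≤ _ := eLpNorm_fiberSum_le hm
    _ ≤ 2 * (2 * eLpNorm (fun s => splitWeight (-1) s • f s) 2 volume) := by gcongr
    _ = _ := by
      rw [← mul_assoc]
      norm_num

/-- The √`dTheta` of the change of variables and the factor `jac` of the chain rule combine to
√`jac`. On the term with `g` this supplies the weight |s| near the origin; on the term with `f` its
boundedness is enough. -/
theorem eLpNorm_weightedFiberSumDeriv_le (h : IsX0Pair f g) {n : ℕ} (hn : n ≤ 2) :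
    eLpNorm (weightedFiberSumDeriv n f g) 2 volume ≤
      16 * (eLpNorm (fun s => splitWeight (-1) s • f s) 2 volume +
        eLpNorm (fun s => splitWeight 1 s • g s) 2 volume) := by
  have hmg : AEStronglyMeasurable (fun s => fiberWeight n s • g s) volume :=
    (measurable_fiberWeight n).aestronglyMeasurable.smul h.aestronglyMeasurable_deriv
  have hmf : AEStronglyMeasurable (fun s => deriv (fiberWeight n) s • f s) volume :=
    (measurable_deriv (fiberWeight n)).aestronglyMeasurable.smul h.aestronglyMeasurable
  have hm : AEStronglyMeasurable
      (fun s => jac s • (fiberWeight n s • g s + deriv (fiberWeight n) s • f s)) volume :=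
    measurable_jac.aestronglyMeasurable.smul (hmg.add hmf)
  have hsq : AEStronglyMeasurable (fun s => √(jac s)) volume :=
    measurable_jac.sqrt.aestronglyMeasurable
  have h1 : eLpNorm (fun s => √(jac s) • fiberWeight n s • g s) 2 volume ≤
      ENNReal.ofReal 4 * eLpNorm (fun s => splitWeight 1 s • g s) 2 volume := by
    refine eLpNorm_le_mul_eLpNorm_of_ae_le_mul (Eventually.of_forall fun s => ?_) 2
    rw [norm_smul, norm_smul, norm_smul, Real.norm_of_nonneg (Real.sqrt_nonneg _),
      Real.norm_of_nonneg (splitWeight_nonneg _ _), Real.norm_eq_abs]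
    calc √(jac s) * (|fiberWeight n s| * ‖g s‖)
        ≤ 2 * splitWeight 1 s * (2 * ‖g s‖) := by
          have := splitWeight_nonneg 1 s
          gcongr
          · exact sqrt_jac_le_two_mul s
          · exact abs_fiberWeight_le hn s
      _ = _ := by ring
  have h2 : eLpNorm (fun s => √(jac s) • deriv (fiberWeight n) s • f s) 2 volume ≤
      ENNReal.ofReal 8 * eLpNorm (fun s => splitWeight (-1) s • f s) 2 volume := by
    refine eLpNorm_le_mul_eLpNorm_of_ae_le_mul ?_ 2
    filter_upwards [ae_ne_zero] with s hs
    rw [norm_smul, norm_smul, norm_smul, Real.norm_of_nonneg (Real.sqrt_nonneg _),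
      Real.norm_of_nonneg (splitWeight_nonneg _ _), Real.norm_eq_abs]
    calc √(jac s) * (|deriv (fiberWeight n) s| * ‖f s‖)
        ≤ 2 * (4 * (splitWeight (-1) s * ‖f s‖)) := by
          have h3 := sqrt_jac_le_two s
          have h4 := abs_deriv_fiberWeight_le hn s
          have h5 := one_le_splitWeight_neg_one hs
          gcongr
          exact le_mul_of_one_le_left (norm_nonneg _) h5
      _ = _ := by ring
  rw [ENNReal.ofReal_ofNat] at h1 h2
  calc _ ≤ _ := eLpNorm_fiberSum_le hm
    _ = 2 * eLpNorm ((fun s => √(jac s) • fiberWeight n s • g s) +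
          fun s => √(jac s) • deriv (fiberWeight n) s • f s) 2 volume := by
      congr 1
      refine eLpNorm_congr_ae ?_
      filter_upwards [ae_ne_zero] with s hs
      rw [smul_smul, sqrt_dTheta_mul_jac hs, Pi.add_apply, smul_add]
    _ ≤ 2 * (8 * eLpNorm (fun s => splitWeight 1 s • g s) 2 volume +
          8 * eLpNorm (fun s => splitWeight (-1) s • f s) 2 volume) := by
      gcongr
      refine (eLpNorm_add_le (hsq.smul hmg) (hsq.smul hmf) one_le_two).trans
        (add_le_add (h1.trans ?_) h2)
      gcongr
      norm_num
    _ = _ := by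
      rw [← mul_add, ← mul_assoc, add_comm]
      norm_num

theorem memLp_weightedFiberSum (h : IsX0Pair f g) {n : ℕ} (hn : n ≤ 2) :
    MemLp (weightedFiberSum n f) 2 volume := by
  refine ⟨aestronglyMeasurable_fiberSum ((measurable_fiberWeight n).aestronglyMeasurable.smul
    h.aestronglyMeasurable), (h.eLpNorm_weightedFiberSum_le hn).trans_lt ?_⟩
  exact ENNReal.mul_lt_top (by norm_num) h.memLp_weight.2

theorem memLp_weightedFiberSumDeriv (h : IsX0Pair f g) {n : ℕ} (hn : n ≤ 2) :
    MemLp (weightedFiberSumDeriv n f g) 2 volume := by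
  refine ⟨aestronglyMeasurable_fiberSum (measurable_jac.aestronglyMeasurable.smul
    (((measurable_fiberWeight n).aestronglyMeasurable.smul h.aestronglyMeasurable_deriv).add
      ((measurable_deriv (fiberWeight n)).aestronglyMeasurable.smul h.aestronglyMeasurable))),
    (h.eLpNorm_weightedFiberSumDeriv_le hn).trans_lt ?_⟩
  exact ENNReal.mul_lt_top (by norm_num)
    (ENNReal.add_lt_top.2 ⟨h.memLp_weight.2, h.memLp_weight_deriv.2⟩)

theorem isWeakDerivOn_weightedFiberSum (h : IsX0Pair f g) {n : ℕ} (hn : n ≤ 2) :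
    IsWeakDerivOn univ (weightedFiberSum n f) (weightedFiberSumDeriv n f g) :=
  isWeakDerivOn_fiberSum h.weakDeriv (contDiff_fiberWeight n)
    ((h.memLp_weightedFiberSum hn).locallyIntegrable one_le_two)
    ((h.memLp_weightedFiberSumDeriv hn).locallyIntegrable one_le_two)

/-- The sums over the fibres of `Theta` are bounded in `H¹` by the norm of `X₀`. -/
theorem eLpNorm_weightedFiberSum_add_le (h : IsX0Pair f g) {n : ℕ} (hn : n ≤ 2) :
    eLpNorm (weightedFiberSum n f) 2 volume + eLpNorm (weightedFiberSumDeriv n f g) 2 volume ≤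
      20 * normX0Pair f g := by
  calc _ ≤ 4 * normX0Pair f g + 16 * normX0Pair f g := by
        refine add_le_add ((h.eLpNorm_weightedFiberSum_le hn).trans ?_)
          ((h.eLpNorm_weightedFiberSumDeriv_le hn).trans ?_)
        · gcongr
          exact le_self_add.trans h.eLpNorm_weight_add_le
        · gcongr
          exact h.eLpNorm_weight_add_le
    _ = _ := by
      rw [← add_mul]
      norm_num

end IsX0Pair

end

noncomputable section

open scoped ENNReal ContDiff

/-! ### Cauchy projections of `L²` functions -/

theorem cauchyPoint_im (z ε : ℝ) :
    ((z : ℂ) + ((1 : ℝ) : ℂ) * Complex.I * (ε : ℂ)).im = ε := by simp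

theorem cauchyPoint_re (z ε : ℝ) :
    ((z : ℂ) + ((1 : ℝ) : ℂ) * Complex.I * (ε : ℂ)).re = z := by simp

theorem ae_tendsto_cauchyApprox {h : ℝ → ℂ} (hh : MemLp h 2 volume) :
    ∀ᵐ z : ℝ, Tendsto (fun ε => cauchyApprox 1 h z ε) (𝓝[>] (0 : ℝ))
      (𝓝 (hardyProj hh.toLp z)) := by
  filter_upwards [ae_tendsto_cauchyIntegral hh.toLp] with z hz
  have h1 := hz (fun ε => (z : ℂ) + ((1 : ℝ) : ℂ) * Complex.I * (ε : ℂ)) (by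
    filter_upwards [self_mem_nhdsWithin] with ε hε
    rw [cauchyPoint_im, cauchyPoint_re, sub_self, abs_zero]
    exact ⟨hε, (mem_Ioi.1 hε).le⟩) (by
    simp_rw [cauchyPoint_im]
    exact tendsto_id.mono_left nhdsWithin_le_nhds)
  exact h1.congr fun ε => cauchyIntegral_congr_ae hh.coeFn_toLp _

theorem cauchyProjExists_of_memLp {h : ℝ → ℂ} (hh : MemLp h 2 volume) : CauchyProjExists 1 h :=
  ⟨fun _ hw => integrable_div_ofReal_sub hh hw,
    (ae_tendsto_cauchyApprox hh).mono fun _ hz => ⟨_, hz⟩⟩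

theorem cauchyProj_ae_eq {h : ℝ → ℂ} (hh : MemLp h 2 volume) :
    cauchyProj 1 h =ᵐ[volume] hardyProj hh.toLp :=
  (ae_tendsto_cauchyApprox hh).mono fun _ hz => hz.limUnder_eq

theorem memLp_cauchyProj {h : ℝ → ℂ} (hh : MemLp h 2 volume) :
    MemLp (cauchyProj 1 h) 2 volume :=
  (Lp.memLp (hardyProj hh.toLp)).ae_eq (cauchyProj_ae_eq hh).symm

theorem eLpNorm_cauchyProj_le {h : ℝ → ℂ} (hh : MemLp h 2 volume) :
    eLpNorm (cauchyProj 1 h) 2 volume ≤ eLpNorm h 2 volume := by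
  rw [eLpNorm_congr_ae (cauchyProj_ae_eq hh), ← eLpNorm_congr_ae hh.coeFn_toLp]
  exact eLpNorm_hardyProj_le _

theorem MemLp.mul_chirp_Theta {f : ℝ → ℂ} (hf : MemLp f 2 volume) (x : ℝ) :
    MemLp (fun s => f s * chirp x (Theta s)) 2 volume :=
  hf.of_le (hf.1.mul ((contDiff_chirp x).continuous.measurable.comp
    measurable_Theta).aestronglyMeasurable)
    (Eventually.of_forall fun s => by rw [norm_mul, norm_chirp, mul_one])

theorem phase_one (x s : ℝ) : phase 1 x s = chirp x (Theta s) := by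
  rw [phase, chirp, Complex.ofReal_one, one_mul]

/-! ### The weighted estimate for positive `x` -/

theorem tendsto_complexTheta_im {z : ℝ} (hz : z ≠ 0) :
    Tendsto (fun ε : ℝ => (complexTheta ((z : ℂ) + ((1 : ℝ) : ℂ) * Complex.I * (ε : ℂ))).im)
      (𝓝[>] (0 : ℝ)) (𝓝 0) := by
  have hc : ContinuousAt (fun ε : ℝ =>
      (complexTheta ((z : ℂ) + ((1 : ℝ) : ℂ) * Complex.I * (ε : ℂ))).im) 0 := by
    unfold complexTheta
    refine Complex.continuous_im.continuousAt.comp (ContinuousAt.div_const (ContinuousAt.sub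
      (by fun_prop) (ContinuousAt.inv₀ (by fun_prop) ?_)) 2)
    simpa using hz
  have h1 := hc.tendsto
  simp only [complexTheta_im, cauchyPoint_im, zero_mul, zero_div] at h1
  simp only [complexTheta_im, cauchyPoint_im]
  exact h1.mono_left nhdsWithin_le_nhds

theorem normSq_cauchyPoint (z ε : ℝ) :
    Complex.normSq ((z : ℂ) + ((1 : ℝ) : ℂ) * Complex.I * (ε : ℂ)) = z ^ 2 + ε ^ 2 := by
  rw [Complex.normSq_apply, cauchyPoint_im, cauchyPoint_re]
  ring

theorem complexTheta_re (w : ℂ) :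
    (complexTheta w).re = (w.re - w.re / Complex.normSq w) / 2 := by
  have h1 : complexTheta w = ((2 : ℝ)⁻¹ : ℝ) * (w - w⁻¹) := by
    unfold complexTheta
    push_cast
    ring
  rw [h1, Complex.re_ofReal_mul, Complex.sub_re, Complex.inv_re]
  ring

/-- The real part of Θ(z+iε) is off by (ε/z) times ε/(2(z²+ε²)), and the imaginary part is at least
ε/(2(z²+ε²)). Hence the point lies in the cone once ε < |z|. -/
theorem complexTheta_nontangential {z : ℝ} (hz : z ≠ 0) : ∀ᶠ ε : ℝ in 𝓝[>] (0 : ℝ),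
    0 < (complexTheta ((z : ℂ) + ((1 : ℝ) : ℂ) * Complex.I * (ε : ℂ))).im ∧
    |(complexTheta ((z : ℂ) + ((1 : ℝ) : ℂ) * Complex.I * (ε : ℂ))).re - Theta z| ≤
      (complexTheta ((z : ℂ) + ((1 : ℝ) : ℂ) * Complex.I * (ε : ℂ))).im := by
  have hz' : 0 < |z| := abs_pos.2 hz
  filter_upwards [Ioo_mem_nhdsGT hz'] with ε hε
  obtain ⟨h0, h1⟩ := hε
  refine ⟨complexTheta_im_pos (by rwa [cauchyPoint_im]), ?_⟩
  have hn : 0 < z ^ 2 + ε ^ 2 := by positivity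
  rw [complexTheta_re, complexTheta_im, cauchyPoint_re, cauchyPoint_im, normSq_cauchyPoint, Theta]
  have e1 : (z - z / (z ^ 2 + ε ^ 2)) / 2 - (z - z⁻¹) / 2 =
      ε / z * (ε * (z ^ 2 + ε ^ 2)⁻¹ / 2) := by
    field_simp
    ring
  rw [e1, abs_mul, abs_div, abs_of_pos h0,
    abs_of_pos (by positivity : 0 < ε * (z ^ 2 + ε ^ 2)⁻¹ / 2)]
  refine (mul_le_of_le_one_left (by positivity) ((div_le_one hz').2 h1.le)).trans ?_
  have : 0 ≤ ε := h0.le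
  gcongr
  linarith

/-- Since ⟨x⟩ ≤ 1 + x, the L² contraction pays for the summand 1 and the decay estimate for the
summand x. -/
theorem ofReal_japanese_mul_eLpNorm_hardyProj_le {G G' : ℝ → ℂ} (hG : IsWeakDerivOn univ G G')
    (h2 : MemLp G 2 volume) (h2' : MemLp G' 2 volume) {x : ℝ} (hx : 0 ≤ x) :
    ENNReal.ofReal (japanese x) * eLpNorm (hardyProj (MemLp.mul_chirp h2 x).toLp) 2 volume ≤
      eLpNorm G 2 volume + eLpNorm G' 2 volume := by
  have hj : japanese x ≤ 1 + x := by
    rw [japanese, Real.sqrt_le_iff]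
    exact ⟨by linarith, by nlinarith⟩
  calc _ ≤ ENNReal.ofReal (1 + x) * eLpNorm (hardyProj (MemLp.mul_chirp h2 x).toLp) 2 volume :=
        mul_le_mul_left (ENNReal.ofReal_le_ofReal hj) _
    _ = eLpNorm (hardyProj (MemLp.mul_chirp h2 x).toLp) 2 volume +
          ENNReal.ofReal x * eLpNorm (hardyProj (MemLp.mul_chirp h2 x).toLp) 2 volume := by
        rw [ENNReal.ofReal_add zero_le_one hx, ENNReal.ofReal_one, add_mul, one_mul]
    _ ≤ _ := by
        refine add_le_add ?_ (ofReal_mul_eLpNorm_hardyProj_mul_chirp_le hG h2 h2' hx)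
        refine (eLpNorm_hardyProj_le _).trans (le_of_eq ?_)
        rw [eLpNorm_congr_ae (MemLp.mul_chirp h2 x).coeFn_toLp, eLpNorm_mul_chirp]

namespace IsX0Pair

variable {f g : ℝ → ℂ}

/-- The Cauchy projection in terms of those of the sums over the fibres of `Theta`. -/
theorem cauchyProj_eq (h : IsX0Pair f g) (x : ℝ) :
    cauchyProj 1 (fun s => f s * chirp x (Theta s)) =ᵐ[volume] fun z =>
      (1 / 2 : ℝ) • hardyProj
        (MemLp.mul_chirp (h.memLp_weightedFiberSum (n := 2) le_rfl) x).toLp (Theta z) +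
      (2 * z)⁻¹ • hardyProj
        (MemLp.mul_chirp (h.memLp_weightedFiberSum (n := 1) one_le_two) x).toLp (Theta z) := by
  set u := (MemLp.mul_chirp (h.memLp_weightedFiberSum (n := 2) le_rfl) x).toLp with hu
  set v := (MemLp.mul_chirp (h.memLp_weightedFiberSum (n := 1) one_le_two) x).toLp with hv
  filter_upwards [ae_ne_zero,
    quasiMeasurePreserving_Theta.ae (ae_tendsto_cauchyIntegral u),
    quasiMeasurePreserving_Theta.ae (ae_tendsto_cauchyIntegral v)] with z hz hzu hzv
  have h1 := hzu _ (complexTheta_nontangential hz) (tendsto_complexTheta_im hz)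
  have h2 := hzv _ (complexTheta_nontangential hz) (tendsto_complexTheta_im hz)
  have h3 : Tendsto (fun ε : ℝ => (1 / 2 : ℂ) * cauchyIntegral u
        (complexTheta ((z : ℂ) + ((1 : ℝ) : ℂ) * Complex.I * (ε : ℂ))) +
      1 / (2 * ((z : ℂ) + ((1 : ℝ) : ℂ) * Complex.I * (ε : ℂ))) * cauchyIntegral v
        (complexTheta ((z : ℂ) + ((1 : ℝ) : ℂ) * Complex.I * (ε : ℂ)))) (𝓝[>] 0)
      (𝓝 ((1 / 2 : ℂ) * hardyProj u (Theta z) + 1 / (2 * (z : ℂ)) * hardyProj v (Theta z))) := by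
    refine (h1.const_mul _).add (Tendsto.mul ?_ h2)
    have hc : ContinuousAt (fun ε : ℝ =>
        1 / (2 * ((z : ℂ) + ((1 : ℝ) : ℂ) * Complex.I * (ε : ℂ)))) 0 := by
      refine ContinuousAt.div (by fun_prop) (by fun_prop) ?_
      simpa using hz
    have h4 := hc.tendsto
    simp only [Complex.ofReal_zero, mul_zero, add_zero] at h4
    exact h4.mono_left nhdsWithin_le_nhds
  have hval : (1 / 2 : ℝ) • hardyProj u (Theta z) + (2 * z)⁻¹ • hardyProj v (Theta z) =
      (1 / 2 : ℂ) * hardyProj u (Theta z) + 1 / (2 * (z : ℂ)) * hardyProj v (Theta z) := by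
    simp only [Complex.real_smul]
    push_cast
    ring
  rw [hval]
  refine (h3.congr' ?_).limUnder_eq
  filter_upwards [self_mem_nhdsWithin] with ε hε
  rw [cauchyApprox, cauchyIntegral_mul_chirp_Theta h.memLp x
    (by rw [cauchyPoint_im]; exact hε), hu, hv,
    cauchyIntegral_congr_ae (MemLp.coeFn_toLp _), cauchyIntegral_congr_ae (MemLp.coeFn_toLp _)]
  rfl

theorem eLpNorm_japanese_mul_cauchyProj_le (h : IsX0Pair f g) {x : ℝ} (hx : 0 ≤ x) :
    eLpNorm (fun z => (japanese x : ℂ) * cauchyProj 1 (fun s => f s * chirp x (Theta s)) z)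
      2 volume ≤ 160 * normX0Pair f g := by
  have hj : 0 ≤ japanese x := Real.sqrt_nonneg _
  have hm2 := h.memLp_weightedFiberSum (n := 2) le_rfl
  have hm1 := h.memLp_weightedFiberSum (n := 1) one_le_two
  set u := hardyProj (MemLp.mul_chirp hm2 x).toLp with hu
  set v := hardyProj (MemLp.mul_chirp hm1 x).toLp with hv
  have hc1 : ∀ s : ℝ, (1 / 2 : ℝ) ^ 2 * jac s ≤ 4 := fun s => by
    rw [jac, mul_div_assoc', div_le_iff₀ (by positivity)]
    nlinarith [sq_nonneg s]
  -- The singular factor 1/(2s) is harmless in L², because `jac` vanishes to second order at the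
  -- origin.
  have hc2 : ∀ s : ℝ, ((2 * s)⁻¹) ^ 2 * jac s ≤ 4 := fun s => by
    by_cases hs : s = 0
    · simp [hs, jac]
    · rw [jac, inv_pow, ← div_eq_inv_mul, div_div, div_le_iff₀ (by positivity)]
      nlinarith [sq_nonneg s, sq_nonneg (s ^ 2)]
  have hum : AEStronglyMeasurable u volume := Lp.aestronglyMeasurable u
  have hvm : AEStronglyMeasurable v volume := Lp.aestronglyMeasurable v
  have hmeas : ∀ (c : ℝ → ℝ), Measurable c → ∀ k : ℝ → ℂ, AEStronglyMeasurable k volume →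
      AEStronglyMeasurable (fun s => c s • k (Theta s)) volume := fun c hc k hk =>
    hc.aestronglyMeasurable.smul (hk.comp_quasiMeasurePreserving quasiMeasurePreserving_Theta)
  have hcm : Measurable fun z : ℝ => (2 * z)⁻¹ := by fun_prop
  have hP : eLpNorm (cauchyProj 1 (fun s => f s * chirp x (Theta s))) 2 volume ≤
      4 * eLpNorm u 2 volume + 4 * eLpNorm v 2 volume := by
    rw [eLpNorm_congr_ae (h.cauchyProj_eq x)]
    exact (eLpNorm_add_le (hmeas (fun _ => 1 / 2) measurable_const u hum) (hmeas _ hcm v hvm)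
      one_le_two).trans (add_le_add (eLpNorm_smul_comp_Theta_le hum measurable_const hc1)
        (eLpNorm_smul_comp_Theta_le hvm hcm hc2))
  have hJ : eLpNorm (fun z => (japanese x : ℂ) * cauchyProj 1
      (fun s => f s * chirp x (Theta s)) z) 2 volume =
      ENNReal.ofReal (japanese x) * eLpNorm (cauchyProj 1
        (fun s => f s * chirp x (Theta s))) 2 volume := by
    rw [← Real.enorm_of_nonneg hj, ← eLpNorm_const_smul]
    rfl
  have hU := (ofReal_japanese_mul_eLpNorm_hardyProj_le (h.isWeakDerivOn_weightedFiberSum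
    (n := 2) le_rfl) hm2 (h.memLp_weightedFiberSumDeriv le_rfl) hx).trans
    (h.eLpNorm_weightedFiberSum_add_le le_rfl)
  have hV := (ofReal_japanese_mul_eLpNorm_hardyProj_le (h.isWeakDerivOn_weightedFiberSum
    (n := 1) one_le_two) hm1 (h.memLp_weightedFiberSumDeriv one_le_two) hx).trans
    (h.eLpNorm_weightedFiberSum_add_le one_le_two)
  rw [hJ]
  calc _ ≤ ENNReal.ofReal (japanese x) * (4 * eLpNorm u 2 volume + 4 * eLpNorm v 2 volume) := by
        gcongr
    _ = 4 * (ENNReal.ofReal (japanese x) * eLpNorm u 2 volume) +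
          4 * (ENNReal.ofReal (japanese x) * eLpNorm v 2 volume) := by ring
    _ ≤ 4 * (20 * normX0Pair f g) + 4 * (20 * normX0Pair f g) := by gcongr
    _ = _ := by ring

/-! ### The uniform estimate -/

theorem enorm_cauchyIntegral_weightedFiberSum_le (h : IsX0Pair f g) {n : ℕ} (hn : n ≤ 2) (x : ℝ)
    {w : ℂ} (hw : 0 < w.im) :
    ‖cauchyIntegral (fun y => weightedFiberSum n f y * chirp x y) w‖ₑ ≤ 20 * normX0Pair f g :=
  (enorm_cauchyIntegral_mul_chirp_le (h.isWeakDerivOn_weightedFiberSum hn)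
    (h.memLp_weightedFiberSum hn) (h.memLp_weightedFiberSumDeriv hn) x hw).trans
    (h.eLpNorm_weightedFiberSum_add_le hn)

end IsX0Pair

theorem eLpNorm_inv_sub_I_le :
    eLpNorm (fun s : ℝ => ((s : ℂ) - Complex.I)⁻¹) 2 volume ≤ 2 := by
  have hn : ∀ s : ℝ, ‖((s : ℂ) - Complex.I)⁻¹‖ₑ ^ (2 : ℝ) =
      ENNReal.ofReal (1 * ((s - 0) ^ 2 + 1 ^ 2)⁻¹) := fun s => by
    rw [← ofReal_norm, ENNReal.ofReal_rpow_of_nonneg (norm_nonneg _) zero_le_two, Real.rpow_two,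
      norm_inv, inv_pow, norm_sq_ofReal_sub, Complex.I_re, Complex.I_im, one_mul]
  rw [eLpNorm_eq_lintegral_rpow_enorm_toReal two_ne_zero ENNReal.ofNat_ne_top]
  simp only [ENNReal.toReal_ofNat]
  simp_rw [hn]
  rw [lintegral_mul_inv_sq_add_sq one_pos]
  calc (ENNReal.ofReal Real.pi) ^ (1 / 2 : ℝ) ≤ (ENNReal.ofReal (2 ^ (2 : ℝ))) ^ (1 / 2 : ℝ) := by
        gcongr
        rw [Real.rpow_two]
        linarith [Real.pi_le_four]
    _ = 2 := by
      rw [← ENNReal.ofReal_rpow_of_nonneg zero_le_two zero_le_two, ← ENNReal.rpow_mul]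
      norm_num

/-- `f / s` is integrable if `f` and `f / s` are square integrable. -/
theorem lintegral_inv_smul_le {f : ℝ → ℂ} (hf : MemLp f 2 volume)
    (hq : MemLp (fun s => s⁻¹ • f s) 2 volume) :
    ∫⁻ s, ‖s⁻¹ • f s‖ₑ ≤
      2 * (eLpNorm f 2 volume + eLpNorm (fun s => s⁻¹ • f s) 2 volume) := by
  have hqI : AEStronglyMeasurable (Complex.I • fun s => s⁻¹ • f s) volume :=
    hq.1.const_smul Complex.I
  -- f/s = (s-i)⁻¹(f - i f/s), a product of two L² functions.
  have heq : (fun s => s⁻¹ • f s) =ᵐ[volume]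
      (fun s : ℝ => ((s : ℂ) - Complex.I)⁻¹) • (f - Complex.I • fun s => s⁻¹ • f s) := by
    filter_upwards [ae_ne_zero] with s hs
    have h1 : (s : ℂ) - Complex.I ≠ 0 := ofReal_sub_ne_zero (by simp) s
    have hs' : (s : ℂ) ≠ 0 := Complex.ofReal_ne_zero.2 hs
    simp only [Pi.smul_apply', Pi.sub_apply, Pi.smul_apply, Complex.real_smul, smul_eq_mul,
      Complex.ofReal_inv]
    field_simp
  rw [← eLpNorm_one_eq_lintegral_enorm, eLpNorm_congr_ae heq]
  calc _ ≤ _ := eLpNorm_smul_le_mul_eLpNorm (p := 2) (q := 2) (hf.1.sub hqI)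
        (measurable_inv_ofReal_sub Complex.I).aestronglyMeasurable
    _ ≤ 2 * (eLpNorm f 2 volume + eLpNorm (Complex.I • fun s => s⁻¹ • f s) 2 volume) :=
        mul_le_mul' eLpNorm_inv_sub_I_le (eLpNorm_sub_le hf.1 hqI one_le_two)
    _ = _ := by
      rw [eLpNorm_const_smul, ← ofReal_norm Complex.I, Complex.norm_I, ENNReal.ofReal_one, one_mul]

/-- Division by s lowers the weight index by one. The fibre sums of f/s needed near z = 0 are thus
fibre sums of f, and f/s itself need not lie in X₀. -/
theorem weightedFiberSum_inv_smul (n : ℕ) (f : ℝ → ℂ) :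
    weightedFiberSum (n + 1) (fun s => s⁻¹ • f s) = weightedFiberSum n f := by
  have h1 : ∀ s : ℝ, s ≠ 0 → fiberWeight (n + 1) s * s⁻¹ = fiberWeight n s := fun s hs => by
    unfold fiberWeight
    field_simp
    ring
  funext y
  simp only [weightedFiberSum, fiberSum, smul_smul, h1 _ (branch_ne_zero (Or.inl rfl) y),
    h1 _ (branch_ne_zero (Or.inr rfl) y)]

/-- Splitting off the value at the origin of the Cauchy integral of `f = s * q`. -/
theorem cauchyIntegral_eq_add_mul {h q : ℝ → ℂ} (hq : Integrable q volume)
    (hq2 : MemLp q 2 volume) (hs : ∀ᵐ s : ℝ, h s = s * q s) {w : ℂ} (hw : 0 < w.im) :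
    cauchyIntegral h w =
      1 / (2 * (Real.pi : ℂ) * Complex.I) * (∫ s, q s) + w * cauchyIntegral q w := by
  rw [cauchyIntegral, cauchyIntegral, mul_left_comm w, ← mul_add, ← integral_const_mul w,
    ← integral_add hq ((integrable_div_ofReal_sub hq2 hw.ne').const_mul w)]
  congr 1
  refine integral_congr_ae ?_
  filter_upwards [hs] with s hs
  have h1 := ofReal_sub_ne_zero hw.ne' s
  rw [hs]
  field_simp
  ring

namespace IsX0Pair

variable {f g : ℝ → ℂ}

theorem norm_cauchyIntegral_weightedFiberSum_le (h : IsX0Pair f g) {n : ℕ} (hn : n ≤ 2) (x : ℝ)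
    {w : ℂ} (hw : 0 < w.im) :
    ‖cauchyIntegral (fun y => weightedFiberSum n f y * chirp x y) w‖ ≤
      20 * (normX0Pair f g).toReal := by
  have h1 := ENNReal.toReal_mono (ENNReal.mul_ne_top (by norm_num) h.normX0Pair_ne_top)
    (h.enorm_cauchyIntegral_weightedFiberSum_le hn x hw)
  rwa [toReal_enorm, ENNReal.toReal_mul, ENNReal.toReal_ofNat] at h1

/-- Here |w| ≥ 1, so both coefficients 1/2 and 1/(2w) are at most 1/2 in modulus. -/
theorem norm_cauchyApprox_le_of_one_le (h : IsX0Pair f g) (x : ℝ) {z ε : ℝ} (hz : 1 ≤ |z|)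
    (hε : 0 < ε) : ‖cauchyApprox 1 (fun s => f s * chirp x (Theta s)) z ε‖ ≤
      20 * (normX0Pair f g).toReal := by
  set w := (z : ℂ) + ((1 : ℝ) : ℂ) * Complex.I * (ε : ℂ) with hw_def
  have hw : 0 < w.im := by rwa [cauchyPoint_im]
  have hwn : 1 ≤ ‖w‖ := hz.trans (by
    rw [← cauchyPoint_re z ε]
    exact Complex.abs_re_le_norm w)
  have hW := complexTheta_im_pos hw
  have b2 := h.norm_cauchyIntegral_weightedFiberSum_le (n := 2) le_rfl x hW
  have b1 := h.norm_cauchyIntegral_weightedFiberSum_le (n := 1) one_le_two x hW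
  rw [cauchyApprox, ← hw_def, cauchyIntegral_mul_chirp_Theta h.memLp x hw]
  refine (norm_add_le _ _).trans ?_
  rw [norm_mul, norm_mul]
  have c1 : ‖(1 / 2 : ℂ)‖ = 1 / 2 := by simp
  have c2 : ‖1 / (2 * w)‖ ≤ 1 / 2 := by
    rw [norm_div, norm_one, norm_mul, Complex.norm_ofNat]
    exact one_div_le_one_div_of_le two_pos (by linarith)
  rw [c1]
  have h3 := mul_le_mul c2 b1 (norm_nonneg _) (by norm_num)
  have h4 := mul_le_mul_of_nonneg_left b2 (by norm_num : (0 : ℝ) ≤ 1 / 2)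
  unfold weightedFiberSum at h3 h4
  linarith

theorem memLp_inv_smul (h : IsX0Pair f g) (hm : MemWL2 (-1) univ f) :
    MemLp (fun s => s⁻¹ • f s) 2 volume := by
  unfold MemWL2 at hm
  rw [Measure.restrict_univ] at hm
  refine hm.of_le (measurable_inv.aestronglyMeasurable.smul h.aestronglyMeasurable)
    (Eventually.of_forall fun s => ?_)
  rw [norm_smul, norm_smul, zpow_neg_one, norm_inv, norm_inv, Real.norm_eq_abs, Real.norm_eq_abs,
    abs_abs]

theorem eLpNorm_inv_smul (f : ℝ → ℂ) :
    eLpNorm (fun s => s⁻¹ • f s) 2 volume = normWL2 (-1) univ f := by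
  unfold normWL2
  rw [Measure.restrict_univ]
  refine eLpNorm_congr_norm_ae (Eventually.of_forall fun s => ?_)
  rw [norm_smul, norm_smul, zpow_neg_one, norm_inv, norm_inv, Real.norm_eq_abs, Real.norm_eq_abs,
    abs_abs]

/-- The change of variables is applied to f/s, and the factor w in front cancels the pole 1/(2w).
The constant collects 2 from the integral of f/s and 20 + 10 from the fibre sums with indices 1 and
0. -/
theorem norm_cauchyApprox_le_of_le_one (h : IsX0Pair f g) (hm : MemWL2 (-1) univ f) (x : ℝ)
    {z ε : ℝ} (hz : |z| ≤ 1) (hε : 0 < ε) (hε1 : ε < 1) :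
    ‖cauchyApprox 1 (fun s => f s * chirp x (Theta s)) z ε‖ ≤
      32 * ((normX0Pair f g).toReal + (normWL2 (-1) univ f).toReal) := by
  set w := (z : ℂ) + ((1 : ℝ) : ℂ) * Complex.I * (ε : ℂ) with hw_def
  set N := (normX0Pair f g).toReal with hN
  set M := (normWL2 (-1) univ f).toReal with hM
  have hN0 : 0 ≤ N := ENNReal.toReal_nonneg
  have hM0 : 0 ≤ M := ENNReal.toReal_nonneg
  have hw : 0 < w.im := by rwa [cauchyPoint_im]
  have hw0 : w ≠ 0 := fun h => by rw [h] at hw; simp at hw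
  have hwn : ‖w‖ ≤ 2 := by
    refine (norm_add_le _ _).trans ?_
    simp only [Complex.norm_real, norm_mul, Complex.norm_I, Real.norm_eq_abs, abs_one,
      abs_of_pos hε]
    linarith
  have hW := complexTheta_im_pos hw
  have hq2 := h.memLp_inv_smul hm
  have hMtop : normWL2 (-1) univ f ≠ ⊤ := by
    rw [← eLpNorm_inv_smul f]
    exact hq2.2.ne
  have b1 := h.norm_cauchyIntegral_weightedFiberSum_le (n := 1) one_le_two x hW
  have b0 := h.norm_cauchyIntegral_weightedFiberSum_le (n := 0) zero_le_two x hW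
  have hint := lintegral_inv_smul_le h.memLp hq2
  rw [eLpNorm_inv_smul] at hint
  have hint2 : ∫⁻ s, ‖s⁻¹ • f s * chirp x (Theta s)‖ₑ ≤
      2 * (normX0Pair f g + normWL2 (-1) univ f) := by
    refine le_trans (le_of_eq (lintegral_congr fun s => ?_)) (hint.trans ?_)
    · rw [enorm_mul, ← ofReal_norm (chirp x (Theta s)), norm_chirp, ENNReal.ofReal_one, mul_one]
    · gcongr
      exact h.eLpNorm_le
  have hfin : 2 * (normX0Pair f g + normWL2 (-1) univ f) ≠ ⊤ :=
    ENNReal.mul_ne_top (by norm_num) (ENNReal.add_ne_top.2 ⟨h.normX0Pair_ne_top, hMtop⟩)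
  have hqc2 : MemLp (fun s => s⁻¹ • f s * chirp x (Theta s)) 2 volume :=
    MemLp.mul_chirp_Theta hq2 x
  have hqc : Integrable (fun s => s⁻¹ • f s * chirp x (Theta s)) volume :=
    ⟨hqc2.1, hint2.trans_lt hfin.lt_top⟩
  have bq : ‖∫ s, s⁻¹ • f s * chirp x (Theta s)‖ ≤ 2 * (N + M) := by
    have h1 := ENNReal.toReal_mono hfin ((enorm_integral_le_lintegral_enorm _).trans hint2)
    rwa [toReal_enorm, ENNReal.toReal_mul, ENNReal.toReal_ofNat,
      ENNReal.toReal_add h.normX0Pair_ne_top hMtop] at h1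
  have c0 : ‖1 / (2 * (Real.pi : ℂ) * Complex.I)‖ ≤ 1 := by
    rw [norm_div, norm_one, norm_mul, norm_mul, Complex.norm_I, Complex.norm_real,
      Complex.norm_ofNat, Real.norm_of_nonneg Real.pi_pos.le, mul_one]
    exact (div_le_one Real.two_pi_pos).2 (by linarith [Real.pi_gt_three])
  have e2 : weightedFiberSum 2 (fun s => s⁻¹ • f s) = weightedFiberSum 1 f :=
    weightedFiberSum_inv_smul 1 f
  have e1 : weightedFiberSum 1 (fun s => s⁻¹ • f s) = weightedFiberSum 0 f :=
    weightedFiberSum_inv_smul 0 f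
  unfold weightedFiberSum at e1 e2
  rw [cauchyApprox, ← hw_def, cauchyIntegral_eq_add_mul hqc hqc2 (by
    filter_upwards [ae_ne_zero] with s hs
    have hs' : (s : ℂ) ≠ 0 := Complex.ofReal_ne_zero.2 hs
    rw [Complex.real_smul, Complex.ofReal_inv]
    field_simp) hw, cauchyIntegral_mul_chirp_Theta hq2 x hw, e1, e2]
  set C1 := cauchyIntegral (fun y => fiberSum (fun s => fiberWeight 1 s • f s) y * chirp x y)
    (complexTheta w) with hC1
  set C0 := cauchyIntegral (fun y => fiberSum (fun s => fiberWeight 0 s • f s) y * chirp x y)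
    (complexTheta w) with hC0
  have e3 : w * (1 / 2 * C1 + 1 / (2 * w) * C0) = w * (1 / 2) * C1 + 1 / 2 * C0 := by
    field_simp
  rw [e3]
  have c1 : ‖(1 / 2 : ℂ)‖ = 1 / 2 := by simp
  have t1 : ‖w * (1 / 2) * C1‖ ≤ 20 * N := by
    rw [norm_mul, norm_mul, c1]
    have : ‖w‖ * (1 / 2) ≤ 1 := by linarith
    exact (mul_le_of_le_one_left (norm_nonneg _) this).trans b1
  have t2 : ‖1 / 2 * C0‖ ≤ 10 * N := by
    rw [norm_mul, c1]
    have : ‖C0‖ ≤ 20 * N := b0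
    linarith
  have t3 : ‖1 / (2 * (Real.pi : ℂ) * Complex.I) * ∫ s, s⁻¹ • f s * chirp x (Theta s)‖ ≤
      2 * (N + M) := by
    rw [norm_mul]
    exact (mul_le_of_le_one_left (norm_nonneg _) c0).trans bq
  calc _ ≤ 2 * (N + M) + (20 * N + 10 * N) :=
        (norm_add_le _ _).trans (add_le_add t3 ((norm_add_le _ _).trans (add_le_add t1 t2)))
    _ ≤ _ := by linarith

/-- The bounds hold for all small ε at every z, so they pass to the limit wherever it exists. -/
theorem eLpNorm_top_cauchyProj_le (h : IsX0Pair f g) (hm : MemWL2 (-1) univ f) (x : ℝ) :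
    eLpNorm (cauchyProj 1 (fun s => f s * chirp x (Theta s))) ⊤ volume ≤
      32 * (normX0Pair f g + normWL2 (-1) univ f) := by
  have hMtop : normWL2 (-1) univ f ≠ ⊤ := by
    rw [← eLpNorm_inv_smul f]
    exact (h.memLp_inv_smul hm).2.ne
  have hN0 : 0 ≤ (normX0Pair f g).toReal := ENNReal.toReal_nonneg
  have hM0 : 0 ≤ (normWL2 (-1) univ f).toReal := ENNReal.toReal_nonneg
  have hconst : (32 : ℝ≥0∞) * (normX0Pair f g + normWL2 (-1) univ f) =
      ENNReal.ofReal (32 * ((normX0Pair f g).toReal + (normWL2 (-1) univ f).toReal)) := by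
    rw [ENNReal.ofReal_mul (by norm_num), ENNReal.ofReal_ofNat, ENNReal.ofReal_add hN0 hM0,
      ENNReal.ofReal_toReal h.normX0Pair_ne_top, ENNReal.ofReal_toReal hMtop]
  rw [hconst, eLpNorm_exponent_top]
  refine eLpNormEssSup_le_of_ae_bound ?_
  filter_upwards [ae_tendsto_cauchyApprox (MemLp.mul_chirp_Theta h.memLp x)] with z hz
  rw [cauchyProj, hz.limUnder_eq]
  refine le_of_tendsto hz.norm ?_
  filter_upwards [Ioo_mem_nhdsGT one_pos] with ε hε
  rcases le_total |z| 1 with h1 | h1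
  · exact h.norm_cauchyApprox_le_of_le_one hm x h1 hε.1 hε.2
  · exact (h.norm_cauchyApprox_le_of_one_le x h1 hε.1).trans (by linarith)

end IsX0Pair

end

noncomputable section

open scoped ENNReal ContDiff ComplexConjugate

/-! ### The `L²` estimate with the factor `s - s⁻¹` -/

theorem memLp_sub_inv_mul {f : ℝ → ℂ} (hf : MemL21 f) (hm : MemWL2 (-1) univ f) :
    MemLp (fun s : ℝ => ((s - s⁻¹ : ℝ) : ℂ) * f s) 2 volume ∧
      eLpNorm (fun s : ℝ => ((s - s⁻¹ : ℝ) : ℂ) * f s) 2 volume ≤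
        normL21 f + normWL2 (-1) univ f := by
  have h1 : MemLp (fun s : ℝ => (|s| ^ (1 : ℤ) : ℝ) • f s) 2 volume := by
    have := hf.1
    rwa [MemWL2, Measure.restrict_univ] at this
  have h2 : MemLp (fun s : ℝ => (|s| ^ (-1 : ℤ) : ℝ) • f s) 2 volume := by
    rwa [MemWL2, Measure.restrict_univ] at hm
  have n1 : ∀ s : ℝ, ‖s • f s‖ = ‖(|s| ^ (1 : ℤ) : ℝ) • f s‖ := fun s => by
    rw [norm_smul, norm_smul, zpow_one, Real.norm_eq_abs, Real.norm_eq_abs, abs_abs]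
  have n2 : ∀ s : ℝ, ‖s⁻¹ • f s‖ = ‖(|s| ^ (-1 : ℤ) : ℝ) • f s‖ := fun s => by
    rw [norm_smul, norm_smul, zpow_neg_one, norm_inv, norm_inv, Real.norm_eq_abs,
      Real.norm_eq_abs, abs_abs]
  have m1 : MemLp (fun s : ℝ => s • f s) 2 volume :=
    h1.of_le (measurable_id.aestronglyMeasurable.smul hf.2.1)
      (Eventually.of_forall fun s => (n1 s).le)
  have m2 : MemLp (fun s : ℝ => s⁻¹ • f s) 2 volume :=
    h2.of_le (measurable_inv.aestronglyMeasurable.smul hf.2.1)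
      (Eventually.of_forall fun s => (n2 s).le)
  have heq : (fun s : ℝ => ((s - s⁻¹ : ℝ) : ℂ) * f s) =
      (fun s : ℝ => s • f s) - fun s : ℝ => s⁻¹ • f s := by
    funext s
    rw [Pi.sub_apply, ← sub_smul, Complex.real_smul]
  rw [heq]
  refine ⟨m1.sub m2, (eLpNorm_sub_le m1.1 m2.1 one_le_two).trans (add_le_add ?_ ?_)⟩
  · rw [eLpNorm_congr_norm_ae (Eventually.of_forall n1), normL21, normWL2, Measure.restrict_univ]
    exact le_self_add
  · rw [eLpNorm_congr_norm_ae (Eventually.of_forall n2), normWL2, Measure.restrict_univ]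

/-! ### Complex conjugation -/

theorem norm_conj_apply (f : ℝ → ℂ) (s : ℝ) : ‖conj (f s)‖ = ‖f s‖ := RCLike.norm_conj _

theorem memLp_conj {f : ℝ → ℂ} {p : ℝ≥0∞} {μ : Measure ℝ} (hf : MemLp f p μ) :
    MemLp (fun s => conj (f s)) p μ := hf.star

theorem eLpNorm_conj_apply (f : ℝ → ℂ) (p : ℝ≥0∞) (μ : Measure ℝ) :
    eLpNorm (fun s => conj (f s)) p μ = eLpNorm f p μ :=
  eLpNorm_congr_norm_ae (Eventually.of_forall (norm_conj_apply f))

theorem conj_real_smul (r : ℝ) (c : ℂ) : conj (r • c) = r • conj c := by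
  rw [Complex.real_smul, Complex.real_smul, map_mul, Complex.conj_ofReal]

theorem memWL2_conj {m : ℤ} {S : Set ℝ} {f : ℝ → ℂ} (hf : MemWL2 m S f) :
    MemWL2 m S fun s => conj (f s) := by
  unfold MemWL2 at hf ⊢
  simp_rw [← conj_real_smul]
  exact memLp_conj hf

theorem normWL2_conj (m : ℤ) (S : Set ℝ) (f : ℝ → ℂ) :
    normWL2 m S (fun s => conj (f s)) = normWL2 m S f := by
  unfold normWL2
  simp_rw [← conj_real_smul]
  exact eLpNorm_conj_apply _ _ _

theorem locallyIntegrableOn_conj {U : Set ℝ} {f : ℝ → ℂ} (hf : LocallyIntegrableOn f U volume) :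
    LocallyIntegrableOn (fun s => conj (f s)) U volume := fun x hx => by
  obtain ⟨t, ht, hi⟩ := hf x hx
  exact ⟨t, ht, Complex.conjCLE.toContinuousLinearMap.integrable_comp hi⟩

theorem IsWeakDerivOn.conj {U : Set ℝ} {f g : ℝ → ℂ} (h : IsWeakDerivOn U f g) :
    IsWeakDerivOn U (fun s => conj (f s)) fun s => conj (g s) := by
  refine ⟨locallyIntegrableOn_conj h.1, locallyIntegrableOn_conj h.2.1, fun φ hφ hφc hφU => ?_⟩
  simp_rw [← conj_real_smul]
  rw [integral_conj, integral_conj, h.2.2 φ hφ hφc hφU, map_neg]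

/-- This is the benefit of carrying the derivative as a separate argument: `wDeriv` is a choice, and
the choice for the conjugate of f need not be literally the conjugate of the choice for f. -/
theorem IsX0Pair.conj {f g : ℝ → ℂ} (h : IsX0Pair f g) :
    IsX0Pair (fun s => conj (f s)) fun s => conj (g s) where
  weakDeriv := h.weakDeriv.conj
  outer := memLp_conj h.outer
  outer_deriv := memLp_conj h.outer_deriv
  inner_deriv := memWL2_conj h.inner_deriv
  inner := memWL2_conj h.inner

theorem normX0Pair_conj (f g : ℝ → ℂ) :
    normX0Pair (fun s => conj (f s)) (fun s => conj (g s)) = normX0Pair f g := by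
  simp only [normX0Pair, eLpNorm_conj_apply, normWL2_conj]

theorem memL21_conj {f : ℝ → ℂ} (hf : MemL21 f) : MemL21 fun s => conj (f s) :=
  ⟨memWL2_conj hf.1, memLp_conj hf.2⟩

theorem normL21_conj (f : ℝ → ℂ) : normL21 (fun s => conj (f s)) = normL21 f := by
  simp only [normL21, eLpNorm_conj_apply, normWL2_conj]

theorem conj_phase_neg_one (x s : ℝ) : conj (phase (-1) x s) = chirp x (Theta s) := by
  rw [phase, chirp, ← Complex.exp_conj]
  simp

/-- Conjugation reflects the pole in the real axis and changes the sign of 1/(2πi). -/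
theorem cauchyApprox_neg_one (h : ℝ → ℂ) (z ε : ℝ) :
    cauchyApprox (-1) h z ε = -conj (cauchyApprox 1 (fun s => conj (h s)) z ε) := by
  unfold cauchyApprox cauchyIntegral
  rw [map_mul, ← integral_conj, ← neg_mul]
  congr 1
  · simp [Complex.conj_ofNat]
  · refine integral_congr_ae (Eventually.of_forall fun s => ?_)
    simp

/-- The projection `𝒫⁻` of `h` is minus the conjugate of `𝒫⁺` of the conjugate of `h`. -/
theorem cauchyProj_neg_one {h k : ℝ → ℂ} (hk : ∀ s, conj (h s) = k s)
    (hex : CauchyProjExists 1 k) :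
    CauchyProjExists (-1) h ∧
      cauchyProj (-1) h =ᵐ[volume] fun z => -conj (cauchyProj 1 k z) := by
  obtain rfl : (fun s => conj (h s)) = k := funext hk
  have hlim : ∀ z l, Tendsto (fun ε => cauchyApprox 1 (fun s => conj (h s)) z ε) (𝓝[>] (0 : ℝ))
      (𝓝 l) → Tendsto (fun ε => cauchyApprox (-1) h z ε) (𝓝[>] (0 : ℝ)) (𝓝 (-conj l)) :=
    fun z l hl => by
      simp_rw [cauchyApprox_neg_one]
      exact ((Complex.continuous_conj.tendsto l).comp hl).neg
  refine ⟨⟨fun w hw => ?_, ?_⟩, ?_⟩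
  · have h1 := hex.1 (conj w) (by simpa using hw)
    refine (Complex.conjCLE.toContinuousLinearMap.integrable_comp h1).congr
      (Eventually.of_forall fun s => ?_)
    simp
  · filter_upwards [hex.2] with z hz
    obtain ⟨l, hl⟩ := hz
    exact ⟨_, hlim z l hl⟩
  · filter_upwards [hex.2] with z hz
    obtain ⟨l, hl⟩ := hz
    rw [cauchyProj, cauchyProj, (hlim z l hl).limUnder_eq, hl.limUnder_eq]

theorem memLp_cauchyProj_neg_one {h k : ℝ → ℂ} (hk : ∀ s, conj (h s) = k s)
    (hex : CauchyProjExists 1 k) {p : ℝ≥0∞} (hp : MemLp (cauchyProj 1 k) p volume) :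
    MemLp (cauchyProj (-1) h) p volume :=
  (memLp_conj hp).neg.ae_eq (cauchyProj_neg_one hk hex).2.symm

theorem eLpNorm_const_mul_cauchyProj_neg_one {h k : ℝ → ℂ} (hk : ∀ s, conj (h s) = k s)
    (hex : CauchyProjExists 1 k) (c : ℂ) (p : ℝ≥0∞) :
    eLpNorm (fun z => c * cauchyProj (-1) h z) p volume =
      eLpNorm (fun z => c * cauchyProj 1 k z) p volume := by
  refine eLpNorm_congr_norm_ae ?_
  filter_upwards [(cauchyProj_neg_one hk hex).2] with z hz
  rw [hz, norm_mul, norm_mul, norm_neg, RCLike.norm_conj]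

theorem eLpNorm_cauchyProj_neg_one {h k : ℝ → ℂ} (hk : ∀ s, conj (h s) = k s)
    (hex : CauchyProjExists 1 k) (p : ℝ≥0∞) :
    eLpNorm (cauchyProj (-1) h) p volume = eLpNorm (cauchyProj 1 k) p volume := by
  simpa only [one_mul] using eLpNorm_const_mul_cauchyProj_neg_one hk hex 1 p

/-! ### The three estimates for both projections -/

theorem IsX0Pair.weighted_estimate {f g : ℝ → ℂ} (h : IsX0Pair f g) {σ : ℝ}
    (hσ : σ = 1 ∨ σ = -1) {x : ℝ} (hx : 0 ≤ x) :
    CauchyProjExists σ (fun s => f s * phase σ x s) ∧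
      MemLp (cauchyProj σ (fun s => f s * phase σ x s)) 2 volume ∧
      eLpNorm (fun z => (japanese x : ℂ) * cauchyProj σ (fun s => f s * phase σ x s) z) 2 volume ≤
        160 * normX0Pair f g := by
  rcases hσ with rfl | rfl
  · have hL := MemLp.mul_chirp_Theta h.memLp x
    simp_rw [phase_one]
    exact ⟨cauchyProjExists_of_memLp hL, memLp_cauchyProj hL,
      h.eLpNorm_japanese_mul_cauchyProj_le hx⟩
  · have hL := MemLp.mul_chirp_Theta h.conj.memLp x
    have hex := cauchyProjExists_of_memLp hL
    have hk : ∀ s, conj (f s * phase (-1) x s) = conj (f s) * chirp x (Theta s) := fun s => by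
      rw [map_mul, conj_phase_neg_one]
    refine ⟨(cauchyProj_neg_one hk hex).1, memLp_cauchyProj_neg_one hk hex (memLp_cauchyProj hL),
      ?_⟩
    rw [eLpNorm_const_mul_cauchyProj_neg_one hk hex, ← normX0Pair_conj f g]
    exact h.conj.eLpNorm_japanese_mul_cauchyProj_le hx

theorem IsX0Pair.uniform_estimate {f g : ℝ → ℂ} (h : IsX0Pair f g) (hm : MemWL2 (-1) univ f)
    {σ : ℝ} (hσ : σ = 1 ∨ σ = -1) (x : ℝ) :
    CauchyProjExists σ (fun s => f s * phase σ x s) ∧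
      MemLp (cauchyProj σ (fun s => f s * phase σ x s)) ⊤ volume ∧
      eLpNorm (cauchyProj σ (fun s => f s * phase σ x s)) ⊤ volume ≤
        32 * (normX0Pair f g + normWL2 (-1) univ f) := by
  have core : ∀ {f g : ℝ → ℂ}, IsX0Pair f g → MemWL2 (-1) univ f →
      CauchyProjExists 1 (fun s => f s * chirp x (Theta s)) ∧
      MemLp (cauchyProj 1 (fun s => f s * chirp x (Theta s))) ⊤ volume ∧
      eLpNorm (cauchyProj 1 (fun s => f s * chirp x (Theta s))) ⊤ volume ≤
        32 * (normX0Pair f g + normWL2 (-1) univ f) := fun {f g} h hm => by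
    have hL := MemLp.mul_chirp_Theta h.memLp x
    have hb := h.eLpNorm_top_cauchyProj_le hm x
    refine ⟨cauchyProjExists_of_memLp hL, ⟨(memLp_cauchyProj hL).1, hb.trans_lt ?_⟩, hb⟩
    have hMtop : normWL2 (-1) univ f < ⊤ := hm.2
    exact ENNReal.mul_lt_top (by norm_num)
      (ENNReal.add_lt_top.2 ⟨h.normX0Pair_ne_top.lt_top, hMtop⟩)
  rcases hσ with rfl | rfl
  · simp_rw [phase_one]
    exact core h hm
  · obtain ⟨hex, hp, hb⟩ := core h.conj (memWL2_conj hm)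
    have hk : ∀ s, conj (f s * phase (-1) x s) = conj (f s) * chirp x (Theta s) := fun s => by
      rw [map_mul, conj_phase_neg_one]
    refine ⟨(cauchyProj_neg_one hk hex).1, memLp_cauchyProj_neg_one hk hex hp, ?_⟩
    rwa [eLpNorm_cauchyProj_neg_one hk hex, ← normX0Pair_conj f g, ← normWL2_conj (-1) univ f]

theorem MemL21.estimate {f : ℝ → ℂ} (hf : MemL21 f) (hm : MemWL2 (-1) univ f) {σ : ℝ}
    (hσ : σ = 1 ∨ σ = -1) (x : ℝ) :
    CauchyProjExists σ (fun s => ((s - s⁻¹ : ℝ) : ℂ) * f s * phase σ x s) ∧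
      MemLp (cauchyProj σ (fun s => ((s - s⁻¹ : ℝ) : ℂ) * f s * phase σ x s)) 2 volume ∧
      eLpNorm (cauchyProj σ (fun s => ((s - s⁻¹ : ℝ) : ℂ) * f s * phase σ x s)) 2 volume ≤
        normL21 f + normWL2 (-1) univ f := by
  have core : ∀ {f : ℝ → ℂ}, MemL21 f → MemWL2 (-1) univ f →
      CauchyProjExists 1 (fun s => ((s - s⁻¹ : ℝ) : ℂ) * f s * chirp x (Theta s)) ∧
      MemLp (cauchyProj 1 (fun s => ((s - s⁻¹ : ℝ) : ℂ) * f s * chirp x (Theta s))) 2 volume ∧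
      eLpNorm (cauchyProj 1 (fun s => ((s - s⁻¹ : ℝ) : ℂ) * f s * chirp x (Theta s))) 2 volume ≤
        normL21 f + normWL2 (-1) univ f := fun {f} hf hm => by
    obtain ⟨hk, hb⟩ := memLp_sub_inv_mul hf hm
    have hL := MemLp.mul_chirp_Theta hk x
    refine ⟨cauchyProjExists_of_memLp hL, memLp_cauchyProj hL,
      (eLpNorm_cauchyProj_le hL).trans (le_trans (le_of_eq ?_) hb)⟩
    exact eLpNorm_congr_norm_ae (Eventually.of_forall fun s => by
      rw [norm_mul _ (chirp x (Theta s)), norm_chirp, mul_one])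
  rcases hσ with rfl | rfl
  · simp_rw [phase_one]
    exact core hf hm
  · obtain ⟨hex, hp, hb⟩ := core (memL21_conj hf) (memWL2_conj hm)
    have hk : ∀ s : ℝ, conj (((s - s⁻¹ : ℝ) : ℂ) * f s * phase (-1) x s) =
        ((s - s⁻¹ : ℝ) : ℂ) * conj (f s) * chirp x (Theta s) := fun s => by
      rw [map_mul, map_mul, conj_phase_neg_one, Complex.conj_ofReal]
    refine ⟨(cauchyProj_neg_one hk hex).1, memLp_cauchyProj_neg_one hk hex hp, ?_⟩
    rwa [eLpNorm_cauchyProj_neg_one hk hex, ← normL21_conj f, ← normWL2_conj (-1) univ f]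

end

/-! ### The three estimates with a common constant -/

theorem lemmap :
    ∃ C : ℝ, 0 < C ∧ ∀ σ : ℝ, (σ = 1 ∨ σ = -1) →
      (∀ x₀ : ℝ, 0 < x₀ → ∀ f : ℝ → ℂ, MemX0 f →
        (∀ x : ℝ, x₀ < x →
          CauchyProjExists σ (fun s => f s * phase σ x s) ∧
          MemLp (cauchyProj σ (fun s => f s * phase σ x s)) 2 volume) ∧
        (⨆ x ∈ Set.Ioi x₀,
          eLpNorm (fun z => (japanese x : ℂ) * cauchyProj σ (fun s => f s * phase σ x s) z)
            2 volume) ≤ ENNReal.ofReal C * normX0 f) ∧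
      (∀ f : ℝ → ℂ, MemX0 f → MemWL2 (-1) Set.univ f →
        (∀ x : ℝ,
          CauchyProjExists σ (fun s => f s * phase σ x s) ∧
          MemLp (cauchyProj σ (fun s => f s * phase σ x s)) ⊤ volume) ∧
        (⨆ x : ℝ, eLpNorm (cauchyProj σ (fun s => f s * phase σ x s)) ⊤ volume) ≤
          ENNReal.ofReal C * (normX0 f + normWL2 (-1) Set.univ f)) ∧
      (∀ f : ℝ → ℂ, MemL21 f → MemWL2 (-1) Set.univ f →
        (∀ x : ℝ,
          CauchyProjExists σ (fun s => ((s - s⁻¹ : ℝ) : ℂ) * f s * phase σ x s) ∧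
          MemLp (cauchyProj σ (fun s => ((s - s⁻¹ : ℝ) : ℂ) * f s * phase σ x s)) 2 volume) ∧
        (⨆ x : ℝ, eLpNorm (cauchyProj σ
            (fun s => ((s - s⁻¹ : ℝ) : ℂ) * f s * phase σ x s)) 2 volume) ≤
          ENNReal.ofReal C * (normL21 f + normWL2 (-1) Set.univ f)) := by
  -- The constants of the three estimates are 160, 32 and 1; the first equals 2·4·20, for two fibre
  -- sums, composition with Θ, and the H¹ bound.
  refine ⟨160, by norm_num, fun σ hσ => ⟨fun x₀ hx₀ f hf => ⟨fun x hx => ?_, ?_⟩,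
    fun f hf hm => ⟨fun x => ?_, ?_⟩, fun f hf hm => ⟨fun x => ?_, ?_⟩⟩⟩
  · have h := hf.isX0Pair.weighted_estimate hσ (hx₀.trans hx).le
    exact ⟨h.1, h.2.1⟩
  · rw [ENNReal.ofReal_ofNat, ← normX0Pair_wDeriv]
    exact iSup₂_le fun x hx => (hf.isX0Pair.weighted_estimate hσ (hx₀.trans hx).le).2.2
  · have h := hf.isX0Pair.uniform_estimate hm hσ x
    exact ⟨h.1, h.2.1⟩
  · rw [ENNReal.ofReal_ofNat, ← normX0Pair_wDeriv]
    refine iSup_le fun x => (hf.isX0Pair.uniform_estimate hm hσ x).2.2.trans ?_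
    gcongr
    norm_num
  · have h := hf.estimate hm hσ x
    exact ⟨h.1, h.2.1⟩
  · rw [ENNReal.ofReal_ofNat]
    refine iSup_le fun x => (hf.estimate hm hσ x).2.2.trans ?_
    exact le_mul_of_one_le_left zero_le (by norm_num)
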